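/- All vector spaces are over $\mathbb C$ and "graded" means $\mathbb Z/2$-graded; for homogeneous $u,v$ of degrees $|u|,|v|$ put $\varepsilon_{u,v}=(-1)^{|u||v|}$. A *vertex superalgebra* is a graded space $V$ with a vector $\mathbf 1$, a linear operator $D$ and bilinear products $u_nv$ ($n\in\mathbb Z$), written $Y(u,z)=\sum_{n\in\mathbb Z}u_nz^{-n-1}$, such that, for all $u,v$: $u_nv=0$ for $n$ sufficiently large; $[D,Y(u,z)]=Y(Du,z)=\frac{d}{dz}Y(u,z)$; $Y(\mathbf 1,z)=\mathrm{id}_V$; $u_n\mathbf 1=0$ for $n\ge 0$ and $u_{-1}\mathbf 1=u$; for homogeneous $u,v$ one has $|u_nv|=|u|+|v|$ and the Jacobi identity $$z_0^{-1}\delta\Big(\tfrac{z_1-z_2}{z_0}\Big)Y(u,z_1)Y(v,z_2)-\varepsilon_{u,v}z_0^{-1}\delta\Big(\tfrac{z_2-z_1}{-z_0}\Big)Y(v,z_2)Y(u,z_1)=z_2^{-1}\delta\Big(\tfrac{z_1-z_0}{z_2}\Big)Y(Y(u,z_0)v,z_2).$$ A homomorphism of vertex superalgebras is a linear map that preserves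 the grading, all the products and the vacuum vector. A *vertex Lie superalgebra* is a graded space $U$ with an even linear operator $D$ and bilinear products $u_nv$ ($n\ge 0$), written $Y(u,z)=\sum_{n\ge 0}u_nz^{-n-1}$, such that, for all $u,v$: $u_nv=0$ for $n$ sufficiently large; $[D,Y(u,z)]=Y(Du,z)=\frac{d}{dz}Y(u,z)$; and, for homogeneous $u,v$: $|u_nv|=|u|+|v|$; the half skew symmetry $u_nv=-\varepsilon_{u,v}\sum_{k\ge 0}(-1)^{n+k}\frac{D^k}{k!}v_{n+k}u$ holds for all $n\ge 0$; and the half Jacobi identity holds, that is, the two sides of the Jacobi identity above have equal coefficients at $z_0^{-k-1}z_1^{-m-1}z_2^{-n-1}$ for all $k,m,n\ge 0$. A homomorphism of vertex Lie superalgebras is a linear map that preserves the grading and all the products and commutes with $D$. Every vertex superalgebra is a vertex Lie superalgebra if one forgets $\mathbf 1$ and the products $u_nv$ with $n<0$. Let $U$ be a vertex Lie superalgebra. Let $\mathcal L(U)$ be the quotient of $U\otimes\mathbb C[q,q^{-1}]$ by the span of all $(Du)_n+n\,u_{n-1}$ ($u\in U$, $n\in\mathbb Z$), where $u_n=u\otimes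 q^n$. It is a Lie superalgebra with $[u_n,v_p]=\sum_{i\ge 0}\binom ni(u_iv)_{n+p-i}$. Let $\mathcal L_+(U)$ be the subalgebra spanned by the $u_n$ with $n\ge 0$, and let $$\mathcal V(U)=\mathcal U(\mathcal L(U))\otimes_{\mathcal U(\mathcal L_+(U))}\mathbb C,$$ where $\mathcal U$ is the universal enveloping algebra of a Lie superalgebra and $\mathbb C$ is the trivial $\mathcal L_+(U)$-module. Put $\mathbf 1=1\otimes 1$ and $\kappa_U(u)=u_{-1}\mathbf 1$ for $u\in U$. **Theorem.** On $\mathcal V(U)$, with its natural grading, there is a unique vertex superalgebra structure with vacuum vector $\mathbf 1$, with the derivation $D$ determined by $D\mathbf 1=0$ and $[D,u_n]=(Du)_n$, and with $Y(\kappa_U(u),z)=\sum_{n\in\mathbb Z}u_nz^{-n-1}$ for all $u\in U$, where $u_n\in\mathcal L(U)$ acts on $\mathcal V(U)$ by left multiplication. The map $\kappa_U:U\to\mathcal V(U)$ is an injective homomorphism of vertex Lie superalgebras, and for every vertex superalgebra $V$ and every homomorphism of vertex Lie superalgebras $\varphi:U\to V$ there is a unique homomorphism of vertex superalgebras $\tilde\varphi:\mathcal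 V(U)\to V$ with $\tilde\varphi\circ\kappa_U=\varphi$. In this sense $\mathcal V(U)$ is the universal enveloping vertex superalgebra of $U$. -/

import Mathlib

open scoped TensorProduct

noncomputable section

/-- The sign `ε_{u,v} = (-1)^{|u||v|}` for homogeneous `u`, `v` of degrees `a`, `b`. -/
def superSign (a b : ZMod 2) : ℂ := (-1) ^ (a.val * b.val)

/-- The generalized binomial coefficient `n(n-1)⋯(n-i+1)/i!` for an integer `n`, as a complex
number. -/
def intChoose (n : ℤ) (i : ℕ) : ℂ := ((Ring.choose n i : ℤ) : ℂ)

/-- A vertex superalgebra structure on the complex vector space `V`; `mul n u v` is `u_n v`, where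
`Y(u,z) = ∑ u_n z^{-n-1}`. All identities of formal series are written by coefficients; `jacobi`
is the coefficient of `z₀^{-k-1} z₁^{-m-1} z₂^{-n-1}` in the Jacobi identity, applied to `w`
(by `truncation` both sums are finite). -/
structure VertexSuperalgebra (V : Type*) [AddCommGroup V] [Module ℂ V] where
  /-- the `ℤ/2`-grading -/
  grading : ZMod 2 → Submodule ℂ V
  isInternal : DirectSum.IsInternal grading
  /-- the vacuum vector -/
  vac : V
  /-- the derivation -/
  D : V →ₗ[ℂ] V
  /-- the products `u_n v` -/
  mul : ℤ → V →ₗ[ℂ] V →ₗ[ℂ] V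
  truncation : ∀ u v, ∃ N : ℤ, ∀ n : ℤ, N ≤ n → mul n u v = 0
  D_comm : ∀ n u v, D (mul n u v) - mul n u (D v) = mul n (D u) v
  mul_D : ∀ n u v, mul n (D u) v = -(n : ℂ) • mul (n - 1) u v
  vac_mul : ∀ n v, mul n vac v = if n = -1 then v else 0
  mul_vac_nonneg : ∀ n : ℤ, 0 ≤ n → ∀ u, mul n u vac = 0
  mul_vac : ∀ u, mul (-1) u vac = u
  jacobi : ∀ (a b : ZMod 2) (u v : V), u ∈ grading a → v ∈ grading b →
    ∀ (k m n : ℤ) (w : V),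
      ∑ᶠ i : ℕ, ((-1) ^ i * intChoose k i) •
          (mul (m + k - i) u (mul (n + i) v w) -
            (superSign a b * (-1) ^ k) • mul (n + k - i) v (mul (m + i) u w)) =
        ∑ᶠ i : ℕ, intChoose m i • mul (m + n - i) (mul (k + i) u v) w
  homog : ∀ (a b : ZMod 2) (u v : V), u ∈ grading a → v ∈ grading b →
    ∀ n, mul n u v ∈ grading (a + b)

/-- A vertex Lie superalgebra structure on the complex vector space `U`; `mul n u v` is `u_n v`
for `n ≥ 0`, where `Y(u,z) = ∑_{n ≥ 0} u_n z^{-n-1}`. The half skew symmetry and the half Jacobi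
identity are written by coefficients: in `skew` that of `z^{-n-1}`, in `jacobi` that of
`z₀^{-k-1} z₁^{-m-1} z₂^{-n-1}` with `k, m, n ≥ 0`, applied to `w`. -/
structure VertexLieSuperalgebra (U : Type*) [AddCommGroup U] [Module ℂ U] where
  /-- the `ℤ/2`-grading -/
  grading : ZMod 2 → Submodule ℂ U
  isInternal : DirectSum.IsInternal grading
  /-- the derivation -/
  D : U →ₗ[ℂ] U
  D_even : ∀ a, ∀ u ∈ grading a, D u ∈ grading a
  /-- the products `u_n v`, `n ≥ 0` -/
  mul : ℕ → U →ₗ[ℂ] U →ₗ[ℂ] U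
  truncation : ∀ u v, ∃ N : ℕ, ∀ n : ℕ, N ≤ n → mul n u v = 0
  D_comm : ∀ n u v, D (mul n u v) - mul n u (D v) = mul n (D u) v
  mul_D_zero : ∀ u v, mul 0 (D u) v = 0
  mul_D_succ : ∀ (n : ℕ) (u v : U), mul (n + 1) (D u) v = -((n : ℂ) + 1) • mul n u v
  skew : ∀ (a b : ZMod 2) (u v : U), u ∈ grading a → v ∈ grading b → ∀ n : ℕ,
    mul n u v = -superSign a b •
      ∑ᶠ k : ℕ, ((-1) ^ (n + k) / (k.factorial : ℂ)) • (D ^ k) (mul (n + k) v u)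
  jacobi : ∀ (a b : ZMod 2) (u v : U), u ∈ grading a → v ∈ grading b →
    ∀ (k m n : ℕ) (w : U),
      ∑ i ∈ Finset.range (k + 1), ((-1) ^ i * (k.choose i : ℂ)) •
          (mul (m + k - i) u (mul (n + i) v w) -
            (superSign a b * (-1) ^ k) • mul (n + k - i) v (mul (m + i) u w)) =
        ∑ i ∈ Finset.range (m + 1), (m.choose i : ℂ) • mul (m + n - i) (mul (k + i) u v) w
  homog : ∀ (a b : ZMod 2) (u v : U), u ∈ grading a → v ∈ grading b →
    ∀ n, mul n u v ∈ grading (a + b)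

/-- Homomorphisms of vertex superalgebras: linear maps that preserve the grading, all products and
the vacuum vector (they commute with the derivations, since `D u = u_{-2} 1`). -/
structure VertexSuperalgebra.Hom {V W : Type*} [AddCommGroup V] [Module ℂ V] [AddCommGroup W]
    [Module ℂ W] (S : VertexSuperalgebra V) (T : VertexSuperalgebra W) where
  toLinearMap : V →ₗ[ℂ] W
  map_grading : ∀ a, ∀ v ∈ S.grading a, toLinearMap v ∈ T.grading a
  map_mul : ∀ n u v, toLinearMap (S.mul n u v) = T.mul n (toLinearMap u) (toLinearMap v)
  map_vac : toLinearMap S.vac = T.vac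

/-- Homomorphisms of vertex Lie superalgebras: linear maps that preserve the grading and all
products and commute with the derivations. -/
structure VertexLieSuperalgebra.Hom {V W : Type*} [AddCommGroup V] [Module ℂ V] [AddCommGroup W]
    [Module ℂ W] (S : VertexLieSuperalgebra V) (T : VertexLieSuperalgebra W) where
  toLinearMap : V →ₗ[ℂ] W
  map_grading : ∀ a, ∀ v ∈ S.grading a, toLinearMap v ∈ T.grading a
  map_mul : ∀ n u v, toLinearMap (S.mul n u v) = T.mul n (toLinearMap u) (toLinearMap v)
  map_D : ∀ v, toLinearMap (S.D v) = T.D (toLinearMap v)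

/-! Every vertex superalgebra is a vertex Lie superalgebra. -/

namespace VertexSuperalgebra

variable {V : Type*} [AddCommGroup V] [Module ℂ V] (S : VertexSuperalgebra V)

theorem induction_homog {p : V → Prop} (h : ∀ a, ∀ v ∈ S.grading a, p v)
    (h0 : p 0) (hadd : ∀ v w, p v → p w → p (v + w)) (v : V) : p v := by
  have hv : v ∈ ⨆ a, S.grading a := by
    rw [S.isInternal.submodule_iSup_eq_top]; trivial
  induction hv using Submodule.iSup_induction' with
  | mem a x hx => exact h a x hx
  | zero => exact h0
  | add x y _ _ hx hy => exact hadd x y hx hy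

theorem vac_even : S.vac ∈ S.grading 0 := by
  have hv : S.vac ∈ S.grading 0 ⊔ S.grading 1 := by
    have h := S.isInternal.submodule_iSup_eq_top
    have h2 : (⨆ a, S.grading a) ≤ S.grading 0 ⊔ S.grading 1 := by
      refine iSup_le fun a => ?_
      fin_cases a
      · exact le_sup_left
      · exact le_sup_right
    rw [h] at h2
    exact h2 trivial
  obtain ⟨e, he, o, ho, heo⟩ := Submodule.mem_sup.1 hv
  have key : ∀ v, S.mul (-1) o v = 0 := by
    refine S.induction_homog (fun b v hb => ?_) (by simp) (fun v w h1 h2 => by simp [h1, h2])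
    have h1 : S.mul (-1) e v + S.mul (-1) o v = v := by
      rw [← LinearMap.add_apply, ← map_add, heo, S.vac_mul]; simp
    have h2 : S.mul (-1) o v ∈ S.grading b := by
      have h1' := eq_sub_iff_add_eq'.2 h1
      rw [h1']
      have := S.homog 0 b e v he hb (-1)
      rw [zero_add] at this
      exact (S.grading b).sub_mem hb this
    have h3 := S.homog 1 b o v ho hb (-1)
    have hdis : Disjoint (S.grading b) (S.grading (1 + b)) :=
      S.isInternal.submodule_iSupIndep.pairwiseDisjoint (by clear * -; decide +revert)
    exact Submodule.disjoint_def.1 hdis _ h2 h3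
  have : o = 0 := by rw [← S.mul_vac o, key]
  rw [← heo, this, add_zero]
  exact he

theorem D_eq (u : V) : S.D u = S.mul (-2) u S.vac := by
  have h := S.mul_D (-1) u S.vac
  rw [S.mul_vac] at h
  rw [h]; norm_num

theorem D_even (a : ZMod 2) (u : V) (hu : u ∈ S.grading a) : S.D u ∈ S.grading a := by
  rw [S.D_eq]
  simpa using S.homog a 0 u S.vac hu S.vac_even (-2)

theorem mul_vac_neg (i : ℕ) (x : V) :
    S.mul (-1 - i) x S.vac = ((i.factorial : ℂ)⁻¹) • (S.D ^ i) x := by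
  induction i generalizing x with
  | zero => simp [S.mul_vac]
  | succ i ih =>
    have h := S.mul_D (-1 - i) x S.vac
    rw [ih] at h
    have e : (-1 - ((i + 1 : ℕ) : ℤ)) = -1 - (i : ℤ) - 1 := by push_cast; ring
    have hc : (-((-1 - (i : ℤ) : ℤ) : ℂ)) = (i : ℂ) + 1 := by push_cast; ring
    have hne : (i : ℂ) + 1 ≠ 0 := by exact_mod_cast Nat.succ_ne_zero i
    rw [hc] at h
    rw [e, pow_succ, Module.End.mul_apply, Nat.factorial_succ]
    have h' := congrArg (fun y => ((i : ℂ) + 1)⁻¹ • y) h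
    simp only [smul_smul, inv_mul_cancel₀ hne, one_smul] at h'
    rw [← h']
    push_cast
    rw [mul_inv]

theorem intChoose_natCast (n i : ℕ) : intChoose (n : ℤ) i = (n.choose i : ℂ) := by
  simp [intChoose, Ring.choose_natCast]

theorem intChoose_neg_one (i : ℕ) : intChoose (-1) i = (-1) ^ i := by
  have : (Ring.choose (-1 : ℤ) i) = (-1) ^ i := by
    rw [Ring.choose_neg]
    have : (1 + (i : ℤ) - 1) = (i : ℤ) := by ring
    rw [this, Ring.choose_natCast]
    simp [Int.negOnePow_def, Units.smul_def]
  rw [intChoose, this]; push_cast; rfl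

theorem skew_symm (a b : ZMod 2) (u v : V) (hu : u ∈ S.grading a) (hv : v ∈ S.grading b)
    (n : ℤ) :
    S.mul n v u = -(superSign a b * (-1) ^ n) •
      ∑ᶠ k : ℕ, ((-1) ^ k / (k.factorial : ℂ)) • (S.D ^ k) (S.mul (n + k) u v) := by
  have h := S.jacobi a b u v hu hv n (-1) 0 S.vac
  have hl : ∀ i : ℕ, i ≠ 0 → ((-1) ^ i * intChoose n i) •
          (S.mul (-1 + n - i) u (S.mul (0 + i) v S.vac) -
            (superSign a b * (-1) ^ n) • S.mul (0 + n - i) v (S.mul (-1 + i) u S.vac)) = 0 := by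
    intro i hi
    rw [S.mul_vac_nonneg (0 + i) (by omega), S.mul_vac_nonneg (-1 + i) (by omega)]
    simp
  rw [finsum_eq_single _ 0 hl] at h
  have h0 : S.mul 0 v S.vac = 0 := S.mul_vac_nonneg 0 le_rfl v
  have hc : intChoose n 0 = 1 := by simp [intChoose]
  simp only [pow_zero, hc, Nat.cast_zero, add_zero, sub_zero, h0, map_zero, zero_sub, zero_add,
    S.mul_vac, one_smul, mul_one] at h
  have hr : ∀ k : ℕ, intChoose (-1) k • S.mul (-1 - k) (S.mul (n + k) u v) S.vac =
      ((-1) ^ k / (k.factorial : ℂ)) • (S.D ^ k) (S.mul (n + k) u v) := by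
    intro k
    rw [S.mul_vac_neg, intChoose_neg_one, smul_smul, div_eq_mul_inv]
  simp only [hr] at h
  rw [← h]
  have hs : superSign a b * superSign a b = 1 := by
    rw [superSign, ← mul_pow]; simp
  have hp : ((-1 : ℂ) ^ n) * (-1) ^ n = 1 := by
    rw [← mul_zpow]; simp
  rw [neg_smul_neg, smul_smul]
  have : superSign a b * (-1) ^ n * (superSign a b * (-1) ^ n) = 1 := by
    linear_combination (superSign a b * superSign a b) * hp + hs
  rw [this, one_smul]

theorem superSign_comm (a b : ZMod 2) : superSign a b = superSign b a := by
  simp [superSign, mul_comm]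

/-- The vertex Lie superalgebra underlying a vertex superalgebra: forget the vacuum vector and the
products `u_n v` with `n < 0`. -/
def toVertexLieSuperalgebra : VertexLieSuperalgebra V where
  grading := S.grading
  isInternal := S.isInternal
  D := S.D
  D_even := S.D_even
  mul n := S.mul n
  truncation u v := by
    obtain ⟨N, hN⟩ := S.truncation u v
    exact ⟨N.toNat, fun n hn => hN n (by omega)⟩
  D_comm n := S.D_comm n
  mul_D_zero u v := by simpa using S.mul_D 0 u v
  mul_D_succ n u v := by
    have h := S.mul_D ((n + 1 : ℕ) : ℤ) u v
    have e : (((n + 1 : ℕ) : ℤ) - 1) = n := by push_cast; ring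
    rw [h, e]; push_cast; rfl
  skew a b u v hu hv n := by
    rw [S.skew_symm b a v u hv hu n, superSign_comm b a, zpow_natCast, neg_smul, neg_smul, mul_smul,
      smul_finsum]
    congr 2
    refine finsum_congr fun k => ?_
    rw [smul_smul, pow_add, mul_div_assoc]
    push_cast
    rfl
  jacobi a b u v hu hv k m n w := by
    have h := S.jacobi a b u v hu hv k m n w
    rw [finsum_eq_sum_of_support_subset (s := Finset.range (k + 1)) _ ?_,
      finsum_eq_sum_of_support_subset (s := Finset.range (m + 1)) _ ?_] at h
    · refine Eq.trans (Finset.sum_congr rfl fun i hi => ?_)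
        (h.trans (Finset.sum_congr rfl fun i hi => ?_))
      · have hi' : i ≤ k := by simpa [Nat.lt_succ_iff] using hi
        rw [intChoose_natCast, zpow_natCast, Nat.cast_sub (by omega), Nat.cast_sub (by omega)]
        push_cast
        rfl
      · have hi' : i ≤ m := by simpa [Nat.lt_succ_iff] using hi
        rw [intChoose_natCast, Nat.cast_sub (by omega)]
        push_cast
        rfl
    · intro i hi
      by_contra hc
      have : m < i := by simpa using hc
      simp [intChoose_natCast, Nat.choose_eq_zero_of_lt this] at hi
    · intro i hi
      by_contra hc
      have : k < i := by simpa using hc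
      simp [intChoose_natCast, Nat.choose_eq_zero_of_lt this] at hi
  homog a b u v hu hv n := S.homog a b u v hu hv n

end VertexSuperalgebra

/-! The universal enveloping algebra of a Lie superalgebra. -/

section Enveloping

variable {L : Type*} [AddCommGroup L] [Module ℂ L]

/-- The relations `x y = ε_{x,y} y x + [x, y]`, for homogeneous `x` and `y`. -/
inductive SuperEnvelopingRel (gr : ZMod 2 → Submodule ℂ L) (br : L →ₗ[ℂ] L →ₗ[ℂ] L) :
    TensorAlgebra ℂ L → TensorAlgebra ℂ L → Prop
  | comm (a b : ZMod 2) (x y : L) (hx : x ∈ gr a) (hy : y ∈ gr b) :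
      SuperEnvelopingRel gr br (TensorAlgebra.ι ℂ x * TensorAlgebra.ι ℂ y)
        (superSign a b • (TensorAlgebra.ι ℂ y * TensorAlgebra.ι ℂ x) +
          TensorAlgebra.ι ℂ (br x y))

/-- The universal enveloping algebra `𝒰(L)` of the Lie superalgebra `L` with grading `gr` and
commutator `br`: the tensor algebra modulo the relations `x y - ε_{x,y} y x = [x, y]`. -/
def SuperEnveloping (gr : ZMod 2 → Submodule ℂ L) (br : L →ₗ[ℂ] L →ₗ[ℂ] L) :=
  RingQuot (SuperEnvelopingRel gr br)

namespace SuperEnveloping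

variable (gr : ZMod 2 → Submodule ℂ L) (br : L →ₗ[ℂ] L →ₗ[ℂ] L)

instance : Ring (SuperEnveloping gr br) :=
  inferInstanceAs (Ring (RingQuot (SuperEnvelopingRel gr br)))

instance : Algebra ℂ (SuperEnveloping gr br) :=
  inferInstanceAs (Algebra ℂ (RingQuot (SuperEnvelopingRel gr br)))

/-- The canonical map `L → 𝒰(L)`. -/
def ι : L →ₗ[ℂ] SuperEnveloping gr br :=
  (RingQuot.mkAlgHom ℂ (SuperEnvelopingRel gr br)).toLinearMap ∘ₗ TensorAlgebra.ι ℂ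

theorem ι_mul_ι (a b : ZMod 2) (x y : L) (hx : x ∈ gr a) (hy : y ∈ gr b) :
    ι gr br x * ι gr br y = superSign a b • (ι gr br y * ι gr br x) + ι gr br (br x y) := by
  have h := RingQuot.mkAlgHom_rel ℂ (SuperEnvelopingRel.comm (br := br) a b x y hx hy)
  rw [map_mul, map_add, map_smul, map_mul] at h
  exact h

/-- The extension to `𝒰(L)` of a linear map `f` from `L` to an associative algebra that respects
the commutators. -/
def lift {A : Type*} [Ring A] [Algebra ℂ A] (f : L →ₗ[ℂ] A)
    (hf : ∀ (a b : ZMod 2) (x y : L), x ∈ gr a → y ∈ gr b →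
      f x * f y = superSign a b • (f y * f x) + f (br x y)) :
    SuperEnveloping gr br →ₐ[ℂ] A :=
  RingQuot.liftAlgHom ℂ ⟨TensorAlgebra.lift ℂ f, by
    rintro _ _ ⟨a, b, x, y, hx, hy⟩
    simpa using hf a b x y hx hy⟩

@[simp]
theorem lift_ι {A : Type*} [Ring A] [Algebra ℂ A] (f : L →ₗ[ℂ] A)
    (hf : ∀ (a b : ZMod 2) (x y : L), x ∈ gr a → y ∈ gr b →
      f x * f y = superSign a b • (f y * f x) + f (br x y)) (x : L) :
    lift gr br f hf (ι gr br x) = f x := by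
  have h := RingQuot.liftAlgHom_mkAlgHom_apply ℂ (s := SuperEnvelopingRel gr br)
    (TensorAlgebra.lift ℂ f) (by
      rintro _ _ ⟨a, b, x, y, hx, hy⟩
      simpa using hf a b x y hx hy) (TensorAlgebra.ι ℂ x)
  rw [TensorAlgebra.lift_ι_apply] at h
  exact h

/-- The `ℤ/2`-grading of `𝒰(L)`: degree `a` is spanned by the products `x₁ ⋯ xᵣ` of homogeneous
elements of `L` whose degrees add up to `a`. -/
def grading (a : ZMod 2) : Submodule ℂ (SuperEnveloping gr br) :=
  Submodule.span ℂ {y | ∃ l : List (ZMod 2 × L), (∀ q ∈ l, q.2 ∈ gr q.1) ∧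
    (l.map Prod.fst).sum = a ∧ y = (l.map fun q => ι gr br q.2).prod}

/-- The augmentation `𝒰(L) → ℂ`, by which `L` acts trivially on `ℂ`. -/
def augmentation : SuperEnveloping gr br →ₐ[ℂ] ℂ :=
  lift gr br 0 (by simp)

end SuperEnveloping

end Enveloping

namespace VertexLieSuperalgebra

variable {U : Type*} [AddCommGroup U] [Module ℂ U] (L : VertexLieSuperalgebra U)

/-- The span of the `(D u)_n + n u_{n-1}` in the affinization `U ⊗ ℂ[q, q⁻¹]`. The affinization is
realized as the space `ℤ →₀ U` of Laurent polynomials with coefficients in `U`; the vector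
`u_n = u ⊗ qⁿ` is `Finsupp.single n u`. -/
def localRel : Submodule ℂ (ℤ →₀ U) :=
  Submodule.span ℂ {x | ∃ (u : U) (n : ℤ),
    x = Finsupp.single n (L.D u) + (n : ℂ) • Finsupp.single (n - 1) u}

/-- The space `ℒ(U)`. -/
abbrev LocalAlgebra := (ℤ →₀ U) ⧸ L.localRel

/-- The element `u_n` of `ℒ(U)`. -/
def mode (n : ℤ) : U →ₗ[ℂ] L.LocalAlgebra :=
  L.localRel.mkQ ∘ₗ Finsupp.lsingle n

/-- The grading of `ℒ(U)`: degree `a` is spanned by the `u_n` with `u` of degree `a`. -/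
def localGrading (a : ZMod 2) : Submodule ℂ L.LocalAlgebra :=
  ⨆ n : ℤ, (L.grading a).map (L.mode n)

theorem mode_D (n : ℤ) (u : U) : L.mode n (L.D u) = -(n : ℂ) • L.mode (n - 1) u := by
  have h : L.localRel.mkQ (Finsupp.single n (L.D u) + (n : ℂ) • Finsupp.single (n - 1) u) = 0 := by
    rw [Submodule.mkQ_apply, Submodule.Quotient.mk_eq_zero]
    exact Submodule.subset_span ⟨u, n, rfl⟩
  rw [map_add, map_smul] at h
  rw [neg_smul]
  exact eq_neg_of_add_eq_zero_left h

theorem finite_support (n p : ℤ) (u v : U) :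
    (Function.support fun i : ℕ => intChoose n i • L.mode (n + p - i) (L.mul i u v)).Finite := by
  obtain ⟨N, hN⟩ := L.truncation u v
  refine (Finset.range N).finite_toSet.subset fun i hi => ?_
  by_contra hc
  have : N ≤ i := by simpa using hc
  simp [hN i this] at hi

/-- `(u, v) ↦ [u_n, v_p] = ∑_{i ≥ 0} (n choose i) (u_i v)_{n+p-i}`. -/
def modeBracket (n p : ℤ) : U →ₗ[ℂ] U →ₗ[ℂ] L.LocalAlgebra :=
  LinearMap.mk₂ ℂ (fun u v => ∑ᶠ i : ℕ, intChoose n i • L.mode (n + p - i) (L.mul i u v))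
    (fun u u' v => by
      rw [← finsum_add_distrib (L.finite_support n p u v) (L.finite_support n p u' v)]
      simp)
    (fun c u v => by
      rw [smul_finsum]
      simp [smul_comm c])
    (fun u v v' => by
      rw [← finsum_add_distrib (L.finite_support n p u v) (L.finite_support n p u v')]
      simp)
    (fun c u v => by
      rw [smul_finsum]
      simp [smul_comm c])

theorem modeBracket_apply (n p : ℤ) (u v : U) : L.modeBracket n p u v =
    ∑ᶠ i : ℕ, intChoose n i • L.mode (n + p - i) (L.mul i u v) := rfl

/-- The bilinear extension of `modeBracket` to the affinization. -/
def affineBracket : (ℤ →₀ U) →ₗ[ℂ] (ℤ →₀ U) →ₗ[ℂ] L.LocalAlgebra :=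
  Finsupp.lsum ℂ fun n => (Finsupp.lsum ℂ fun p => (L.modeBracket n p).flip).flip

theorem affineBracket_single (n p : ℤ) (u v : U) :
    L.affineBracket (Finsupp.single n u) (Finsupp.single p v) = L.modeBracket n p u v := by
  simp [affineBracket]

theorem succ_mul_intChoose (n : ℤ) (i : ℕ) :
    ((i : ℂ) + 1) * intChoose n (i + 1) = ((n : ℂ) - i) * intChoose n i := by
  have h := Ring.choose_smul_choose n (Nat.le_succ i)
  have e : i.succ - i = 1 := by omega
  rw [e, Ring.choose_one_right, Nat.choose_succ_self_right, nsmul_eq_mul] at h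
  have h' := congrArg (Int.cast : ℤ → ℂ) h
  push_cast at h'
  rw [intChoose, intChoose, h', mul_comm]

theorem intChoose_sub_one (n : ℤ) (i : ℕ) :
    (n : ℂ) * intChoose (n - 1) i = ((i : ℂ) + 1) * intChoose n (i + 1) := by
  have h1 := succ_mul_intChoose (n - 1) i
  have h2 : intChoose n (i + 1) = intChoose (n - 1) i + intChoose (n - 1) (i + 1) := by
    have := Ring.choose_succ_succ (n - 1) i
    rw [sub_add_cancel] at this
    rw [intChoose, this]; push_cast; rfl
  push_cast at h1
  rw [h2, mul_add, h1]; ring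

theorem finsum_eq_range {M : Type*} [AddCommMonoid M] (f : ℕ → M) (N : ℕ)
    (h : ∀ i, N ≤ i → f i = 0) : ∑ᶠ i, f i = ∑ i ∈ Finset.range N, f i := by
  refine finsum_eq_sum_of_support_subset f fun i hi => ?_
  by_contra hc
  exact hi (h i (by simpa using hc))

theorem affineBracket_rel_left (x : ℤ →₀ U) (hx : x ∈ L.localRel) : L.affineBracket x = 0 := by
  have hle : L.localRel ≤ LinearMap.ker L.affineBracket := by
    refine Submodule.span_le.2 ?_
    rintro _ ⟨u, n, rfl⟩
    refine LinearMap.mem_ker.2 (Finsupp.lhom_ext fun p v => ?_)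
    rw [map_add, map_smul, LinearMap.add_apply, LinearMap.smul_apply, affineBracket_single,
      affineBracket_single, modeBracket_apply, modeBracket_apply, LinearMap.zero_apply]
    obtain ⟨N, hN⟩ := L.truncation u v
    rw [finsum_eq_range _ (N + 1), finsum_eq_range _ N, Finset.sum_range_succ', L.mul_D_zero,
      map_zero, smul_zero, add_zero, Finset.smul_sum, ← Finset.sum_add_distrib]
    · refine Finset.sum_eq_zero fun i _ => ?_
      have e : n + p - ((i + 1 : ℕ) : ℤ) = n - 1 + p - i := by push_cast; ring
      rw [L.mul_D_succ, map_smul, smul_smul, smul_smul, e, ← add_smul, intChoose_sub_one]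
      convert zero_smul ℂ _
      ring
    · intro i hi; simp [hN i hi]
    · intro i hi
      obtain ⟨j, rfl⟩ : ∃ j, i = j + 1 := ⟨i - 1, by omega⟩
      simp [L.mul_D_succ, hN j (by omega)]
  exact LinearMap.mem_ker.1 (hle hx)

theorem affineBracket_rel_right (y : ℤ →₀ U) (hy : y ∈ L.localRel) :
    L.affineBracket.flip y = 0 := by
  have hle : L.localRel ≤ LinearMap.ker L.affineBracket.flip := by
    refine Submodule.span_le.2 ?_
    rintro _ ⟨v, p, rfl⟩
    refine LinearMap.mem_ker.2 (Finsupp.lhom_ext fun n u => ?_)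
    rw [LinearMap.flip_apply, map_add, map_smul, affineBracket_single,
      affineBracket_single, modeBracket_apply, modeBracket_apply, LinearMap.zero_apply]
    obtain ⟨N, hN⟩ := L.truncation u v
    obtain ⟨N', hN'⟩ := L.truncation u (L.D v)
    set K := max N N' + 1 with hK
    rw [finsum_eq_range _ K (fun i hi => by simp [hN' i (by omega)]),
      finsum_eq_range _ K (fun i hi => by simp [hN i (by omega)])]
    have step : ∀ i : ℕ, intChoose n i • L.mode (n + p - i) (L.mul i u (L.D v)) +
        (p : ℂ) • (intChoose n i • L.mode (n + (p - 1) - i) (L.mul i u v)) =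
        -(((i + 1 : ℕ) : ℂ) * intChoose n (i + 1)) • L.mode (n + p - ((i + 1 : ℕ) : ℤ)) (L.mul i u v)
          + ((i : ℂ) * intChoose n i) • L.mode (n + p - i) (L.mul (i - 1) u v) := by
      intro i
      have e1 : n + p - ((i + 1 : ℕ) : ℤ) = n + p - i - 1 := by push_cast; ring
      have e2 : n + (p - 1) - i = n + p - i - 1 := by ring
      have hD : L.mul i u (L.D v) = L.D (L.mul i u v) - L.mul i (L.D u) v := by
        rw [← L.D_comm]; abel
      have hu : L.mul i (L.D u) v = -(i : ℂ) • L.mul (i - 1) u v := by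
        cases i with
        | zero => simp [L.mul_D_zero]
        | succ j => rw [L.mul_D_succ]; push_cast; rfl
      have hs := succ_mul_intChoose n i
      rw [hD, hu, map_sub, map_smul, L.mode_D, e1, e2]
      push_cast
      rw [hs]
      module
    rw [Finset.smul_sum, ← Finset.sum_add_distrib, Finset.sum_congr rfl fun i _ => step i,
      Finset.sum_add_distrib, Finset.sum_range_succ, Finset.sum_range_succ' _ (max N N')]
    simp only [Nat.cast_zero, zero_mul, zero_smul, add_zero, hN _ (le_max_left N N'), map_zero,
      smul_zero, Nat.add_sub_cancel]
    rw [← Finset.sum_add_distrib]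
    refine Finset.sum_eq_zero fun i _ => ?_
    rw [neg_smul, neg_add_cancel]
  exact LinearMap.mem_ker.1 (hle hy)

/-- The commutator of `ℒ(U)`. -/
def localBracket : L.LocalAlgebra →ₗ[ℂ] L.LocalAlgebra →ₗ[ℂ] L.LocalAlgebra :=
  (L.localRel.liftQ (L.localRel.liftQ L.affineBracket fun x hx => L.affineBracket_rel_left x hx).flip
    fun y hy => by
      rw [LinearMap.mem_ker]
      refine LinearMap.ext fun x => ?_
      obtain ⟨x, rfl⟩ := L.localRel.mkQ_surjective x
      exact LinearMap.congr_fun (L.affineBracket_rel_right y hy) x).flip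

/-- `[u_n, v_p] = ∑_{i ≥ 0} (n choose i) (u_i v)_{n+p-i}` in `ℒ(U)`. -/
theorem localBracket_mode (n p : ℤ) (u v : U) : L.localBracket (L.mode n u) (L.mode p v) =
    ∑ᶠ i : ℕ, intChoose n i • L.mode (n + p - i) (L.mul i u v) :=
  L.affineBracket_single n p u v

/-- `ℒ₊(U)`, the span of the `u_n` with `n ≥ 0`. -/
def localPos : Submodule ℂ L.LocalAlgebra :=
  Submodule.span ℂ {x | ∃ (u : U) (n : ℤ), 0 ≤ n ∧ x = L.mode n u}

theorem localBracket_mem_localPos {x y : L.LocalAlgebra} (hx : x ∈ L.localPos)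
    (hy : y ∈ L.localPos) : L.localBracket x y ∈ L.localPos := by
  have h := Submodule.apply_mem_map₂ L.localBracket hx hy
  rw [localPos, Submodule.map₂_span_span] at h
  refine (Submodule.span_le.2 ?_) h
  rintro _ ⟨_, ⟨u, n, hn, rfl⟩, _, ⟨v, p, hp, rfl⟩, rfl⟩
  change L.localBracket (L.mode n u) (L.mode p v) ∈ L.localPos
  rw [localBracket_mode]
  refine finsum_induction (· ∈ L.localPos) L.localPos.zero_mem
    (fun _ _ => L.localPos.add_mem) fun i => ?_
  lift n to ℕ using hn
  by_cases hi : i ≤ n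
  · exact L.localPos.smul_mem _ (Submodule.subset_span ⟨_, _, by omega, rfl⟩)
  · rw [VertexSuperalgebra.intChoose_natCast, Nat.choose_eq_zero_of_lt (by omega)]
    simp

/-- The grading of `ℒ₊(U)`. -/
def posGrading (a : ZMod 2) : Submodule ℂ L.localPos :=
  (L.localGrading a).comap L.localPos.subtype

/-- The commutator of `ℒ₊(U)`. -/
def posBracket : L.localPos →ₗ[ℂ] L.localPos →ₗ[ℂ] L.localPos :=
  LinearMap.mk₂ ℂ (fun x y => ⟨L.localBracket x y, L.localBracket_mem_localPos x.2 y.2⟩)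
    (fun x x' y => Subtype.ext (by simp))
    (fun c x y => Subtype.ext (by simp))
    (fun x y y' => Subtype.ext (by simp))
    (fun c x y => Subtype.ext (by simp))

/-- `𝒰(ℒ(U))`. -/
abbrev LocalEnveloping := SuperEnveloping L.localGrading L.localBracket

/-- `𝒰(ℒ₊(U))`. -/
abbrev PosEnveloping := SuperEnveloping L.posGrading L.posBracket

/-- The canonical map `ℒ₊(U) → 𝒰(ℒ(U))`. -/
def posMap : L.localPos →ₗ[ℂ] L.LocalEnveloping :=
  SuperEnveloping.ι L.localGrading L.localBracket ∘ₗ L.localPos.subtype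

theorem posMap_comm (a b : ZMod 2) (x y : L.localPos) (hx : x ∈ L.posGrading a)
    (hy : y ∈ L.posGrading b) : L.posMap x * L.posMap y =
      superSign a b • (L.posMap y * L.posMap x) + L.posMap (L.posBracket x y) :=
  SuperEnveloping.ι_mul_ι L.localGrading L.localBracket a b (x : L.LocalAlgebra) y hx hy

/-- The homomorphism `𝒰(ℒ₊(U)) → 𝒰(ℒ(U))` induced by the inclusion. -/
def posInclusion : L.PosEnveloping →ₐ[ℂ] L.LocalEnveloping :=
  SuperEnveloping.lift L.posGrading L.posBracket L.posMap L.posMap_comm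

/-- The relations `x a ⊗ c = x ⊗ a c` (`x ∈ 𝒰(ℒ(U))`, `a ∈ 𝒰(ℒ₊(U))`, `c ∈ ℂ`) that make the
tensor product over `ℂ` the tensor product over the noncommutative ring `𝒰(ℒ₊(U))`, which acts on
the trivial module `ℂ` by the augmentation. -/
def balancedRel : Submodule L.LocalEnveloping (L.LocalEnveloping ⊗[ℂ] ℂ) :=
  Submodule.span L.LocalEnveloping
    {t | ∃ (x : L.LocalEnveloping) (a : L.PosEnveloping) (c : ℂ),
      t = (x * L.posInclusion a) ⊗ₜ[ℂ] c -
        x ⊗ₜ[ℂ] (SuperEnveloping.augmentation L.posGrading L.posBracket a * c)}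

/-- The `ℒ(U)`-module `𝒱(U) = 𝒰(ℒ(U)) ⊗_{𝒰(ℒ₊(U))} ℂ`. -/
abbrev Enveloping := (L.LocalEnveloping ⊗[ℂ] ℂ) ⧸ L.balancedRel

/-- The vector `1 = 1 ⊗ 1` of `𝒱(U)`. -/
def envVac : L.Enveloping := L.balancedRel.mkQ ((1 : L.LocalEnveloping) ⊗ₜ[ℂ] (1 : ℂ))

/-- The operator on `𝒱(U)` by which `u_n ∈ ℒ(U)` acts. -/
def envMode (n : ℤ) (u : U) (w : L.Enveloping) : L.Enveloping :=
  SuperEnveloping.ι L.localGrading L.localBracket (L.mode n u) • w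

/-- The grading of `𝒱(U)`, the image of the grading of `𝒰(ℒ(U))` under `x ↦ x 1`. -/
def envGrading (a : ZMod 2) : Submodule ℂ L.Enveloping :=
  (SuperEnveloping.grading L.localGrading L.localBracket a).map
    (LinearMap.toSpanSingleton L.LocalEnveloping L.Enveloping L.envVac |>.restrictScalars ℂ)

/-- `S` is a vertex superalgebra structure on the graded space `𝒱(U)` with vacuum vector `1`, with
the derivation `D` induced by the derivation `u_n ↦ (D u)_n` of `ℒ(U)` (so that `D 1 = 0` and
`[D, u_n] = (D u)_n` on `𝒱(U)`), and with `Y(u_{-1} 1, z) = ∑ u_n z^{-n-1}` for `u ∈ U`. -/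
structure IsEnvelopingStructure (S : VertexSuperalgebra L.Enveloping) : Prop where
  grading_eq : ∀ a, S.grading a = L.envGrading a
  vac_eq : S.vac = L.envVac
  D_vac : S.D L.envVac = 0
  D_mode : ∀ (n : ℤ) (u : U) (w : L.Enveloping),
    S.D (L.envMode n u w) = L.envMode n (L.D u) w + L.envMode n u (S.D w)
  mul_eq : ∀ (n : ℤ) (u : U) (w : L.Enveloping),
    S.mul n (L.envMode (-1) u L.envVac) w = L.envMode n u w

end VertexLieSuperalgebra

end

noncomputable section

/-! The theorem rests on three facts: `ℒ(U)` is a Lie superalgebra, local fields generate a vertex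
superalgebra, and a Poincaré–Birkhoff–Witt theorem holds relative to `ℒ₊(U)`.

Half skew symmetry and the commutator part of the half Jacobi identity, inserted into the bracket of
modes, turn into skew symmetry and the Jacobi identity of `ℒ(U)` by identities between binomial
coefficients (`localBracket_mode_skew`, `localBracket_mode_jacobi`).

The commutator `[u_n, v_p]` is polynomial in `n` with coefficients depending only on `n + p`, so the
fields `∑ u_n z^{-n-1}` on `𝒱(U)` are mutually local. They generate `𝒱(U)` from the vacuum, which
their nonnegative modes kill, and they are translation covariant. Consider all covariant, creative
homogeneous fields that are local with respect to these. Such a field `a` is determined by the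
vector `a₋₁ 1` (`stateField_ext`), and the space of such fields is closed under products with the
generators by Dong's lemma (`IsLocal.fieldProd`), so every vector arises. This gives a
correspondence `Y` with `Y(u_n v) = Y(u)_n Y(v)`, and the Jacobi identity of `𝒱(U)` becomes the one
for a pair of local fields (`fieldRes_eq_binSum`). The derivation and the directness of the grading
come from the universal property of `𝒱(U)` as an induced module (`exists_env_deriv`,
`envGrading_isInternal`).

For injectivity, `𝒱(U)` is mapped to a module of ordered monomials in which only `ℒ₊(U)` kills the
empty monomial (`OrderedSuperBasis.exists_module`). Hence `u₋₁ 1 = 0` forces `u₋₁ ∈ ℒ₊(U)`, and a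
linear map that vanishes on `ℒ₊(U)` and sends `u₋₁` to `u` (`exists_residue`) gives `u = 0`.

For the universal property, the modes of the `φ(u)` make `V` an `ℒ(U)`-module by the commutator
formula, with a vacuum killed by `ℒ₊(U)`; this yields a linear map `𝒱(U) → V`. It respects products
by the vectors `κ(u)`, hence all products, because these vectors generate and the associator formula
expresses products by `u_k v` through those by `u` and `v` (`map_of_envMode`). Applied to the
identity map, the same argument shows that the structure is unique. -/

theorem superSign_comm (a b : ZMod 2) : superSign a b = superSign b a := by
  simp [superSign, mul_comm]

theorem superSign_mul_self (a b : ZMod 2) : superSign a b * superSign a b = 1 := by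
  rw [superSign, ← mul_pow]; simp

theorem superSign_add_left (a b c : ZMod 2) :
    superSign (a + b) c = superSign a c * superSign b c := by
  rw [superSign, superSign, superSign, ← pow_add]
  refine neg_one_pow_congr ?_
  revert a b c
  decide

theorem superSign_add_right (a b c : ZMod 2) :
    superSign a (b + c) = superSign a b * superSign a c := by
  rw [superSign_comm, superSign_add_left, superSign_comm b, superSign_comm c]

theorem superSign_zero_left (a : ZMod 2) : superSign 0 a = 1 := by simp [superSign]

theorem superSign_one_one : superSign 1 1 = -1 := by simp [superSign, ZMod.val_one]

/-! ### Graded vector spaces -/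

section Graded

variable {V W : Type*} [AddCommGroup V] [Module ℂ V] [AddCommGroup W] [Module ℂ W]
  {gr : ZMod 2 → Submodule ℂ V}

theorem exists_linearMap_of_isInternal (h : DirectSum.IsInternal gr) (f : ∀ a, gr a →ₗ[ℂ] W) :
    ∃ F : V →ₗ[ℂ] W, ∀ a v (hv : v ∈ gr a), F v = f a ⟨v, hv⟩ := by
  let e := LinearEquiv.ofBijective (DirectSum.coeLinearMap gr) h
  refine ⟨DirectSum.toModule ℂ _ _ f ∘ₗ e.symm.toLinearMap, fun a v hv => ?_⟩
  have : e.symm v = DirectSum.lof ℂ _ (fun a => gr a) a ⟨v, hv⟩ := by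
    rw [LinearEquiv.symm_apply_eq]
    exact (DirectSum.coeLinearMap_lof gr a ⟨v, hv⟩).symm
  simp [this]

theorem homogeneous_induction (htop : ⨆ a, gr a = ⊤) {p : V → Prop} (h : ∀ a, ∀ v ∈ gr a, p v)
    (hadd : ∀ v w, p v → p w → p (v + w)) (v : V) : p v := by
  have hv : v ∈ ⨆ a, gr a := by rw [htop]; trivial
  induction hv using Submodule.iSup_induction' with
  | mem a x hx => exact h a x hx
  | zero => exact h 0 0 (zero_mem _)
  | add x y _ _ hx hy => exact hadd x y hx hy

/-- The graded pieces lie in the eigenspaces of `σ` for the distinct eigenvalues `1` and `-1`. This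
is how directness is shown for gradings on quotients: the parity operator of `U` is carried over to
them. -/
theorem isInternal_of_involution (σ : V →ₗ[ℂ] V)
    (hσ : ∀ a, ∀ v ∈ gr a, σ v = (-1 : ℂ) ^ a.val • v) (htop : ⨆ a, gr a = ⊤) :
    DirectSum.IsInternal gr := by
  rw [DirectSum.isInternal_submodule_iff_iSupIndep_and_iSup_eq_top]
  refine ⟨?_, htop⟩
  rw [iSupIndep_def]
  have h01 : Disjoint (gr 0) (gr 1) := by
    rw [Submodule.disjoint_def]
    intro x h0 h1
    have e0 := hσ 0 x h0
    have e1 := hσ 1 x h1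
    rw [e0] at e1
    simp only [ZMod.val_zero, pow_zero, one_smul, ZMod.val_one, pow_one, neg_smul] at e1
    have : (2 : ℂ) • x = 0 := by rw [two_smul]; nth_rw 2 [e1]; exact add_neg_cancel x
    exact (smul_eq_zero.1 this).resolve_left two_ne_zero
  intro a
  have : ⨆ j, ⨆ (_ : j ≠ a), gr j ≤ gr (1 + a) := by
    refine iSup₂_le fun j hj => ?_
    have : j = 1 + a := by revert a j; decide
    rw [this]
  refine Disjoint.mono_right this ?_
  have : a = 0 ∨ a = 1 := by clear * -; revert a; decide
  rcases this with rfl | rfl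
  · simpa using h01
  · exact h01.symm

/-- The projection onto degree `a` maps each `Z b` into `Z a`, hence everything into `Z a`, and it
fixes the vectors of degree `a`. -/
theorem eq_of_le_of_isInternal (h : DirectSum.IsInternal gr) {Z : ZMod 2 → Submodule ℂ V}
    (hZ : ∀ a, Z a ≤ gr a) (htop : ⨆ a, Z a = ⊤) (a : ZMod 2) : Z a = gr a := by
  refine le_antisymm (hZ a) fun v hv => ?_
  obtain ⟨π, hπ⟩ := exists_linearMap_of_isInternal h
    (fun b => if b = a then (gr b).subtype else 0)
  have key : ∀ w, π w ∈ Z a := by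
    refine homogeneous_induction htop (fun b w hw => ?_) (fun v w hv hw => ?_)
    · rw [hπ b w (hZ b hw)]
      split_ifs with hb
      · subst hb; exact hw
      · simp
    · rw [map_add]; exact add_mem hv hw
  have := key v
  rw [hπ a v hv] at this
  simpa using this

end Graded

/-! ### Binomial coefficients with integer upper argument -/

section Binomial

theorem intChoose_zero_right (n : ℤ) : intChoose n 0 = 1 := by simp [intChoose]

theorem intChoose_succ_succ (n : ℤ) (i : ℕ) :
    intChoose (n + 1) (i + 1) = intChoose n i + intChoose n (i + 1) := by
  simp [intChoose, Ring.choose_succ_succ]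

theorem intChoose_zero_succ (i : ℕ) : intChoose 0 (i + 1) = 0 := by
  simp [intChoose]

theorem intChoose_vandermonde (m n : ℤ) (t : ℕ) :
    ∑ x ∈ Finset.HasAntidiagonal.antidiagonal t, intChoose m x.1 * intChoose n x.2 =
      intChoose (m + n) t := by
  simp only [intChoose]
  rw [Ring.add_choose_eq t (Commute.all m n)]
  push_cast
  rfl

theorem intChoose_neg (n : ℤ) (i : ℕ) :
    intChoose (-n) i = (-1) ^ i * intChoose (n + i - 1) i := by
  rw [intChoose, intChoose, Ring.choose_neg]
  rcases Nat.even_or_odd i with h | h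
  · simp [h.neg_one_pow, Int.negOnePow_even _ ((Int.even_coe_nat i).2 h)]
  · simp [h.neg_one_pow, Int.negOnePow_odd _ ((Int.odd_coe_nat i).2 h)]

theorem intChoose_mul_sub (n : ℤ) (s i : ℕ) :
    intChoose n (s + i) * intChoose (s + i : ℕ) s = intChoose n s * intChoose (n - s) i := by
  have h := Ring.choose_smul_choose n (Nat.le_add_right s i)
  rw [Nat.add_sub_cancel_left, nsmul_eq_mul] at h
  have h' := congrArg (Int.cast : ℤ → ℂ) h
  push_cast at h'
  rw [VertexSuperalgebra.intChoose_natCast, mul_comm]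
  exact h'

/-- Negating the upper argument of the second factor makes it independent of `x.1`, so that
Vandermonde's identity applies; a second negation gives the result. This is the identity behind the
skew symmetry of `ℒ(U)`. -/
theorem intChoose_alternating (n p : ℤ) (t : ℕ) :
    ∑ x ∈ Finset.HasAntidiagonal.antidiagonal t,
        (-1) ^ x.1 * (intChoose n x.1 * intChoose (n + p - x.1) x.2) =
      intChoose p t := by
  have h1 : ∀ x ∈ Finset.HasAntidiagonal.antidiagonal t,
      (-1 : ℂ) ^ x.1 * (intChoose n x.1 * intChoose (n + p - x.1) x.2) =
        (-1) ^ t * (intChoose n x.1 * intChoose (t - 1 - n - p) x.2) := by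
    intro x hx
    rw [Finset.HasAntidiagonal.mem_antidiagonal] at hx
    have e := intChoose_neg (-(n + p - x.1)) x.2
    rw [neg_neg] at e
    have e2 : -(n + p - (x.1 : ℤ)) + x.2 - 1 = t - 1 - n - p := by
      rw [← hx]; push_cast; ring
    rw [e, e2, ← hx, pow_add]
    ring
  rw [Finset.sum_congr rfl h1, ← Finset.mul_sum, intChoose_vandermonde]
  have e := intChoose_neg (-p) t
  rw [neg_neg] at e
  rw [e]
  congr 2
  ring

end Binomial

/-! ### Binomial sums of eventually vanishing sequences -/

section BinomialSums

variable {V W : Type*} [AddCommGroup V] [Module ℂ V] [AddCommGroup W] [Module ℂ W]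

/-- `∑ (n choose i) f i`. -/
def binSum (n : ℤ) (f : ℕ → V) : V := ∑ᶠ i : ℕ, intChoose n i • f i

/-- `∑ (-1)ⁱ (n choose i) f i`. -/
def altSum (n : ℤ) (f : ℕ → V) : V := ∑ᶠ i : ℕ, ((-1) ^ i * intChoose n i) • f i

theorem binSum_eq_range {n : ℤ} {f : ℕ → V} {N : ℕ} (h : ∀ i, N ≤ i → f i = 0) :
    binSum n f = ∑ i ∈ Finset.range N, intChoose n i • f i :=
  VertexLieSuperalgebra.finsum_eq_range _ _ fun i hi => by rw [h i hi, smul_zero]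

theorem altSum_eq_range {n : ℤ} {f : ℕ → V} {N : ℕ} (h : ∀ i, N ≤ i → f i = 0) :
    altSum n f = ∑ i ∈ Finset.range N, ((-1) ^ i * intChoose n i) • f i :=
  VertexLieSuperalgebra.finsum_eq_range _ _ fun i hi => by rw [h i hi, smul_zero]

theorem binSum_succ {n : ℤ} {f : ℕ → V} (hf : ∃ N, ∀ i, N ≤ i → f i = 0) :
    binSum (n + 1) f = binSum n f + binSum n fun i => f (i + 1) := by
  obtain ⟨N, hN⟩ := hf
  rw [binSum_eq_range (N := N + 1) fun i hi => hN i (by omega),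
    binSum_eq_range (N := N + 1) fun i hi => hN i (by omega),
    binSum_eq_range (N := N) fun i hi => hN (i + 1) (by omega),
    Finset.sum_range_succ', Finset.sum_range_succ' _ N]
  simp only [intChoose_succ_succ, add_smul, Finset.sum_add_distrib, intChoose_zero_right]
  abel

theorem altSum_succ {n : ℤ} {f : ℕ → V} (hf : ∃ N, ∀ i, N ≤ i → f i = 0) :
    altSum (n + 1) f = altSum n f - altSum n fun i => f (i + 1) := by
  obtain ⟨N, hN⟩ := hf
  rw [altSum_eq_range (N := N + 1) fun i hi => hN i (by omega),
    altSum_eq_range (N := N + 1) fun i hi => hN i (by omega),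
    altSum_eq_range (N := N) fun i hi => hN (i + 1) (by omega),
    Finset.sum_range_succ', Finset.sum_range_succ' _ N, add_sub_right_comm,
    ← Finset.sum_sub_distrib]
  simp only [intChoose_zero_right]
  congr 1
  refine Finset.sum_congr rfl fun i _ => ?_
  rw [intChoose_succ_succ]
  module

theorem altSum_add {n : ℤ} {f g : ℕ → V} (hf : ∃ N, ∀ i, N ≤ i → f i = 0)
    (hg : ∃ N, ∀ i, N ≤ i → g i = 0) :
    altSum n (fun i => f i + g i) = altSum n f + altSum n g := by
  obtain ⟨N, hN⟩ := hf
  obtain ⟨N', hN'⟩ := hg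
  rw [altSum_eq_range (N := max N N') fun i hi => by
      rw [hN i (by omega), hN' i (by omega), add_zero],
    altSum_eq_range (N := max N N') fun i hi => hN i (by omega),
    altSum_eq_range (N := max N N') fun i hi => hN' i (by omega), ← Finset.sum_add_distrib]
  simp only [smul_add]

theorem altSum_smul {n : ℤ} {f : ℕ → V} (c : ℂ) :
    altSum n (fun i => c • f i) = c • altSum n f := by
  rw [altSum, altSum, smul_finsum]
  exact finsum_congr fun i => smul_comm _ _ _

theorem altSum_map {n : ℤ} {f : ℕ → V} (hf : ∃ N, ∀ i, N ≤ i → f i = 0) (φ : V →ₗ[ℂ] W) :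
    φ (altSum n f) = altSum n fun i => φ (f i) := by
  obtain ⟨N, hN⟩ := hf
  rw [altSum_eq_range hN, altSum_eq_range (N := N) fun i hi => by rw [hN i hi, map_zero], map_sum]
  simp only [map_smul]

theorem altSum_zero_left (f : ℕ → V) : altSum 0 f = f 0 := by
  rw [altSum, finsum_eq_single _ 0]
  · simp [intChoose_zero_right]
  · intro i hi
    obtain ⟨j, rfl⟩ := Nat.exists_eq_succ_of_ne_zero hi
    rw [Nat.succ_eq_add_one, intChoose_zero_succ, mul_zero, zero_smul]

/-- The coefficient form of `(∂₁ + ∂₂)(z₁ - z₂)ⁿ = 0`; it comes down to `(i + 1) (n choose i + 1) =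
(n - i) (n choose i)`. -/
theorem altSum_deriv {n : ℤ} {g : ℕ → V} (hg : ∃ N, ∀ i, N ≤ i → g i = 0) :
    altSum n (fun i => ((n : ℂ) - i) • g i) + altSum n (fun i => (i : ℂ) • g (i - 1)) = 0 := by
  obtain ⟨N, hN⟩ := hg
  rw [altSum_eq_range (N := N) fun i hi => by rw [hN i hi, smul_zero],
    altSum_eq_range (N := N + 1) fun i hi => by rw [hN (i - 1) (by omega), smul_zero],
    Finset.sum_range_succ' _ N, ← add_assoc, ← Finset.sum_add_distrib]
  simp only [Nat.cast_zero, zero_smul, smul_zero, add_zero, Nat.add_sub_cancel]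
  refine Finset.sum_eq_zero fun i _ => ?_
  have h := VertexLieSuperalgebra.succ_mul_intChoose n i
  rw [smul_smul, smul_smul, ← add_smul]
  convert zero_smul ℂ _
  push_cast
  linear_combination (-1 : ℂ) ^ (i + 1) * h

end BinomialSums

/-! ### Multiplication of formal series by differences of variables -/

section Shifts

variable (M : Type*) [AddCommGroup M] [Module ℂ M]

/-- Multiplication by `z₁ - z₂`, on the coefficients of formal series in two variables. -/
def shiftDiff : Module.End ℂ (ℤ → ℤ → M) where
  toFun f m n := f (m + 1) n - f m (n + 1)
  map_add' f g := by ext m n; simp only [Pi.add_apply]; abel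
  map_smul' c f := by ext m n; simp [smul_sub]

/-- Multiplication by `z₁ - z₂`, on the coefficients of formal series in three variables. -/
def shiftDiff₁₂ : Module.End ℂ (ℤ → ℤ → ℤ → M) where
  toFun f m n p := f (m + 1) n p - f m (n + 1) p
  map_add' f g := by ext m n p; simp only [Pi.add_apply]; abel
  map_smul' c f := by ext m n p; simp [smul_sub]

/-- Multiplication by `z₁ - z₃`, on the coefficients of formal series in three variables. -/
def shiftDiff₁₃ : Module.End ℂ (ℤ → ℤ → ℤ → M) where
  toFun f m n p := f (m + 1) n p - f m n (p + 1)
  map_add' f g := by ext m n p; simp only [Pi.add_apply]; abel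
  map_smul' c f := by ext m n p; simp [smul_sub]

/-- Multiplication by `z₂ - z₃`, on the coefficients of formal series in three variables. -/
def shiftDiff₂₃ : Module.End ℂ (ℤ → ℤ → ℤ → M) where
  toFun f m n p := f m (n + 1) p - f m n (p + 1)
  map_add' f g := by ext m n p; simp only [Pi.add_apply]; abel
  map_smul' c f := by ext m n p; simp [smul_sub]

variable {M}

theorem shiftDiff_apply (f : ℤ → ℤ → M) (m n : ℤ) :
    shiftDiff M f m n = f (m + 1) n - f m (n + 1) := rfl

theorem shiftDiff₁₂_apply (f : ℤ → ℤ → ℤ → M) (m n p : ℤ) :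
    shiftDiff₁₂ M f m n p = f (m + 1) n p - f m (n + 1) p := rfl

theorem shiftDiff₁₃_apply (f : ℤ → ℤ → ℤ → M) (m n p : ℤ) :
    shiftDiff₁₃ M f m n p = f (m + 1) n p - f m n (p + 1) := rfl

theorem shiftDiff₂₃_apply (f : ℤ → ℤ → ℤ → M) (m n p : ℤ) :
    shiftDiff₂₃ M f m n p = f m (n + 1) p - f m n (p + 1) := rfl

theorem shiftDiff₁₂_eq : shiftDiff₁₂ M = shiftDiff₁₃ M - shiftDiff₂₃ M := by
  ext f m n p
  simp only [shiftDiff₁₂_apply, LinearMap.sub_apply, Pi.sub_apply, shiftDiff₁₃_apply,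
    shiftDiff₂₃_apply]
  abel

theorem shiftDiff_commute : Commute (shiftDiff₁₃ M) (shiftDiff₂₃ M) := by
  ext f m n p
  simp only [Module.End.mul_apply, shiftDiff₁₃_apply, shiftDiff₂₃_apply]
  abel

theorem shiftDiff₁₃_pow_apply (N : ℕ) (φ : ℤ → M →ₗ[ℂ] M) (g : ℤ → ℤ → M) (s t : ℤ) :
    (shiftDiff₁₃ M ^ N) (fun m n p => φ (n + t) (g (m + s) p)) =
      fun m n p => φ (n + t) ((shiftDiff M ^ N) g (m + s) p) := by
  induction N with
  | zero => rfl
  | succ N ih =>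
    rw [pow_succ', pow_succ', Module.End.mul_apply, ih]
    ext m n p
    rw [shiftDiff₁₃_apply, Module.End.mul_apply, shiftDiff_apply, map_sub, add_right_comm]

theorem shiftDiff₂₃_pow_apply (N : ℕ) (φ : ℤ → M →ₗ[ℂ] M) (g : ℤ → ℤ → M) (s t : ℤ) :
    (shiftDiff₂₃ M ^ N) (fun m n p => φ (m + t) (g (n + s) p)) =
      fun m n p => φ (m + t) ((shiftDiff M ^ N) g (n + s) p) := by
  induction N with
  | zero => rfl
  | succ N ih =>
    rw [pow_succ', pow_succ', Module.End.mul_apply, ih]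
    ext m n p
    rw [shiftDiff₂₃_apply, Module.End.mul_apply, shiftDiff_apply, map_sub, add_right_comm]

theorem shiftDiff₂₃_pow_slice (N : ℕ) (f : ℤ → ℤ → ℤ → M) (m : ℤ) :
    (shiftDiff₂₃ M ^ N) f m = (shiftDiff M ^ N) (f m) := by
  induction N with
  | zero => rfl
  | succ N ih =>
    rw [pow_succ', pow_succ', Module.End.mul_apply, Module.End.mul_apply, ← ih]
    rfl

theorem pow_apply_eq_zero_of_le {T : Module.End ℂ M} {N N' : ℕ} (h : N ≤ N') {f : M}
    (hf : (T ^ N) f = 0) : (T ^ N') f = 0 := by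
  obtain ⟨k, rfl⟩ := Nat.exists_eq_add_of_le' h
  rw [pow_add, Module.End.mul_apply, hf, map_zero]

/-- A series killed by `z₁ - z₂` is constant along the lines `m + n = const`, and on each of them
truncation in `n` gives a zero. -/
theorem eq_zero_of_shiftDiff_pow {f : ℤ → ℤ → M} {K : ℤ} (hK : ∀ m n, K ≤ n → f m n = 0) (N : ℕ)
    (h : (shiftDiff M ^ N) f = 0) : f = 0 := by
  induction N generalizing f with
  | zero => exact h
  | succ N ih =>
    rw [pow_succ, Module.End.mul_apply] at h
    have h' := ih (f := shiftDiff M f) (fun m n hn => by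
      rw [shiftDiff_apply, hK _ _ hn, hK _ _ (by omega), sub_zero]) h
    have step : ∀ j : ℕ, ∀ m n, f m n = f (m - j) (n + j) := by
      intro j
      induction j with
      | zero => simp
      | succ j ih =>
        intro m n
        have := congrFun (congrFun h' (m - j - 1)) (n + j)
        rw [shiftDiff_apply, Pi.zero_apply, Pi.zero_apply, sub_eq_zero, sub_add_cancel] at this
        rw [ih, this]
        push_cast
        congr 1 <;> ring
    ext m n
    rw [step (K - n).toNat, hK _ _ (by omega)]
    rfl

/-- The operator on the coefficients is `-∂₁`, whose commutator with `z₁ - z₂` is a scalar; so a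
derivative costs one more power. -/
theorem shiftDiff_pow_deriv (N : ℕ) (f : ℤ → ℤ → M) (h : (shiftDiff M ^ N) f = 0) :
    (shiftDiff M ^ (N + 1)) (fun (m n : ℤ) => (m : ℂ) • f (m - 1) n) = 0 := by
  have key : ∀ f : ℤ → ℤ → M, shiftDiff M (fun (m n : ℤ) => (m : ℂ) • f (m - 1) n) =
      (fun (m n : ℤ) => (m : ℂ) • shiftDiff M f (m - 1) n) + f := by
    intro f
    ext m n
    simp only [shiftDiff_apply, Pi.add_apply, add_sub_cancel_right, sub_add_cancel]
    push_cast
    module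
  induction N generalizing f with
  | zero =>
    have : f = 0 := h
    subst this
    have : (fun (m _ : ℤ) => (m : ℂ) • (0 : ℤ → ℤ → M) (m - 1) 0) = 0 := by ext; simp
    simp only [Pi.zero_apply, smul_zero]
    exact map_zero _
  | succ N ih =>
    rw [pow_succ, Module.End.mul_apply, key, map_add, ih (shiftDiff M f) (by
      rw [pow_succ, Module.End.mul_apply] at h; exact h), h, add_zero]

end Shifts

/-! ### Fields, locality and products of fields -/

section Fields

variable (V : Type*) [AddCommGroup V] [Module ℂ V]

/-- The space of fields `a(z) = ∑ aₙ z^{-n-1}` on `V`. -/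
def vertexFields : Submodule ℂ (ℤ → Module.End ℂ V) where
  carrier := {a | ∀ v, ∃ N : ℤ, ∀ n, N ≤ n → a n v = 0}
  add_mem' {a b} ha hb v := by
    obtain ⟨N, hN⟩ := ha v
    obtain ⟨N', hN'⟩ := hb v
    exact ⟨max N N', fun n hn => by
      rw [Pi.add_apply, LinearMap.add_apply, hN n (by omega), hN' n (by omega), add_zero]⟩
  zero_mem' v := ⟨0, fun n _ => rfl⟩
  smul_mem' c a ha v := by
    obtain ⟨N, hN⟩ := ha v
    exact ⟨N, fun n hn => by rw [Pi.smul_apply, LinearMap.smul_apply, hN n hn, smul_zero]⟩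

variable {V}

/-- The coefficients of `a(z₁) b(z₂) - ε b(z₂) a(z₁)`. -/
def superComm (ε : ℂ) (a b : ℤ → Module.End ℂ V) (m n : ℤ) : Module.End ℂ V :=
  a m * b n - ε • (b n * a m)

/-- Locality: `(z₁ - z₂)^N (a(z₁) b(z₂) - ε b(z₂) a(z₁)) = 0` for some `N`. -/
def IsLocal (ε : ℂ) (a b : ℤ → Module.End ℂ V) : Prop :=
  ∃ N : ℕ, (shiftDiff (Module.End ℂ V) ^ N) (superComm ε a b) = 0

theorem IsLocal.symm {ε : ℂ} (hε : ε * ε = 1) {a b : ℤ → Module.End ℂ V} (h : IsLocal ε a b) :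
    IsLocal ε b a := by
  obtain ⟨N, hN⟩ := h
  refine ⟨N, ?_⟩
  have e : superComm ε b a = fun m n => -ε • superComm ε a b n m := by
    ext m n : 2
    simp only [superComm, smul_sub, smul_smul, neg_mul, hε]
    module
  have key : ∀ (N : ℕ) (f : ℤ → ℤ → Module.End ℂ V) (c : ℂ),
      (shiftDiff (Module.End ℂ V) ^ N) (fun m n => c • f n m) =
        fun m n => ((-1) ^ N * c) • (shiftDiff (Module.End ℂ V) ^ N) f n m := by
    intro N
    induction N with
    | zero => intro f c; simp
    | succ N ih =>
      intro f c
      rw [pow_succ', Module.End.mul_apply, ih]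
      ext m n : 2
      rw [shiftDiff_apply, pow_succ', Module.End.mul_apply, shiftDiff_apply]
      module
  rw [e, key, hN]
  ext m n : 2
  simp

theorem IsLocal.add {ε : ℂ} {a a' b : ℤ → Module.End ℂ V} (h : IsLocal ε a b)
    (h' : IsLocal ε a' b) : IsLocal ε (a + a') b := by
  obtain ⟨N, hN⟩ := h
  obtain ⟨N', hN'⟩ := h'
  refine ⟨max N N', ?_⟩
  have e : superComm ε (a + a') b = superComm ε a b + superComm ε a' b := by
    ext m n : 2
    simp only [superComm, Pi.add_apply, add_mul, mul_add]
    module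
  rw [e, map_add, pow_apply_eq_zero_of_le (le_max_left _ _) hN,
    pow_apply_eq_zero_of_le (le_max_right _ _) hN', add_zero]

theorem IsLocal.smul {ε : ℂ} {a b : ℤ → Module.End ℂ V} (h : IsLocal ε a b) (c : ℂ) :
    IsLocal ε (c • a) b := by
  obtain ⟨N, hN⟩ := h
  refine ⟨N, ?_⟩
  have e : superComm ε (c • a) b = c • superComm ε a b := by
    ext m n : 2
    simp only [superComm, Pi.smul_apply, smul_mul_assoc, mul_smul_comm]
    module
  rw [e, map_smul, hN, smul_zero]

theorem IsLocal.zero_left (ε : ℂ) (b : ℤ → Module.End ℂ V) : IsLocal ε 0 b :=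
  ⟨0, by ext m n : 2; simp [superComm]⟩

theorem IsLocal.deriv {ε : ℂ} {a b : ℤ → Module.End ℂ V} (h : IsLocal ε a b) :
    IsLocal ε (fun n => -(n : ℂ) • a (n - 1)) b := by
  obtain ⟨N, hN⟩ := h
  refine ⟨N + 1, ?_⟩
  have e : superComm ε (fun n => -(n : ℂ) • a (n - 1)) b =
      -fun (m n : ℤ) => (m : ℂ) • superComm ε a b (m - 1) n := by
    ext m n : 2
    simp only [superComm, Pi.neg_apply, smul_mul_assoc, mul_smul_comm]
    module
  rw [e, map_neg, shiftDiff_pow_deriv N _ hN, neg_zero]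

theorem eventually_zero (a : vertexFields V) (x : ℤ) (v : V) :
    ∃ N : ℕ, ∀ i : ℕ, N ≤ i → a.1 (x + i) v = 0 := by
  obtain ⟨N, hN⟩ := a.2 v
  exact ⟨(N - x).toNat, fun i hi => hN _ (by omega)⟩

theorem eventually_zero_comp (a b : vertexFields V) (f : ℕ → ℤ) (x : ℤ) (v : V) :
    ∃ N : ℕ, ∀ i : ℕ, N ≤ i → a.1 (f i) (b.1 (x + i) v) = 0 := by
  obtain ⟨N, hN⟩ := eventually_zero b x v
  exact ⟨N, fun i hi => by rw [hN i hi, map_zero]⟩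

theorem eventually_zero_term (ε : ℂ) (a b : vertexFields V) (k m n : ℤ) (v : V) :
    ∃ N : ℕ, ∀ i : ℕ, N ≤ i → a.1 (m + k - i) (b.1 (n + i) v) -
      (ε * (-1) ^ k) • b.1 (n + k - i) (a.1 (m + i) v) = 0 := by
  obtain ⟨N, hN⟩ := eventually_zero_comp a b (fun i => m + k - i) n v
  obtain ⟨N', hN'⟩ := eventually_zero_comp b a (fun i => n + k - i) m v
  exact ⟨max N N', fun i hi => by
    rw [hN i (by omega), hN' i (by omega), smul_zero, sub_zero]⟩

/-- The coefficients of `(z₁ - z₂)^k a(z₁) b(z₂) - ε (-z₂ + z₁)^k b(z₂) a(z₁)`. -/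
def fieldRes (ε : ℂ) (a b : vertexFields V) (k m n : ℤ) : Module.End ℂ V where
  toFun v := altSum k fun i : ℕ => a.1 (m + k - i) (b.1 (n + i) v) -
    (ε * (-1) ^ k) • b.1 (n + k - i) (a.1 (m + i) v)
  map_add' v w := by
    rw [← altSum_add (eventually_zero_term ε a b k m n v) (eventually_zero_term ε a b k m n w)]
    congr 1
    ext i
    simp only [map_add]
    module
  map_smul' c v := by
    rw [RingHom.id_apply, ← altSum_smul]
    congr 1
    ext i
    simp only [map_smul]
    module

theorem fieldRes_apply (ε : ℂ) (a b : vertexFields V) (k m n : ℤ) (v : V) :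
    fieldRes ε a b k m n v = altSum k fun i : ℕ => a.1 (m + k - i) (b.1 (n + i) v) -
      (ε * (-1) ^ k) • b.1 (n + k - i) (a.1 (m + i) v) := rfl

theorem fieldRes_eq_sub (ε : ℂ) (a b : vertexFields V) (k m n : ℤ) (v : V) :
    fieldRes ε a b k m n v = altSum k (fun i : ℕ => a.1 (m + k - i) (b.1 (n + i) v)) -
      (ε * (-1) ^ k) • altSum k (fun i : ℕ => b.1 (n + k - i) (a.1 (m + i) v)) := by
  rw [fieldRes_apply, ← altSum_smul, sub_eq_add_neg, ← neg_one_smul ℂ (altSum k _), ← altSum_smul,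
    ← altSum_add]
  · congr 1
    ext i
    module
  · exact eventually_zero_comp a b _ _ _
  · obtain ⟨N, hN⟩ := eventually_zero_comp b a (fun i => n + k - i) m v
    exact ⟨N, fun i hi => by rw [hN i hi, smul_zero, smul_zero]⟩

/-- Raising `k` by one multiplies both expansions of `(z₁ - z₂)^k` by `z₁ - z₂`, which is Pascal's
rule in each of them. For `k ≥ 0` this identifies `fieldRes` with a power of `z₁ - z₂` times the
supercommutator, and it permits descent to negative `k`. -/
theorem fieldRes_succ (ε : ℂ) (a b : vertexFields V) (k : ℤ) :
    fieldRes ε a b (k + 1) = shiftDiff _ (fieldRes ε a b k) := by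
  ext m n v
  rw [shiftDiff_apply, LinearMap.sub_apply, fieldRes_eq_sub, fieldRes_eq_sub, fieldRes_eq_sub,
    altSum_succ (eventually_zero_comp a b _ _ _), altSum_succ (eventually_zero_comp b a _ _ _),
    zpow_add₀ (by norm_num), zpow_one]
  have e1 : ∀ i : ℕ, m + 1 + k - i = m + (k + 1) - i := fun i => by ring
  have e2 : ∀ i : ℕ, m + (k + 1) - ((i + 1 : ℕ) : ℤ) = m + k - i := fun i => by push_cast; ring
  have e3 : ∀ i : ℕ, n + 1 + k - i = n + (k + 1) - i := fun i => by ring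
  have e4 : ∀ i : ℕ, n + (k + 1) - ((i + 1 : ℕ) : ℤ) = n + k - i := fun i => by push_cast; ring
  have e5 : ∀ (m : ℤ) (i : ℕ), m + ((i + 1 : ℕ) : ℤ) = m + 1 + i := fun m i => by push_cast; ring
  simp only [e1, e2, e3, e4, e5]
  module

theorem fieldRes_natCast (ε : ℂ) (a b : vertexFields V) (k : ℕ) :
    fieldRes ε a b k = (shiftDiff (Module.End ℂ V) ^ k) (superComm ε a.1 b.1) := by
  induction k with
  | zero =>
    ext m n v
    simp [fieldRes_apply, altSum_zero_left, superComm]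
  | succ k ih =>
    rw [Nat.cast_succ, fieldRes_succ, ih, pow_succ', Module.End.mul_apply]

theorem fieldRes_eventually_zero {ε : ℂ} {a b : vertexFields V} (h : IsLocal ε a.1 b.1) :
    ∃ N : ℤ, ∀ k, N ≤ k → fieldRes ε a b k = 0 := by
  obtain ⟨N, hN⟩ := h
  refine ⟨N, fun k hk => ?_⟩
  obtain ⟨j, rfl⟩ := Int.eq_ofNat_of_zero_le (show 0 ≤ k by omega)
  rw [fieldRes_natCast]
  exact pow_apply_eq_zero_of_le (by omega) hN

/-- The `k`-th product `a(z)ₖ b(z)` of fields. -/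
def fieldProd (ε : ℂ) (k : ℤ) (a b : vertexFields V) : vertexFields V where
  val := fieldRes ε a b k 0
  property v := by
    obtain ⟨K, hK⟩ := eventually_zero a 0 v
    obtain ⟨N, hN⟩ := b.2 v
    choose f hf using fun i : ℕ => b.2 (a.1 i v)
    -- Above `N` all `b_{n+i} v` vanish. In the other half only `i < K` contribute, and there `n + k
    -- - i ≥ f i` is needed; the sum of absolute values bounds all the `f i` at once.
    refine ⟨max N (∑ i ∈ Finset.range K, |f i| + |k| + K), fun n hn => ?_⟩
    rw [fieldRes_eq_sub, altSum_eq_range (N := 0) (fun i _ => by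
      rw [hN _ (by omega), map_zero]),
      altSum_eq_range (N := 0) (fun i _ => ?_)]
    · simp
    · by_cases hi : K ≤ i
      · rw [hK i hi, map_zero]
      · rw [zero_add]
        refine hf i _ ?_
        have := Finset.single_le_sum (f := fun i => |f i|) (fun i _ => abs_nonneg _)
          (Finset.mem_range.2 (not_le.1 hi))
        have h1 := le_abs_self (f i)
        have h2 := neg_abs_le k
        omega

theorem fieldProd_apply (ε : ℂ) (k : ℤ) (a b : vertexFields V) (n : ℤ) :
    (fieldProd ε k a b).1 n = fieldRes ε a b k 0 n := rfl

/-- The Jacobi identity for local fields. -/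
theorem fieldRes_eq_binSum {ε : ℂ} {a b : vertexFields V} (h : IsLocal ε a.1 b.1) (k m n : ℤ)
    (v : V) :
    binSum m (fun i : ℕ => (fieldProd ε (k + i) a b).1 (m + n - i) v) =
      fieldRes ε a b k m n v := by
  obtain ⟨N, hN⟩ := fieldRes_eventually_zero h
  -- Both sides satisfy the recursion `R(k, m+1, n) = R(k+1, m, n) + R(k, m, n+1)`, agree for `m =
  -- 0` by the definition of the products, and vanish for large `k` by locality. These properties
  -- determine them.
  set X : ℤ → ℤ → ℤ → V := fun k m n =>
    binSum m (fun i : ℕ => (fieldProd ε (k + i) a b).1 (m + n - i) v) with hX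
  have hXsucc : ∀ k m n, X k (m + 1) n = X (k + 1) m n + X k m (n + 1) := by
    intro k m n
    simp only [hX]
    rw [binSum_succ, add_comm]
    · congr 1
      · congr 1
        ext i
        have e1 : k + ((i + 1 : ℕ) : ℤ) = k + 1 + i := by push_cast; ring
        have e2 : m + 1 + n - ((i + 1 : ℕ) : ℤ) = m + n - i := by push_cast; ring
        rw [e1, e2]
      · congr 1
        ext i
        have e : m + 1 + n - (i : ℤ) = m + (n + 1) - i := by ring
        rw [e]
    · exact ⟨(N - k).toNat, fun i hi => by
        rw [fieldProd_apply, hN _ (by omega)]; rfl⟩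
  have hsucc : ∀ k m n, fieldRes ε a b k (m + 1) n v =
      fieldRes ε a b (k + 1) m n v + fieldRes ε a b k m (n + 1) v := by
    intro k m n
    rw [fieldRes_succ, shiftDiff_apply, LinearMap.sub_apply, sub_add_cancel]
  have h0 : ∀ k n, X k 0 n = fieldRes ε a b k 0 n v := by
    intro k n
    simp only [hX]
    rw [binSum, finsum_eq_single _ 0]
    · simp [intChoose_zero_right, fieldProd_apply]
    · intro i hi
      obtain ⟨j, rfl⟩ := Nat.exists_eq_succ_of_ne_zero hi
      rw [Nat.succ_eq_add_one, intChoose_zero_succ, zero_smul]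
  have main : ∀ (j : ℕ) (k : ℤ), N ≤ k + j → ∀ m n, X k m n = fieldRes ε a b k m n v := by
    intro j
    induction j with
    | zero =>
      intro k hk m n
      rw [hN k (by simpa using hk)]
      simp only [hX]
      rw [binSum_eq_range (N := 0) fun i _ => by
        rw [fieldProd_apply, hN _ (by push_cast at hk; omega)]; rfl]
      rfl
    | succ j ih =>
      intro k hk
      have hk' := ih (k + 1) (by push_cast at hk; omega)
      -- Once the claim holds for `k + 1`, the recursion makes the claims at `(m + 1, n)` and `(m, n
      -- + 1)` equivalent, so it spreads from `m = 0` in both directions.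
      have iff : ∀ m n, X k (m + 1) n = fieldRes ε a b k (m + 1) n v ↔
          X k m (n + 1) = fieldRes ε a b k m (n + 1) v := by
        intro m n
        rw [hXsucc, hsucc, hk' m n, add_right_inj]
      intro m
      induction m using Int.induction_on with
      | zero => exact h0 k
      | succ m ihm => exact fun n => (iff _ _).2 (ihm _)
      | pred m ihm =>
        intro n
        have := (iff (-m - 1) (n - 1)).1 (by rw [sub_add_cancel]; exact ihm _)
        rwa [sub_add_cancel] at this
  exact main (N - k).toNat k (by omega) m n

end Fields

/-! ### Dong's lemma and uniqueness of local fields -/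

section Dong

variable {V : Type*} [AddCommGroup V] [Module ℂ V]

/-- `F i` converges to `f` coefficientwise, and the coefficients of the `F i v` are eventually
constant. -/
def EventuallyEqAt (F : ℕ → ℤ → ℤ → ℤ → Module.End ℂ V) (f : ℤ → ℤ → ℤ → Module.End ℂ V) : Prop :=
  ∀ m n p v, ∀ᶠ i in Filter.atTop, F i m n p v = f m n p v

theorem EventuallyEqAt.shiftDiff₁₃_pow {F : ℕ → ℤ → ℤ → ℤ → Module.End ℂ V}
    {f : ℤ → ℤ → ℤ → Module.End ℂ V} (h : EventuallyEqAt F f) (N : ℕ) :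
    EventuallyEqAt (fun i => (shiftDiff₁₃ _ ^ N) (F i)) ((shiftDiff₁₃ _ ^ N) f) := by
  induction N with
  | zero => exact h
  | succ N ih =>
    intro m n p v
    filter_upwards [ih (m + 1) n p v, ih m n (p + 1) v] with i h1 h2
    rw [pow_succ', Module.End.mul_apply, Module.End.mul_apply, shiftDiff₁₃_apply,
      shiftDiff₁₃_apply, LinearMap.sub_apply, LinearMap.sub_apply, h1, h2]

theorem EventuallyEqAt.shiftDiff₂₃_pow {F : ℕ → ℤ → ℤ → ℤ → Module.End ℂ V}
    {f : ℤ → ℤ → ℤ → Module.End ℂ V} (h : EventuallyEqAt F f) (N : ℕ) :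
    EventuallyEqAt (fun i => (shiftDiff₂₃ _ ^ N) (F i)) ((shiftDiff₂₃ _ ^ N) f) := by
  induction N with
  | zero => exact h
  | succ N ih =>
    intro m n p v
    filter_upwards [ih m (n + 1) p v, ih m n (p + 1) v] with i h1 h2
    rw [pow_succ', Module.End.mul_apply, Module.End.mul_apply, shiftDiff₂₃_apply,
      shiftDiff₂₃_apply, LinearMap.sub_apply, LinearMap.sub_apply, h1, h2]

theorem EventuallyEqAt.eq_zero {F : ℕ → ℤ → ℤ → ℤ → Module.End ℂ V}
    {f : ℤ → ℤ → ℤ → Module.End ℂ V} (h : EventuallyEqAt F f) (h0 : ∀ i, F i = 0) : f = 0 := by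
  ext m n p v
  obtain ⟨i, hi⟩ := (h m n p v).exists
  rw [← hi, h0]

theorem altSum_eventually_eq {k : ℤ} {f : ℕ → V} (hf : ∃ N, ∀ i, N ≤ i → f i = 0) :
    ∀ᶠ K in Filter.atTop, ∑ i ∈ Finset.range K, ((-1) ^ i * intChoose k i) • f i = altSum k f := by
  obtain ⟨N, hN⟩ := hf
  filter_upwards [Filter.eventually_ge_atTop N] with K hK
  rw [altSum_eq_range (N := K) fun i hi => hN i (hK.trans hi)]

/-- The supercommutator of `a b` with `c` is `a [b, c] + ε₂ [a, c] b`; the power of `z₂ - z₃` kills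
the first summand, and that of `z₁ - z₃` the second. The shifts `s`, `t` occur because the terms of
`fieldRes` have shifted indices. -/
theorem shiftDiff_pow_triple {ε₁ ε₂ : ℂ} {a b c : ℤ → Module.End ℂ V} {N₁ N₂ : ℕ}
    (h₁ : (shiftDiff (Module.End ℂ V) ^ N₁) (superComm ε₁ a c) = 0)
    (h₂ : (shiftDiff (Module.End ℂ V) ^ N₂) (superComm ε₂ b c) = 0) (s t : ℤ) :
    (shiftDiff₁₃ (Module.End ℂ V) ^ N₁ * shiftDiff₂₃ (Module.End ℂ V) ^ N₂) (fun m n p =>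
      a (m + s) * b (n + t) * c p - (ε₁ * ε₂) • (c p * (a (m + s) * b (n + t)))) = 0 := by
  have e : (fun (m n p : ℤ) => a (m + s) * b (n + t) * c p -
        (ε₁ * ε₂) • (c p * (a (m + s) * b (n + t)))) =
      (fun m n p => LinearMap.mulLeft ℂ (a (m + s)) (superComm ε₂ b c (n + t) p)) +
      ε₂ • (fun m n p => LinearMap.mulRight ℂ (b (n + t)) (superComm ε₁ a c (m + s) p)) := by
    ext m n p : 3
    simp only [superComm, Pi.add_apply, Pi.smul_apply, LinearMap.mulLeft_apply,
      LinearMap.mulRight_apply, mul_sub, sub_mul, mul_smul_comm, smul_mul_assoc, mul_assoc]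
    module
  rw [e, map_add, map_smul, Module.End.mul_apply,
    shiftDiff₂₃_pow_apply N₂ (fun m => LinearMap.mulLeft ℂ (a m)) (superComm ε₂ b c) t s, h₂,
    ((shiftDiff_commute (M := Module.End ℂ V)).pow_pow N₁ N₂).eq, Module.End.mul_apply,
    shiftDiff₁₃_pow_apply N₁ (fun n => LinearMap.mulRight ℂ (b n)) (superComm ε₁ a c) s t, h₁]
  simp only [Pi.zero_apply, map_zero]
  have : (fun _ _ _ => 0 : ℤ → ℤ → ℤ → Module.End ℂ V) = 0 := rfl
  rw [this, map_zero, map_zero, smul_zero, add_zero]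

theorem shiftDiff_pow_triple' {ε₁ ε₂ : ℂ} {a b c : ℤ → Module.End ℂ V} {N₁ N₂ : ℕ}
    (h₁ : (shiftDiff (Module.End ℂ V) ^ N₁) (superComm ε₁ a c) = 0)
    (h₂ : (shiftDiff (Module.End ℂ V) ^ N₂) (superComm ε₂ b c) = 0) (s t : ℤ) :
    (shiftDiff₁₃ (Module.End ℂ V) ^ N₁ * shiftDiff₂₃ (Module.End ℂ V) ^ N₂) (fun m n p =>
      b (n + t) * a (m + s) * c p - (ε₁ * ε₂) • (c p * (b (n + t) * a (m + s)))) = 0 := by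
  have e : (fun (m n p : ℤ) => b (n + t) * a (m + s) * c p -
        (ε₁ * ε₂) • (c p * (b (n + t) * a (m + s)))) =
      (fun m n p => LinearMap.mulLeft ℂ (b (n + t)) (superComm ε₁ a c (m + s) p)) +
      ε₁ • (fun m n p => LinearMap.mulRight ℂ (a (m + s)) (superComm ε₂ b c (n + t) p)) := by
    ext m n p : 3
    simp only [superComm, Pi.add_apply, Pi.smul_apply, LinearMap.mulLeft_apply,
      LinearMap.mulRight_apply, mul_sub, sub_mul, mul_smul_comm, smul_mul_assoc, mul_assoc]
    module
  rw [e, add_comm, map_add, map_smul, Module.End.mul_apply,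
    shiftDiff₂₃_pow_apply N₂ (fun m => LinearMap.mulRight ℂ (a m)) (superComm ε₂ b c) t s, h₂,
    ((shiftDiff_commute (M := Module.End ℂ V)).pow_pow N₁ N₂).eq, Module.End.mul_apply,
    shiftDiff₁₃_pow_apply N₁ (fun n => LinearMap.mulLeft ℂ (b n)) (superComm ε₁ a c) s t, h₁]
  simp only [Pi.zero_apply, map_zero]
  have : (fun _ _ _ => 0 : ℤ → ℤ → ℤ → Module.End ℂ V) = 0 := rfl
  rw [this, map_zero, map_zero, smul_zero, add_zero]

/-- The coefficients of the commutator of `fieldRes ε a b k` with `c(z₃)`. -/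
def resComm (ε ε' : ℂ) (a b c : vertexFields V) (k m n p : ℤ) : Module.End ℂ V :=
  fieldRes ε a b k m n * c.1 p - ε' • (c.1 p * fieldRes ε a b k m n)

theorem resComm_succ (ε ε' : ℂ) (a b c : vertexFields V) (k : ℤ) :
    resComm ε ε' a b c (k + 1) = shiftDiff₁₂ _ (resComm ε ε' a b c k) := by
  ext m n p : 3
  simp only [resComm, shiftDiff₁₂_apply, fieldRes_succ, shiftDiff_apply, sub_mul, mul_sub]
  module

/-- The series is an infinite combination of shifted triple products, each of which is annihilated
by `shiftDiff_pow_triple` and its variant with `a`, `b` exchanged. Each coefficient, applied to a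
vector, involves only finitely many of them, so finite partial sums suffice. -/
theorem resComm_annihilated (ε : ℂ) {ε₁ ε₂ : ℂ} {a b c : vertexFields V} {N₁ N₂ : ℕ}
    (h₁ : (shiftDiff (Module.End ℂ V) ^ N₁) (superComm ε₁ a.1 c.1) = 0)
    (h₂ : (shiftDiff (Module.End ℂ V) ^ N₂) (superComm ε₂ b.1 c.1) = 0) (k : ℤ) :
    (shiftDiff₁₃ (Module.End ℂ V) ^ N₁ * shiftDiff₂₃ (Module.End ℂ V) ^ N₂)
      (resComm ε (ε₁ * ε₂) a b c k) = 0 := by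
  set G : ℕ → ℤ → ℤ → ℤ → Module.End ℂ V := fun i =>
    (fun m n p => a.1 (m + (k - i)) * b.1 (n + i) * c.1 p -
      (ε₁ * ε₂) • (c.1 p * (a.1 (m + (k - i)) * b.1 (n + i)))) - (ε * (-1) ^ k) •
    (fun m n p => b.1 (n + (k - i)) * a.1 (m + i) * c.1 p -
      (ε₁ * ε₂) • (c.1 p * (b.1 (n + (k - i)) * a.1 (m + i)))) with hG
  have happrox : EventuallyEqAt (fun K => ∑ i ∈ Finset.range K, ((-1) ^ i * intChoose k i) • G i)
      (resComm ε (ε₁ * ε₂) a b c k) := by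
    intro m n p v
    have z1 := eventually_zero_term ε a b k m n (c.1 p v)
    obtain ⟨N, hN⟩ := eventually_zero_term ε a b k m n v
    have hs : altSum k (fun i : ℕ => (a.1 (m + k - i) (b.1 (n + i) (c.1 p v)) -
          (ε * (-1) ^ k) • b.1 (n + k - i) (a.1 (m + i) (c.1 p v))) +
          -(ε₁ * ε₂) • c.1 p (a.1 (m + k - i) (b.1 (n + i) v) -
          (ε * (-1) ^ k) • b.1 (n + k - i) (a.1 (m + i) v))) =
        resComm ε (ε₁ * ε₂) a b c k m n p v := by
      rw [altSum_add z1 ⟨N, fun i hi => by rw [hN i hi, map_zero, smul_zero]⟩, altSum_smul,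
        ← altSum_map ⟨N, hN⟩, ← fieldRes_apply, ← fieldRes_apply, resComm]
      simp only [LinearMap.sub_apply, LinearMap.smul_apply, Module.End.mul_apply]
      module
    have z2 : ∃ N, ∀ i : ℕ, N ≤ i → (a.1 (m + k - i) (b.1 (n + i) (c.1 p v)) -
          (ε * (-1) ^ k) • b.1 (n + k - i) (a.1 (m + i) (c.1 p v))) +
          -(ε₁ * ε₂) • c.1 p (a.1 (m + k - i) (b.1 (n + i) v) -
          (ε * (-1) ^ k) • b.1 (n + k - i) (a.1 (m + i) v)) = 0 := by
      obtain ⟨N', hN'⟩ := z1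
      exact ⟨max N N', fun i hi => by
        rw [hN i (by omega), hN' i (by omega), map_zero, smul_zero, add_zero]⟩
    filter_upwards [altSum_eventually_eq (k := k) z2] with K hK
    rw [← hs, ← hK]
    simp only [Finset.sum_apply, LinearMap.sum_apply, Pi.smul_apply, LinearMap.smul_apply]
    refine Finset.sum_congr rfl fun i _ => ?_
    congr 1
    simp only [hG, Pi.sub_apply, Pi.smul_apply, LinearMap.sub_apply, LinearMap.smul_apply,
      Module.End.mul_apply, map_sub, map_smul, add_sub_assoc]
    module
  have h := (happrox.shiftDiff₂₃_pow N₂).shiftDiff₁₃_pow N₁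
  refine h.eq_zero fun K => ?_
  rw [← Module.End.mul_apply, map_sum]
  refine Finset.sum_eq_zero fun i _ => ?_
  rw [map_smul, hG, map_sub, map_smul, shiftDiff_pow_triple h₁ h₂ (k - i) i,
    shiftDiff_pow_triple' h₁ h₂ i (k - i)]
  simp

/-- Dong's lemma. -/
theorem IsLocal.fieldProd {ε ε₁ ε₂ : ℂ} {a b c : vertexFields V} (hab : IsLocal ε a.1 b.1)
    (hac : IsLocal ε₁ a.1 c.1) (hbc : IsLocal ε₂ b.1 c.1) (k : ℤ) :
    IsLocal (ε₁ * ε₂) (fieldProd ε k a b).1 c.1 := by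
  obtain ⟨N, hN⟩ := fieldRes_eventually_zero hab
  obtain ⟨N₁, h₁⟩ := hac
  obtain ⟨N₂, h₂⟩ := hbc
  -- Descending induction on `k`: for `k ≥ N` the series is zero by locality of `a` and `b`.
  have main : ∀ (j : ℕ) (k : ℤ), N ≤ k + j →
      ∃ M : ℕ, (shiftDiff₂₃ (Module.End ℂ V) ^ M) (resComm ε (ε₁ * ε₂) a b c k) = 0 := by
    intro j
    induction j with
    | zero =>
      intro k hk
      refine ⟨0, ?_⟩
      ext m n p : 3
      simp [resComm, hN k (by simpa using hk)]
    | succ j ih =>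
      intro k hk
      obtain ⟨M, hM⟩ := ih (k + 1) (by push_cast at hk; omega)
      set C := resComm ε (ε₁ * ε₂) a b c k
      rw [resComm_succ, shiftDiff₁₂_eq, LinearMap.sub_apply, map_sub, sub_eq_zero,
        ← Module.End.mul_apply, ← Module.End.mul_apply, ← pow_succ] at hM
      -- Since `z₁ - z₂ = (z₁ - z₃) - (z₂ - z₃)`, the case `k + 1` says that `z₁ - z₃` and `z₂ - z₃`
      -- act alike on `(z₂ - z₃)^M C`. So powers of the one may be traded for powers of the other.
      have hj : ∀ j : ℕ, (shiftDiff₂₃ (Module.End ℂ V) ^ M * shiftDiff₁₃ (Module.End ℂ V) ^ j) C =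
          (shiftDiff₂₃ (Module.End ℂ V) ^ (M + j)) C := by
        intro j
        induction j with
        | zero => simp
        | succ j ihj =>
          rw [pow_succ', ← mul_assoc,
            ← (shiftDiff_commute (M := Module.End ℂ V)).pow_right M |>.eq, mul_assoc,
            Module.End.mul_apply, ihj, ← Module.End.mul_apply,
            (shiftDiff_commute (M := Module.End ℂ V)).pow_right (M + j) |>.eq, add_comm M j,
            pow_add, mul_assoc, Module.End.mul_apply, hM, ← Module.End.mul_apply, ← pow_add]
          congr 2
          ring
      -- In the presence of `(z₂ - z₃)^M`, the factor `(z₁ - z₃)^{N₁}` of the annihilator of `C` is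
      -- replaced by `(z₂ - z₃)^{N₁}`.
      refine ⟨N₂ + (M + N₁), ?_⟩
      rw [pow_add, Module.End.mul_apply, ← hj, ← Module.End.mul_apply, ← mul_assoc, ← pow_add,
        add_comm, pow_add, mul_assoc, Module.End.mul_apply,
        ← ((shiftDiff_commute (M := Module.End ℂ V)).pow_pow N₁ N₂).eq,
        resComm_annihilated ε h₁ h₂, map_zero]
  obtain ⟨M, hM⟩ := main (N - k).toNat k (by omega)
  refine ⟨M, ?_⟩
  -- The product of fields is the residue in `z₁`, that is, the slice `m = 0`, and multiplication by
  -- `z₂ - z₃` acts slicewise.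
  have h0 := congrFun hM 0
  rw [shiftDiff₂₃_pow_slice] at h0
  exact h0

/-- A field that is local with respect to fields generating `V` from a vector killed by it is
zero. -/
theorem eq_zero_of_isLocal {X : Type*} (fld : X → vertexFields V) {vac : V}
    (hgen : ∀ W : Submodule ℂ V, vac ∈ W → (∀ x n, ∀ w ∈ W, (fld x).1 n w ∈ W) → W = ⊤)
    {a : ℤ → Module.End ℂ V} (hloc : ∀ x, ∃ ε, IsLocal ε a (fld x).1) (h0 : ∀ n, a n vac = 0) :
    a = 0 := by
  have h := hgen (⨅ n, LinearMap.ker (a n)) (by simpa using h0) fun x q w hw => by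
    obtain ⟨ε, N, hN⟩ := hloc x
    simp only [Submodule.mem_iInf, LinearMap.mem_ker] at hw ⊢
    obtain ⟨K, hK⟩ := (fld x).2 w
    have key : ∀ (N : ℕ) (f : ℤ → ℤ → Module.End ℂ V), (shiftDiff V ^ N) (fun m n => f m n w) =
        fun m n => (shiftDiff _ ^ N) f m n w := by
      intro N
      induction N with
      | zero => intro f; rfl
      | succ N ih =>
        intro f
        rw [pow_succ', Module.End.mul_apply, ih, pow_succ', Module.End.mul_apply]
        rfl
    -- If all modes of `a` kill `w`, the supercommutator applied to `w` reduces to `a_m x_n w`. This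
    -- is truncated in `n` because `x` is a field, so a power of `z₁ - z₂` can kill it only if it is
    -- zero.
    have hz := eq_zero_of_shiftDiff_pow (f := fun m n => superComm ε a (fld x).1 m n w) (K := K)
      (fun m n hn => by simp [superComm, hK n hn, hw]) N (by rw [key, hN]; rfl)
    intro n
    have := congrFun (congrFun hz n) q
    simpa [superComm, hw] using this
  ext n v
  have hv : v ∈ (⨅ n, LinearMap.ker (a n)) := by rw [h]; trivial
  simp only [Submodule.mem_iInf, LinearMap.mem_ker] at hv
  simpa using hv n

end Dong

/-! ### Covariance, creativity and parity of products of fields -/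

section Closure

variable {V : Type*} [AddCommGroup V] [Module ℂ V]

/-- Commuting with `D` acts on products of `a(z₁)` and `b(z₂)` as `∂₁ + ∂₂`, which annihilates `(z₁
- z₂)^k`. The residue in `z₁` removes `∂₁` and leaves the derivative in `z₂`. -/
theorem fieldProd_covariant (D : Module.End ℂ V) {ε : ℂ} {a b : vertexFields V}
    (ha : ∀ n v, D (a.1 n v) - a.1 n (D v) = -(n : ℂ) • a.1 (n - 1) v)
    (hb : ∀ n v, D (b.1 n v) - b.1 n (D v) = -(n : ℂ) • b.1 (n - 1) v) (k n : ℤ) (v : V) :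
    D ((fieldProd ε k a b).1 n v) - (fieldProd ε k a b).1 n (D v) =
      -(n : ℂ) • (fieldProd ε k a b).1 (n - 1) v := by
  have half : ∀ {a b : vertexFields V}
      (_ : ∀ n v, D (a.1 n v) - a.1 n (D v) = -(n : ℂ) • a.1 (n - 1) v)
      (_ : ∀ n v, D (b.1 n v) - b.1 n (D v) = -(n : ℂ) • b.1 (n - 1) v) (m n : ℤ),
      D (altSum k fun i : ℕ => a.1 (m + k - i) (b.1 (n + i) v)) =
        (altSum k fun i : ℕ => a.1 (m + k - i) (b.1 (n + i) (D v))) +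
        (-(m : ℂ) • (altSum k fun i : ℕ => a.1 (m - 1 + k - i) (b.1 (n + i) v)) +
        -(n : ℂ) • (altSum k fun i : ℕ => a.1 (m + k - i) (b.1 (n - 1 + i) v))) := by
    intro a b ha hb m n
    have hz := altSum_deriv (n := k)
      (eventually_zero_comp a b (fun i => m - 1 + k - i) n v)
    obtain ⟨N0, h0⟩ := eventually_zero_comp a b (fun i => m + k - i) n v
    obtain ⟨N1, h1⟩ := eventually_zero_comp a b (fun i => m + k - i) n (D v)
    obtain ⟨N2, h2⟩ := eventually_zero_comp a b (fun i => m - 1 + k - i) n v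
    obtain ⟨N3, h3⟩ := eventually_zero_comp a b (fun i => m + k - i) (n - 1) v
    set K := N0 + N1 + N2 + N3 + 1
    rw [altSum_eq_range (N := K) fun i hi => by rw [h2 i (by omega), smul_zero],
      altSum_eq_range (N := K) fun i hi => by rw [h2 (i - 1) (by omega), smul_zero],
      ← Finset.sum_add_distrib] at hz
    rw [altSum_map ⟨N0, h0⟩, altSum_eq_range (N := K) fun i hi => by rw [h0 i (by omega), map_zero],
      altSum_eq_range (N := K) fun i hi => h1 i (by omega),
      altSum_eq_range (N := K) fun i hi => h2 i (by omega),
      altSum_eq_range (N := K) fun i hi => h3 i (by omega),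
      Finset.smul_sum, Finset.smul_sum, ← Finset.sum_add_distrib, ← Finset.sum_add_distrib,
      ← sub_eq_zero, ← Finset.sum_sub_distrib]
    refine Eq.trans ?_ (neg_eq_zero.2 hz)
    rw [← Finset.sum_neg_distrib]
    refine Finset.sum_congr rfl fun i _ => ?_
    have e1 := ha (m + k - i) (b.1 (n + i) v)
    have e2 := congrArg (a.1 (m + k - i)) (hb (n + i) v)
    rw [map_sub, map_smul] at e2
    rw [sub_eq_iff_eq_add] at e1 e2
    rw [e1, e2]
    have e3 : m + k - i - 1 = m - 1 + k - (i : ℤ) := by ring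
    have e4 : n + i - 1 = n - 1 + (i : ℤ) := by ring
    rw [e3, e4]
    -- For `i = 0` the truncated index `i - 1` is harmless, since its coefficient is zero.
    rcases i with _ | i
    · push_cast
      module
    · have e5 : m - 1 + k - ((i + 1 - 1 : ℕ) : ℤ) = m + k - ((i + 1 : ℕ) : ℤ) := by
        push_cast [Nat.add_sub_cancel]; ring
      have e6 : n + ((i + 1 - 1 : ℕ) : ℤ) = n - 1 + ((i + 1 : ℕ) : ℤ) := by
        push_cast [Nat.add_sub_cancel]; ring
      rw [e5, e6]
      push_cast
      module
  rw [fieldProd_apply, fieldProd_apply, fieldRes_eq_sub, fieldRes_eq_sub, fieldRes_eq_sub,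
    map_sub, map_smul, half ha hb, half hb ha]
  push_cast
  module

theorem fieldProd_creative {ε : ℂ} {a b : vertexFields V} {vac : V}
    (ha : ∀ n : ℤ, 0 ≤ n → a.1 n vac = 0) (hb : ∀ n : ℤ, 0 ≤ n → b.1 n vac = 0) (k n : ℤ)
    (hn : 0 ≤ n) : (fieldProd ε k a b).1 n vac = 0 := by
  rw [fieldProd_apply, fieldRes_apply, altSum_eq_range (N := 0) fun i _ => by
    rw [ha _ (by omega), hb _ (by omega), map_zero, map_zero, smul_zero, sub_zero]]
  rfl

/-- Only the term `a_k b₋₁` survives on a vector killed by all nonnegative modes. Thus the passage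
from fields to states takes products of fields to products of states. -/
theorem fieldProd_neg_one {ε : ℂ} {a b : vertexFields V} {vac : V}
    (ha : ∀ n : ℤ, 0 ≤ n → a.1 n vac = 0) (hb : ∀ n : ℤ, 0 ≤ n → b.1 n vac = 0) (k : ℤ) :
    (fieldProd ε k a b).1 (-1) vac = a.1 k (b.1 (-1) vac) := by
  rw [fieldProd_apply, fieldRes_apply, altSum_eq_range (N := 1) fun i hi => by
    rw [ha _ (by omega), hb _ (by omega), map_zero, map_zero, smul_zero, sub_zero]]
  simp [intChoose_zero_right, ha 0 le_rfl]

theorem fieldProd_homog {ε : ℂ} {a b : vertexFields V} {gr : ZMod 2 → Submodule ℂ V}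
    {α β : ZMod 2} (ha : ∀ n γ, ∀ v ∈ gr γ, a.1 n v ∈ gr (α + γ))
    (hb : ∀ n γ, ∀ v ∈ gr γ, b.1 n v ∈ gr (β + γ)) (k n : ℤ) (γ : ZMod 2) (v : V)
    (hv : v ∈ gr γ) : (fieldProd ε k a b).1 n v ∈ gr (α + β + γ) := by
  obtain ⟨N, hN⟩ := eventually_zero_term ε a b k 0 n v
  rw [fieldProd_apply, fieldRes_apply, altSum_eq_range hN]
  refine Submodule.sum_mem _ fun i _ => Submodule.smul_mem _ _ (Submodule.sub_mem _ ?_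
    (Submodule.smul_mem _ _ ?_))
  · rw [add_assoc]; exact ha _ _ _ (hb _ _ _ hv)
  · rw [add_assoc, add_left_comm]; exact hb _ _ _ (ha _ _ _ hv)

end Closure

/-! ### The vertex superalgebra generated by local fields -/

/-- Mutually local, translation covariant, creative homogeneous fields that generate the graded
space `V` from the vacuum vector. -/
structure GeneratingFields (V X : Type*) [AddCommGroup V] [Module ℂ V] where
  grading : ZMod 2 → Submodule ℂ V
  isInternal : DirectSum.IsInternal grading
  vac : V
  vac_even : vac ∈ grading 0
  D : V →ₗ[ℂ] V
  D_vac : D vac = 0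
  parity : X → ZMod 2
  field : X → vertexFields V
  covariant : ∀ x n v,
    D ((field x).1 n v) - (field x).1 n (D v) = -(n : ℂ) • (field x).1 (n - 1) v
  creative : ∀ x (n : ℤ), 0 ≤ n → (field x).1 n vac = 0
  homog : ∀ x n b, ∀ v ∈ grading b, (field x).1 n v ∈ grading (parity x + b)
  isLocal : ∀ x y, IsLocal (superSign (parity x) (parity y)) (field x).1 (field y).1
  generate : ∀ W : Submodule ℂ V, vac ∈ W → (∀ x n, ∀ w ∈ W, (field x).1 n w ∈ W) → W = ⊤

namespace GeneratingFields

variable {V X : Type*} [AddCommGroup V] [Module ℂ V] (G : GeneratingFields V X)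

/-- The translation covariant, creative fields of parity `b` that are local with respect to the
generating fields. -/
def stateFields (b : ZMod 2) : Submodule ℂ (vertexFields V) where
  carrier := {a | (∀ n v, G.D (a.1 n v) - a.1 n (G.D v) = -(n : ℂ) • a.1 (n - 1) v) ∧
    (∀ n : ℤ, 0 ≤ n → a.1 n G.vac = 0) ∧
    (∀ n c, ∀ v ∈ G.grading c, a.1 n v ∈ G.grading (b + c)) ∧
    ∀ x, IsLocal (superSign b (G.parity x)) a.1 (G.field x).1}
  add_mem' {a a'} h h' := by
    refine ⟨fun n v => ?_, fun n hn => ?_, fun n c v hv => ?_, fun x => (h.2.2.2 x).add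
      (h'.2.2.2 x)⟩
    · have e := congrArg₂ (· + ·) (h.1 n v) (h'.1 n v)
      simp only [Submodule.coe_add, Pi.add_apply, LinearMap.add_apply, map_add, smul_add] at e ⊢
      rw [← e]
      abel
    · simp [h.2.1 n hn, h'.2.1 n hn]
    · exact add_mem (h.2.2.1 n c v hv) (h'.2.2.1 n c v hv)
  zero_mem' := ⟨by simp, by simp, by simp, fun x => IsLocal.zero_left _ _⟩
  smul_mem' c a h := by
    refine ⟨fun n v => ?_, fun n hn => ?_, fun n d v hv => ?_, fun x => (h.2.2.2 x).smul c⟩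
    · have e := congrArg (c • ·) (h.1 n v)
      simp only [Submodule.coe_smul, Pi.smul_apply, LinearMap.smul_apply, map_smul, smul_sub]
        at e ⊢
      rw [e, smul_comm]
    · simp [h.2.1 n hn]
    · exact Submodule.smul_mem _ _ (h.2.2.1 n d v hv)

variable {G}

theorem field_mem (x : X) : G.field x ∈ G.stateFields (G.parity x) :=
  ⟨G.covariant x, G.creative x, G.homog x, G.isLocal x⟩

theorem isLocal_field {b : ZMod 2} {a : vertexFields V} (ha : a ∈ G.stateFields b) (x : X) :
    IsLocal (superSign (G.parity x) b) (G.field x).1 a.1 := by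
  rw [superSign_comm]
  exact (ha.2.2.2 x).symm (superSign_mul_self _ _)

variable (V) in
/-- The identity field. -/
def idField : vertexFields V where
  val n := if n = -1 then 1 else 0
  property v := ⟨0, fun n hn => by simp only; rw [if_neg (by omega)]; rfl⟩

theorem idField_apply (n : ℤ) (v : V) : (idField V).1 n v = if n = -1 then v else 0 := by
  simp only [idField]
  split_ifs <;> rfl

theorem idField_mem : idField V ∈ G.stateFields 0 := by
  refine ⟨fun n v => ?_, fun n hn => ?_, fun n c v hv => ?_, fun x => ⟨0, ?_⟩⟩
  · simp only [idField_apply]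
    by_cases h : n = -1
    · subst h; simp
    · by_cases h' : n = 0
      · subst h'; simp
      · rw [if_neg h, if_neg h, if_neg (by omega)]; simp
  · rw [idField_apply, if_neg (by omega)]
  · rw [idField_apply, zero_add]
    split_ifs
    · exact hv
    · exact zero_mem _
  · ext m n : 2
    simp only [pow_zero, Module.End.one_apply, superComm, superSign_zero_left, idField, one_smul,
      Pi.zero_apply]
    split_ifs <;> simp

theorem prod_mem {a b : ZMod 2} {f g : vertexFields V} (hf : f ∈ G.stateFields a)
    (hg : g ∈ G.stateFields b) (h : IsLocal (superSign a b) f.1 g.1) (n : ℤ) :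
    fieldProd (superSign a b) n f g ∈ G.stateFields (a + b) :=
  ⟨fieldProd_covariant G.D hf.1 hg.1 n, fieldProd_creative hf.2.1 hg.2.1 n,
    fun k c v hv => fieldProd_homog (fun n c v hv => hf.2.2.1 n c v hv)
      (fun n c v hv => hg.2.2.1 n c v hv) n k c v hv, fun x => by
      rw [superSign_add_left]
      exact h.fieldProd (hf.2.2.2 x) (hg.2.2.2 x) n⟩

/-- The derivative of a field. -/
def derivField (a : vertexFields V) : vertexFields V where
  val n := -(n : ℂ) • a.1 (n - 1)
  property v := by
    obtain ⟨N, hN⟩ := a.2 v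
    exact ⟨N + 1, fun n hn => by rw [LinearMap.smul_apply, hN _ (by omega), smul_zero]⟩

theorem derivField_mem {b : ZMod 2} {a : vertexFields V} (ha : a ∈ G.stateFields b) :
    derivField a ∈ G.stateFields b := by
  refine ⟨fun n v => ?_, fun n hn => ?_, fun n c v hv => ?_, fun x => (ha.2.2.2 x).deriv⟩
  · simp only [derivField, LinearMap.smul_apply, map_smul]
    rw [← smul_sub, ha.1]
  · simp only [derivField, LinearMap.smul_apply]
    rcases hn.eq_or_lt with rfl | hn
    · simp
    · rw [ha.2.1 _ (by omega), smul_zero]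
  · exact Submodule.smul_mem _ _ (ha.2.2.1 _ c v hv)

/-- Goddard's uniqueness argument: covariance and `D 1 = 0` propagate the vanishing from `a₋₁ 1` to
all `a_{-1-j} 1`, the nonnegative modes kill the vacuum anyway, and locality extends the vanishing
from the vacuum to all of `V`. -/
theorem stateField_eq_zero {b : ZMod 2} {a : vertexFields V} (ha : a ∈ G.stateFields b)
    (h : a.1 (-1) G.vac = 0) : a = 0 := by
  have hneg : ∀ j : ℕ, a.1 (-1 - j) G.vac = 0 := by
    intro j
    induction j with
    | zero => simpa using h
    | succ j ih =>
      have e := ha.1 (-1 - j) G.vac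
      rw [ih, G.D_vac, map_zero, map_zero, sub_zero, eq_comm, smul_eq_zero] at e
      have e' : (-1 - ((j + 1 : ℕ) : ℤ)) = -1 - j - 1 := by push_cast; ring
      rw [e']
      refine e.resolve_left ?_
      have : ((-1 - (j : ℤ) : ℤ) : ℂ) ≠ 0 := Int.cast_ne_zero.2 (by omega)
      exact neg_ne_zero.2 this
  refine Subtype.ext (eq_zero_of_isLocal G.field G.generate (fun x => ⟨_, ha.2.2.2 x⟩) fun n => ?_)
  rcases le_or_gt 0 n with hn | hn
  · exact ha.2.1 n hn
  · have := hneg (-1 - n).toNat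
    rwa [Int.toNat_of_nonneg (by omega), sub_sub_cancel] at this

theorem stateField_ext {b : ZMod 2} {a a' : vertexFields V} (ha : a ∈ G.stateFields b)
    (ha' : a' ∈ G.stateFields b) (h : a.1 (-1) G.vac = a'.1 (-1) G.vac) : a = a' := by
  rw [← sub_eq_zero]
  exact stateField_eq_zero (sub_mem ha ha') (by simp [h])

variable (G) in
/-- The map `a ↦ a₋₁ 1` from fields to states. -/
def state : vertexFields V →ₗ[ℂ] V where
  toFun a := a.1 (-1) G.vac
  map_add' _ _ := rfl
  map_smul' _ _ := rfl

theorem state_mem {b : ZMod 2} {a : vertexFields V} (ha : a ∈ G.stateFields b) :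
    G.state a ∈ G.grading b := by
  have h := ha.2.2.1 (-1) 0 _ G.vac_even
  rwa [add_zero] at h

theorem state_prod {a b : ZMod 2} {f g : vertexFields V} (hf : f ∈ G.stateFields a)
    (hg : g ∈ G.stateFields b) (ε : ℂ) (n : ℤ) :
    G.state (fieldProd ε n f g) = f.1 n (G.state g) :=
  fieldProd_neg_one hf.2.1 hg.2.1 n

/-- A family of homogeneous states that contains the vacuum vector and is closed under the
generating fields contains all homogeneous states. -/
theorem homogeneous_generate {Z : ZMod 2 → Submodule ℂ V} (hZ : ∀ a, Z a ≤ G.grading a)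
    (h0 : G.vac ∈ Z 0) (h : ∀ x n b, ∀ v ∈ Z b, (G.field x).1 n v ∈ Z (G.parity x + b))
    (b : ZMod 2) : Z b = G.grading b := by
  refine eq_of_le_of_isInternal G.isInternal hZ (G.generate _ ?_ fun x n w hw => ?_) b
  · exact Submodule.mem_iSup_of_mem 0 h0
  · induction hw using Submodule.iSup_induction' with
    | mem a w hw => exact Submodule.mem_iSup_of_mem _ (h x n a w hw)
    | zero => rw [map_zero]; exact zero_mem _
    | add v w _ _ hv hw => rw [map_add]; exact add_mem hv hw

/-- The identity field produces the vacuum, and the product of a generating field with a field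
producing `w` produces the corresponding mode applied to `w`; so the states obtained are closed
under the generators. -/
theorem map_stateFields (b : ZMod 2) : (G.stateFields b).map G.state = G.grading b := by
  refine homogeneous_generate (Z := fun b => (G.stateFields b).map G.state) ?_ ?_ ?_ b
  · rintro a _ ⟨f, hf, rfl⟩
    exact state_mem hf
  · exact ⟨idField V, idField_mem, by simp [state, idField_apply]⟩
  · rintro x n b _ ⟨f, hf, rfl⟩
    exact ⟨_, prod_mem (field_mem x) hf (isLocal_field hf x) n, state_prod (field_mem x) hf _ n⟩

variable (G) in
-- In each degree the map to states is bijective, by `stateField_ext` and `map_stateFields`; the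
-- inverses are glued along the grading.
theorem exists_stateField : ∃ Y : V →ₗ[ℂ] vertexFields V,
    ∀ b, ∀ v ∈ G.grading b, Y v ∈ G.stateFields b ∧ G.state (Y v) = v := by
  let s : ∀ b, G.stateFields b →ₗ[ℂ] G.grading b := fun b =>
    (G.state.domRestrict (G.stateFields b)).codRestrict (G.grading b) fun a => state_mem a.2
  have hs : ∀ b, Function.Bijective (s b) := by
    intro b
    constructor
    · intro a a' h
      exact Subtype.ext (stateField_ext a.2 a'.2 (congrArg Subtype.val h))
    · rintro ⟨v, hv⟩
      rw [← map_stateFields] at hv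
      obtain ⟨a, ha, rfl⟩ := hv
      exact ⟨⟨a, ha⟩, rfl⟩
  obtain ⟨Y, hY⟩ := exists_linearMap_of_isInternal G.isInternal
    fun b => (G.stateFields b).subtype ∘ₗ (LinearEquiv.ofBijective (s b) (hs b)).symm.toLinearMap
  refine ⟨Y, fun b v hv => ?_⟩
  rw [hY b v hv]
  refine ⟨Subtype.property _, ?_⟩
  exact congrArg Subtype.val ((LinearEquiv.ofBijective (s b) (hs b)).apply_symm_apply ⟨v, hv⟩)

variable (G) in
/-- The state-field correspondence. -/
def toField : V →ₗ[ℂ] vertexFields V := G.exists_stateField.choose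

theorem toField_mem {b : ZMod 2} {v : V} (hv : v ∈ G.grading b) : G.toField v ∈ G.stateFields b :=
  (G.exists_stateField.choose_spec b v hv).1

theorem state_toField {b : ZMod 2} {v : V} (hv : v ∈ G.grading b) : G.state (G.toField v) = v :=
  (G.exists_stateField.choose_spec b v hv).2

theorem toField_state {b : ZMod 2} {a : vertexFields V} (ha : a ∈ G.stateFields b) :
    G.toField (G.state a) = a :=
  stateField_ext (toField_mem (state_mem ha)) ha (state_toField (state_mem ha))

/-- The fields in `stateFields` are only required to be local with respect to the generators. For
fixed `v`, the `u` whose fields are local with that of `v` include the vacuum and are stable under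
the generators, again by Dong's lemma. -/
theorem isLocal_toField {b c : ZMod 2} {u v : V} (hu : u ∈ G.grading b) (hv : v ∈ G.grading c) :
    IsLocal (superSign b c) (G.toField u).1 (G.toField v).1 := by
  let Z : ZMod 2 → Submodule ℂ V := fun b =>
    { carrier := {u | u ∈ G.grading b ∧ IsLocal (superSign b c) (G.toField u).1 (G.toField v).1}
      add_mem' := fun {u u'} h h' => ⟨add_mem h.1 h'.1, by rw [map_add]; exact h.2.add h'.2⟩
      zero_mem' := ⟨zero_mem _, by rw [map_zero]; exact IsLocal.zero_left _ _⟩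
      smul_mem' := fun r u h => ⟨Submodule.smul_mem _ r h.1, by
        rw [map_smul]; exact h.2.smul r⟩ }
  have hZ : Z b = G.grading b := by
    refine homogeneous_generate (Z := Z) (fun a u h => h.1) ?_ (fun x n a w hw => ?_) b
    · refine ⟨G.vac_even, ?_⟩
      have e : G.state (idField V) = G.vac := by simp [state, idField_apply]
      rw [← e, toField_state idField_mem]
      refine ⟨0, ?_⟩
      ext m n : 2
      simp only [pow_zero, Module.End.one_apply, superComm, superSign_zero_left, idField, one_smul,
        Pi.zero_apply]
      split_ifs <;> simp
    · have hw' := toField_mem hw.1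
      have hl := isLocal_field hw' x
      have hp := prod_mem (field_mem x) hw' hl n
      refine ⟨G.homog x n a w hw.1, ?_⟩
      have e : (G.field x).1 n w = G.state (fieldProd (superSign (G.parity x) a) n (G.field x)
          (G.toField w)) := by rw [state_prod (field_mem x) hw', state_toField hw.1]
      rw [e, toField_state hp, superSign_add_left]
      exact hl.fieldProd (isLocal_field (toField_mem hv) x) hw.2 n
  have hu' : u ∈ Z b := by rw [hZ]; exact hu
  exact hu'.2

/-- Both fields belong to `stateFields` and produce the same state. Dong's lemma needs the two
factors to be local with respect to each other, hence `isLocal_toField`. -/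
theorem toField_toField {b c : ZMod 2} {u v : V} (hu : u ∈ G.grading b) (hv : v ∈ G.grading c)
    (n : ℤ) : G.toField ((G.toField u).1 n v) =
      fieldProd (superSign b c) n (G.toField u) (G.toField v) := by
  rw [← toField_state (prod_mem (toField_mem hu) (toField_mem hv) (isLocal_toField hu hv) n),
    state_prod (toField_mem hu) (toField_mem hv), state_toField hv]

theorem iSup_grading : ⨆ b, G.grading b = ⊤ := G.isInternal.submodule_iSup_eq_top

theorem toField_D (v : V) : G.toField (G.D v) = derivField (G.toField v) := by
  refine homogeneous_induction G.iSup_grading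
    (p := fun v => G.toField (G.D v) = derivField (G.toField v)) (fun b v hv => ?_)
    (fun v w hv hw => ?_) v
  · have h := toField_mem hv
    rw [← toField_state (derivField_mem h)]
    congr 1
    have e := h.1 (-1) G.vac
    rw [G.D_vac, map_zero, sub_zero] at e
    have e' := state_toField hv
    rw [state, LinearMap.coe_mk, AddHom.coe_mk] at e'
    rw [e'] at e
    exact e
  · rw [map_add, map_add, hv, hw, map_add]
    refine Subtype.ext (funext fun n => ?_)
    exact (smul_add _ _ _).symm

variable (G) in
/-- The vertex superalgebra generated by the fields. -/
def vertexSuperalgebra : VertexSuperalgebra V where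
  grading := G.grading
  isInternal := G.isInternal
  vac := G.vac
  D := G.D
  mul n := LinearMap.proj n ∘ₗ (vertexFields V).subtype ∘ₗ G.toField
  truncation u v := (G.toField u).2 v
  D_comm n u v := by
    refine homogeneous_induction G.iSup_grading
      (p := fun u => G.D ((G.toField u).1 n v) - (G.toField u).1 n (G.D v) =
        (G.toField (G.D u)).1 n v) (fun b u hu => ?_) (fun u w hu hw => ?_) u
    · rw [toField_D, (toField_mem hu).1]
      rfl
    · simp only [map_add, Submodule.coe_add, Pi.add_apply, LinearMap.add_apply, ← hu, ← hw]
      abel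
  mul_D n u v := by
    change (G.toField (G.D u)).1 n v = _
    rw [toField_D]
    rfl
  vac_mul n v := by
    have e : G.state (idField V) = G.vac := by simp [state, idField_apply]
    change (G.toField G.vac).1 n v = _
    rw [← idField_apply, ← e, toField_state idField_mem]
  mul_vac_nonneg n hn u := by
    refine homogeneous_induction G.iSup_grading (p := fun u => (G.toField u).1 n G.vac = 0)
      (fun b u hu => (toField_mem hu).2.1 n hn) (fun u w hu hw => ?_) u
    simp [hu, hw]
  mul_vac u := by
    refine homogeneous_induction G.iSup_grading (p := fun u => (G.toField u).1 (-1) G.vac = u)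
      (fun b u hu => state_toField hu) (fun u w hu hw => ?_) u
    simp [hu, hw]
  jacobi a b u v hu hv k m n w := by
    have h := fieldRes_eq_binSum (isLocal_toField hu hv) k m n w
    refine h.symm.trans (finsum_congr fun i => ?_)
    have e := toField_toField hu hv (k + i)
    exact congrArg (fun a : vertexFields V => intChoose m i • a.1 (m + n - i) w) e.symm
  homog a b u v hu hv n := (toField_mem hu).2.2.1 n b v hv

theorem vertexSuperalgebra_mul (x : X) (n : ℤ) (v : V) :
    G.vertexSuperalgebra.mul n ((G.field x).1 (-1) G.vac) v = (G.field x).1 n v := by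
  change (G.toField (G.state (G.field x))).1 n v = _
  rw [toField_state (field_mem x)]

end GeneratingFields

/-! ### A Poincaré–Birkhoff–Witt theorem relative to a subalgebra -/

/-- A Lie superalgebra `L` with a homogeneous basis indexed by a well-ordered set, of which an
upper segment spans a subalgebra. -/
structure OrderedSuperBasis (L I : Type*) [AddCommGroup L] [Module ℂ L] [LinearOrder I] where
  grading : ZMod 2 → Submodule ℂ L
  isInternal : DirectSum.IsInternal grading
  bracket : L →ₗ[ℂ] L →ₗ[ℂ] L
  skew : ∀ a b x y, x ∈ grading a → y ∈ grading b → bracket x y = -superSign a b • bracket y x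
  jacobi : ∀ a b x y, x ∈ grading a → y ∈ grading b → ∀ c, ∀ z ∈ grading c,
    bracket x (bracket y z) = bracket (bracket x y) z + superSign a b • bracket y (bracket x z)
  homog : ∀ a b x y, x ∈ grading a → y ∈ grading b → bracket x y ∈ grading (a + b)
  basis : Module.Basis I ℂ L
  deg : I → ZMod 2
  basis_mem : ∀ i, basis i ∈ grading (deg i)
  pos : Set I
  pos_upper : IsUpperSet pos
  bracket_pos : ∀ i ∈ pos, ∀ j ∈ pos, bracket (basis i) (basis j) ∈
    Submodule.span ℂ (basis '' pos)

namespace OrderedSuperBasis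

variable {L I : Type*} [AddCommGroup L] [Module ℂ L] [LinearOrder I]

open Classical in
/-- The action of a basis vector on an ordered monomial. -/
def act [WellFoundedLT I] (B : OrderedSuperBasis L I) (i : I) (w : List I) : List I →₀ ℂ :=
  match w with
  | [] => if i ∈ B.pos then 0 else Finsupp.single [i] 1
  | j :: w =>
    if i < j ∨ (i = j ∧ B.deg i = 0) then Finsupp.single (i :: j :: w) 1
    else if _h : j < i then
      -- The rule `x_i x_j w = ± x_j x_i w + [x_i, x_j] w`. The bound on the length always holds, by
      -- `act_mem_length`; it is tested only to make the recursion visibly terminate.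
      superSign (B.deg i) (B.deg j) •
        ((act B i w).sum fun w' c => if _h' : w'.length ≤ w.length + 1 then c • act B j w' else 0) +
        (B.basis.repr (B.bracket (B.basis i) (B.basis j))).sum fun k c => c • act B k w
    -- Here `i = j` is odd, and `x² = ½ [x, x]`.
    else (2⁻¹ : ℂ) • (B.basis.repr (B.bracket (B.basis i) (B.basis j))).sum fun k c => c • act B k w
-- In `x_j (x_i w)` the inner result may be as long as `j :: w`; then the index has dropped from `i`
-- to `j`, which is why the basis has to be well-ordered.
termination_by (w.length, WellFounded.wrap (wellFounded_lt (α := I)) i)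
decreasing_by
  · exact Prod.Lex.left _ _ (by simp)
  · rcases Nat.lt_or_ge w'.length (j :: w).length with h | h
    · exact Prod.Lex.left _ _ h
    · have e : w'.length = (j :: w).length := le_antisymm _h' h
      rw [e]
      exact Prod.Lex.right _ _h
  · exact Prod.Lex.left _ _ (by simp)
  · exact Prod.Lex.left _ _ (by simp)

variable [WellFoundedLT I] (B : OrderedSuperBasis L I)

/-- The operator by which a basis vector acts. -/
def op (i : I) : Module.End ℂ (List I →₀ ℂ) := Finsupp.linearCombination ℂ (B.act i)

/-- The action of `L` on the span of the monomials. -/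
def rep : L →ₗ[ℂ] Module.End ℂ (List I →₀ ℂ) := B.basis.constr ℂ B.op

theorem op_single (i : I) (w : List I) : B.op i (Finsupp.single w 1) = B.act i w := by
  simp [op]

theorem rep_basis (i : I) : B.rep (B.basis i) = B.op i := by simp [rep]

theorem rep_single (x : L) (w : List I) :
    B.rep x (Finsupp.single w 1) = (B.basis.repr x).sum fun k c => c • B.act k w := by
  rw [rep, Module.Basis.constr_apply, Finsupp.sum, Finsupp.sum, LinearMap.sum_apply]
  simp [op_single]

/-- `i` may precede `j` in an ordered monomial. -/
def prec (i j : I) : Prop := i < j ∨ (i = j ∧ B.deg i = 0)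

/-- Ordered monomials in the basis vectors outside the subalgebra. -/
def IsOrdered (w : List I) : Prop := (∀ k ∈ w, k ∉ B.pos) ∧ w.Pairwise B.prec

variable {B}

omit [WellFoundedLT I] in
theorem prec.le {i j : I} (h : B.prec i j) : i ≤ j := h.elim le_of_lt fun h => h.1.le

omit [WellFoundedLT I] in
theorem prec.trans {i j k : I} (h : B.prec i j) (h' : B.prec j k) : B.prec i k := by
  rcases h with h | ⟨rfl, _⟩
  · exact Or.inl (h.trans_le h'.le)
  · exact h'

omit [WellFoundedLT I] in
theorem isOrdered_cons {i : I} {w : List I} :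
    B.IsOrdered (i :: w) ↔ i ∉ B.pos ∧ (∀ j ∈ w, B.prec i j) ∧ B.IsOrdered w := by
  simp only [IsOrdered, List.mem_cons, forall_eq_or_imp, List.pairwise_cons]
  tauto

omit [WellFoundedLT I] in
theorem IsOrdered.cons {i j : I} {w : List I} (h : B.IsOrdered (j :: w)) (hij : B.prec i j) :
    B.IsOrdered (i :: j :: w) := by
  have h' := isOrdered_cons.1 h
  refine isOrdered_cons.2 ⟨fun hi => h'.1 (B.pos_upper hij.le hi), ?_, h⟩
  simp only [List.mem_cons, forall_eq_or_imp]
  exact ⟨hij, fun k hk => hij.trans (h'.2.1 k hk)⟩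

omit [WellFoundedLT I] in
theorem IsOrdered.tail {i : I} {w : List I} (h : B.IsOrdered (i :: w)) : B.IsOrdered w :=
  (isOrdered_cons.1 h).2.2

theorem act_of_isOrdered {i : I} {w : List I} (h : B.IsOrdered (i :: w)) :
    B.act i w = Finsupp.single (i :: w) 1 := by
  have h' := isOrdered_cons.1 h
  cases w with
  | nil => rw [act, if_neg h'.1]
  | cons j w =>
    have hij : i < j ∨ (i = j ∧ B.deg i = 0) := h'.2.1 j (by simp)
    rw [act, if_pos hij]

/-- Induction along the order by which the recursion for `act` terminates. -/
theorem word_induction {p : I → List I → Prop} (h : ∀ i w,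
    (∀ k w', w'.length < w.length → p k w') → (∀ j < i, ∀ w', w'.length ≤ w.length → p j w') →
    p i w) (i : I) (w : List I) : p i w := by
  have key : ∀ (n : ℕ) (i : I) (w : List I), w.length = n → p i w := by
    intro n
    induction n using Nat.strong_induction_on with
    | _ n ih =>
      intro i
      induction i using WellFoundedLT.induction with
      | _ i ihi =>
        intro w hw
        refine h i w (fun k w' hw' => ih _ (hw ▸ hw') k w' rfl) fun j hj w' hw' => ?_
        rcases hw'.lt_or_eq with hlt | heq
        · exact ih _ (hw ▸ hlt) j w' rfl
        · exact ihi j hj w' (heq.trans hw)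
  exact key _ i w rfl

omit [LinearOrder I] [WellFoundedLT I] in
theorem sum_smul_mem {J : Type*} {N : Submodule ℂ (List I →₀ ℂ)} (f : J →₀ ℂ)
    (g : J → List I →₀ ℂ) (h : ∀ j ∈ f.support, g j ∈ N) : (f.sum fun j c => c • g j) ∈ N :=
  Submodule.sum_mem _ fun j hj => N.smul_mem _ (h j hj)

theorem act_mem_length (i : I) (w : List I) :
    B.act i w ∈ Finsupp.supported ℂ ℂ {w' : List I | w'.length ≤ w.length + 1} := by
  refine word_induction (p := fun i w =>
    B.act i w ∈ Finsupp.supported ℂ ℂ {w' : List I | w'.length ≤ w.length + 1})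
    (fun i w ih1 ih2 => ?_) i w
  have mono : ∀ {n m : ℕ} {v : List I →₀ ℂ}, n ≤ m →
      v ∈ Finsupp.supported ℂ ℂ {w' : List I | w'.length ≤ n} →
      v ∈ Finsupp.supported ℂ ℂ {w' : List I | w'.length ≤ m} := fun hnm hv =>
    Finsupp.supported_mono (fun w hw => le_trans hw hnm) hv
  cases w with
  | nil =>
    rw [act]
    split_ifs
    · exact zero_mem _
    · exact Finsupp.single_mem_supported _ _ (by simp)
  | cons j w =>
    have hk : ∀ x : L, ((B.basis.repr x).sum fun k c => c • B.act k w) ∈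
        Finsupp.supported ℂ ℂ {w' : List I | w'.length ≤ (j :: w).length + 1} := fun x =>
      sum_smul_mem _ _ fun k _ => mono (by simp) (ih1 k w (by simp))
    rw [act]
    split_ifs with h1 h2
    · exact Finsupp.single_mem_supported _ _ (by simp)
    · refine add_mem (Submodule.smul_mem _ _ (Submodule.sum_mem _ fun w' _ => ?_)) (hk _)
      dsimp only
      split_ifs with h3
      · exact Submodule.smul_mem _ _ (mono (by simpa using h3) (ih2 j h2 w' h3))
      · exact zero_mem _
    · exact Submodule.smul_mem _ _ (hk _)

theorem act_cons_of_lt {i j : I} (h : j < i) (w : List I) : B.act i (j :: w) =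
    superSign (B.deg i) (B.deg j) • B.op j (B.act i w) +
      B.rep (B.bracket (B.basis i) (B.basis j)) (Finsupp.single w 1) := by
  rw [act, if_neg (by rintro (h' | h'); exacts [lt_asymm h h', h.ne h'.1.symm]), dif_pos h,
    rep_single]
  congr 2
  rw [op, Finsupp.linearCombination_apply]
  refine Finsupp.sum_congr fun w' hw' => ?_
  rw [dif_pos]
  exact (Finsupp.mem_supported _ _).1 (act_mem_length i w) hw'

theorem act_cons_self {i : I} (h : B.deg i = 1) (w : List I) : B.act i (i :: w) =
    (2⁻¹ : ℂ) • B.rep (B.bracket (B.basis i) (B.basis i)) (Finsupp.single w 1) := by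
  rw [act, if_neg (by simp [h]), dif_neg (lt_irrefl i), rep_single]

omit [LinearOrder I] [WellFoundedLT I] in
theorem mem_of_mem_supported {s : Set (List I)} {N : Submodule ℂ (List I →₀ ℂ)}
    (h : ∀ w ∈ s, Finsupp.single w 1 ∈ N) {v : List I →₀ ℂ} (hv : v ∈ Finsupp.supported ℂ ℂ s) :
    v ∈ N := by
  rw [Finsupp.supported_eq_span_single] at hv
  refine (Submodule.span_le.2 ?_) hv
  rintro _ ⟨w, hw, rfl⟩
  exact h w hw

theorem op_mem {s : Set (List I)} {N : Submodule ℂ (List I →₀ ℂ)} {i : I}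
    (h : ∀ w ∈ s, B.act i w ∈ N) {v : List I →₀ ℂ} (hv : v ∈ Finsupp.supported ℂ ℂ s) :
    B.op i v ∈ N := by
  have := mem_of_mem_supported (N := N.comap (B.op i)) (fun w hw => by
    rw [Submodule.mem_comap, op_single]; exact h w hw) hv
  exact this

theorem rep_mem {s : Set (List I)} {N : Submodule ℂ (List I →₀ ℂ)}
    (h : ∀ i, ∀ w ∈ s, B.act i w ∈ N) (x : L) {v : List I →₀ ℂ}
    (hv : v ∈ Finsupp.supported ℂ ℂ s) : B.rep x v ∈ N := by
  refine mem_of_mem_supported (N := N.comap (B.rep x)) (fun w hw => ?_) hv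
  rw [Submodule.mem_comap, rep_single]
  exact sum_smul_mem _ _ fun i _ => h i w hw

omit [WellFoundedLT I] in
theorem cons_cases {i j : I} {w : List I} (hw : B.IsOrdered (j :: w)) :
    B.IsOrdered (i :: j :: w) ∨ j < i ∨ (i = j ∧ B.deg i = 1) := by
  rcases lt_trichotomy i j with h | rfl | h
  · exact Or.inl (hw.cons (Or.inl h))
  · have : B.deg i = 0 ∨ B.deg i = 1 := by generalize B.deg i = a; revert a; decide
    rcases this with h | h
    · exact Or.inl (hw.cons (Or.inr ⟨rfl, h⟩))
    · exact Or.inr (Or.inr ⟨rfl, h⟩)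
  · exact Or.inr (Or.inl h)

theorem act_mem_ordered (i : I) (w : List I) (hw : B.IsOrdered w) : B.act i w ∈
    Finsupp.supported ℂ ℂ {w' : List I | B.IsOrdered w' ∧ w'.length ≤ w.length + 1} := by
  suffices h : B.act i w ∈ Finsupp.supported ℂ ℂ {w' : List I | B.IsOrdered w'} from
    (Finsupp.mem_supported _ _).2 fun w' hw' => ⟨(Finsupp.mem_supported _ _).1 h hw',
      (Finsupp.mem_supported _ _).1 (act_mem_length i w) hw'⟩
  revert hw
  refine word_induction (p := fun i w => B.IsOrdered w →
    B.act i w ∈ Finsupp.supported ℂ ℂ {w' : List I | B.IsOrdered w'})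
    (fun i w ih1 ih2 hw => ?_) i w
  cases w with
  | nil =>
    rw [act]
    split_ifs with h
    · exact zero_mem _
    · exact Finsupp.single_mem_supported _ _ (isOrdered_cons.2 ⟨h, by simp, hw⟩)
  | cons j w =>
    have hrep : ∀ x, B.rep x (Finsupp.single w 1) ∈
        Finsupp.supported ℂ ℂ {w' : List I | B.IsOrdered w'} := fun x => by
      rw [rep_single]
      exact sum_smul_mem _ _ fun k _ => ih1 k w (by simp) hw.tail
    rcases cons_cases (i := i) hw with h | h | ⟨rfl, h⟩
    · rw [act_of_isOrdered h]
      exact Finsupp.single_mem_supported _ _ h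
    · rw [act_cons_of_lt h]
      refine add_mem (Submodule.smul_mem _ _ (op_mem (s := {w' | B.IsOrdered w' ∧
        w'.length ≤ w.length + 1}) (fun w' hw' => ih2 j h w' hw'.2 hw'.1) ?_)) (hrep _)
      exact (Finsupp.mem_supported _ _).2 fun w' hw' =>
        ⟨(Finsupp.mem_supported _ _).1 (ih1 i w (by simp) hw.tail) hw',
          (Finsupp.mem_supported _ _).1 (act_mem_length i w) hw'⟩
    · rw [act_cons_self h]
      exact Submodule.smul_mem _ _ (hrep _)

/-- Moving `i` into place inserts it among letters that `k` may precede, and `k` may precede `i`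
itself; all other terms come from commutators and are no longer than `w`. -/
theorem act_mem_leading {i k : I} (w : List I) (hki : k < i) (hw : B.IsOrdered (k :: w)) :
    B.act i w ∈ Finsupp.supported ℂ ℂ
      {w' : List I | B.IsOrdered w' ∧ (B.IsOrdered (k :: w') ∨ w'.length ≤ w.length)} := by
  induction w generalizing k with
  | nil =>
    rw [act]
    split_ifs with h
    · exact zero_mem _
    · have h1 : B.IsOrdered [i] := isOrdered_cons.2 ⟨h, by simp, hw.tail⟩
      have h2 : B.IsOrdered [k, i] := h1.cons (Or.inl hki)
      exact Finsupp.single_mem_supported ℂ _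
        (show B.IsOrdered [i] ∧ (B.IsOrdered [k, i] ∨ [i].length ≤ 0) from ⟨h1, Or.inl h2⟩)
  | cons j w ih =>
    have hlow : ∀ w', B.IsOrdered w' → w'.length ≤ w.length → ∀ l, B.act l w' ∈
        Finsupp.supported ℂ ℂ {w' : List I | B.IsOrdered w' ∧
          (B.IsOrdered (k :: w') ∨ w'.length ≤ (j :: w).length)} := by
      intro w' hw' hl l
      refine Finsupp.supported_mono ?_ (act_mem_ordered l w' hw')
      rintro w'' ⟨h1, h2⟩
      exact ⟨h1, Or.inr (h2.trans (by simpa using hl))⟩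
    have hrep : ∀ x, B.rep x (Finsupp.single w 1) ∈ Finsupp.supported ℂ ℂ
        {w' : List I | B.IsOrdered w' ∧
          (B.IsOrdered (k :: w') ∨ w'.length ≤ (j :: w).length)} := fun x => by
      rw [rep_single]
      exact sum_smul_mem _ _ fun l _ => hlow w hw.tail.tail le_rfl l
    have hkj := (isOrdered_cons.1 hw).2.1 j (by simp)
    rcases cons_cases (i := i) hw.tail with h | h | ⟨rfl, h⟩
    · rw [act_of_isOrdered h]
      exact Finsupp.single_mem_supported _ _ ⟨h, Or.inl (h.cons (Or.inl hki))⟩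
    · rw [act_cons_of_lt h]
      refine add_mem (Submodule.smul_mem _ _ (op_mem (fun w' hw' => ?_) (ih h hw.tail))) (hrep _)
      rcases hw'.2 with h' | h'
      · rw [act_of_isOrdered h']
        exact Finsupp.single_mem_supported _ _ ⟨h', Or.inl (h'.cons hkj)⟩
      · exact hlow w' hw'.1 h' j
    · rw [act_cons_self h]
      exact Submodule.smul_mem _ _ (hrep _)

/-- When `j` may be put in front of `w`, the relation is the rule that defines `act`. For `i = j`
even both sides agree because `[x, x] = 0` by skew symmetry. -/
theorem rel_of_isOrdered {i j : I} (hij : j ≤ i) {w : List I} (hw : B.IsOrdered (j :: w)) :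
    B.op i (B.op j (Finsupp.single w 1)) =
      superSign (B.deg i) (B.deg j) • B.op j (B.op i (Finsupp.single w 1)) +
        B.rep (B.bracket (B.basis i) (B.basis j)) (Finsupp.single w 1) := by
  rcases hij.lt_or_eq with h | rfl
  · rw [op_single, act_of_isOrdered hw, op_single, act_cons_of_lt h, op_single]
  · have hd : B.deg j = 0 ∨ B.deg j = 1 := by generalize B.deg j = a; revert a; decide
    rcases hd with hd | hd
    · have h := B.skew _ _ _ _ (B.basis_mem j) (B.basis_mem j)
      rw [hd, superSign_zero_left, neg_one_smul] at h
      have h0 : B.bracket (B.basis j) (B.basis j) = 0 := by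
        have : (2 : ℂ) • B.bracket (B.basis j) (B.basis j) = 0 := by
          rw [two_smul]; nth_rw 2 [h]; exact add_neg_cancel _
        exact (smul_eq_zero.1 this).resolve_left two_ne_zero
      rw [h0, hd, superSign_zero_left, one_smul, map_zero, LinearMap.zero_apply, add_zero]
    · rw [op_single, act_of_isOrdered hw, op_single, act_cons_self hd, hd, superSign_one_one]
      module

variable (B) in
/-- The vectors on which the commutator relations hold. -/
def relSubmodule : Submodule ℂ (List I →₀ ℂ) where
  carrier := {v | ∀ a b x y, x ∈ B.grading a → y ∈ B.grading b → B.rep x (B.rep y v) =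
    superSign a b • B.rep y (B.rep x v) + B.rep (B.bracket x y) v}
  add_mem' {v w} hv hw a b x y hx hy := by
    simp only [map_add, hv a b x y hx hy, hw a b x y hx hy]
    module
  zero_mem' a b x y _ _ := by simp
  smul_mem' c v hv a b x y hx hy := by
    simp only [map_smul, hv a b x y hx hy]
    module

omit [WellFoundedLT I] in
theorem span_basis (a : ZMod 2) :
    Submodule.span ℂ (B.basis '' {i | B.deg i = a}) = B.grading a := by
  refine eq_of_le_of_isInternal (Z := fun a => Submodule.span ℂ (B.basis '' {i | B.deg i = a}))
    B.isInternal (fun a => Submodule.span_le.2 ?_) (eq_top_iff.2 ?_) a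
  · rintro _ ⟨i, rfl, rfl⟩
    exact B.basis_mem i
  · rw [← B.basis.span_eq]
    refine Submodule.span_le.2 ?_
    rintro _ ⟨i, rfl⟩
    exact Submodule.mem_iSup_of_mem (B.deg i) (Submodule.subset_span ⟨i, rfl, rfl⟩)

theorem mem_relSubmodule {v : List I →₀ ℂ} (h : ∀ i j, j ≤ i → B.op i (B.op j v) =
      superSign (B.deg i) (B.deg j) • B.op j (B.op i v) +
        B.rep (B.bracket (B.basis i) (B.basis j)) v) : v ∈ B.relSubmodule := by
  have h' : ∀ i j, B.op i (B.op j v) = superSign (B.deg i) (B.deg j) • B.op j (B.op i v) +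
        B.rep (B.bracket (B.basis i) (B.basis j)) v := by
    intro i j
    rcases le_total j i with hij | hij
    · exact h i j hij
    · have e := h j i hij
      rw [B.skew _ _ _ _ (B.basis_mem i) (B.basis_mem j), map_smul, LinearMap.smul_apply, e,
        smul_add, smul_smul, superSign_comm (B.deg j), superSign_mul_self]
      module
  intro a b x y hx hy
  rw [← span_basis] at hx hy
  induction hx, hy using Submodule.span_induction₂ with
  | mem_mem x y hx hy =>
    obtain ⟨i, rfl, rfl⟩ := hx
    obtain ⟨j, rfl, rfl⟩ := hy
    rw [rep_basis, rep_basis, h']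
  | zero_left => simp
  | zero_right => simp
  | add_left x y z _ _ _ h1 h2 =>
    simp only [map_add, LinearMap.add_apply, h1, h2]
    module
  | add_right x y z _ _ _ h1 h2 =>
    simp only [map_add, LinearMap.add_apply, h1, h2]
    module
  | smul_left r x y _ _ h1 =>
    simp only [map_smul, LinearMap.smul_apply, h1]
    module
  | smul_right r x y _ _ h1 =>
    simp only [map_smul, LinearMap.smul_apply, h1]
    module

theorem rep_pos_nil {x : L} (hx : x ∈ Submodule.span ℂ (B.basis '' B.pos)) :
    B.rep x (Finsupp.single [] 1) = 0 := by
  induction hx using Submodule.span_induction with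
  | mem x hx =>
    obtain ⟨i, hi, rfl⟩ := hx
    rw [rep_basis, op_single, act, if_pos hi]
  | zero => simp
  | add x y _ _ hx hy => rw [map_add, LinearMap.add_apply, hx, hy, add_zero]
  | smul c x _ hx => rw [map_smul, LinearMap.smul_apply, hx, smul_zero]

/-- Applying `i` to `w` may give monomials too long for the inductive hypothesis. By
`act_mem_leading`, `k` may be put in front of these, and then `rel_of_isOrdered` applies. -/
theorem op_mem_relSubmodule {n : ℕ}
    (ih : ∀ w : List I, w.length < n → B.IsOrdered w → Finsupp.single w 1 ∈ B.relSubmodule)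
    {i j k : I} (hki : k < i) (hkj : k ≤ j) {w : List I} (hw : B.IsOrdered (k :: w))
    (hn : w.length < n) :
    B.op j (B.op k (B.op i (Finsupp.single w 1))) =
      superSign (B.deg j) (B.deg k) • B.op k (B.op j (B.op i (Finsupp.single w 1))) +
        B.rep (B.bracket (B.basis j) (B.basis k)) (B.op i (Finsupp.single w 1)) := by
  let T : (List I →₀ ℂ) →ₗ[ℂ] (List I →₀ ℂ) := B.op j ∘ₗ B.op k -
    (superSign (B.deg j) (B.deg k) • B.op k ∘ₗ B.op j +
      B.rep (B.bracket (B.basis j) (B.basis k)))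
  have hT : ∀ v, T v = 0 ↔ B.op j (B.op k v) = superSign (B.deg j) (B.deg k) • B.op k (B.op j v) +
      B.rep (B.bracket (B.basis j) (B.basis k)) v := fun v => sub_eq_zero
  rw [op_single B i, ← hT]
  refine mem_of_mem_supported (N := LinearMap.ker T) (fun w' hw' => ?_) (act_mem_leading w hki hw)
  rw [LinearMap.mem_ker, hT]
  rcases hw'.2 with h | h
  · exact rel_of_isOrdered hkj h
  · have := ih w' (by omega) hw'.1 _ _ _ _ (B.basis_mem j) (B.basis_mem k)
    rwa [rep_basis, rep_basis] at this

/-- In both orders of `x_i`, `x_j`, the letter `k` is moved to the front, by relations on the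
shorter `w` and by `op_mem_relSubmodule`. Then `x_i` and `x_j` are exchanged on `w`, and the
remaining commutators match by the Jacobi identity. -/
theorem rel_cons_of_lt {n : ℕ}
    (ih : ∀ w : List I, w.length < n → B.IsOrdered w → Finsupp.single w 1 ∈ B.relSubmodule)
    {i j k : I} (hkj : k < j) (hji : j ≤ i) {w : List I} (hw : B.IsOrdered (k :: w))
    (hn : w.length < n) :
    B.op i (B.op j (Finsupp.single (k :: w) 1)) =
      superSign (B.deg i) (B.deg j) • B.op j (B.op i (Finsupp.single (k :: w) 1)) +
        B.rep (B.bracket (B.basis i) (B.basis j)) (Finsupp.single (k :: w) 1) := by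
  rw [← act_of_isOrdered hw, ← op_single]
  set v : List I →₀ ℂ := Finsupp.single w 1
  have hv := ih w hn hw.tail
  have hi := B.basis_mem i
  have hj := B.basis_mem j
  have hk := B.basis_mem k
  have h1 := hv _ _ _ _ hj hk
  have h2 := hv _ _ _ _ hi hk
  have h3 := op_mem_relSubmodule ih hkj (hkj.le.trans hji) hw hn
  have h4 := op_mem_relSubmodule ih (hkj.trans_le hji) hkj.le hw hn
  have h5 := hv _ _ _ _ hi hj
  have h6 := hv _ _ _ _ hi (B.homog _ _ _ _ hj hk)
  have h7 := hv _ _ _ _ hj (B.homog _ _ _ _ hi hk)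
  have h8 := hv _ _ _ _ (B.homog _ _ _ _ hi hj) hk
  have hJ := B.jacobi _ _ _ _ hi hj _ _ hk
  rw [superSign_add_right] at h6 h7
  rw [superSign_add_left] at h8
  rw [superSign_comm (B.deg j) (B.deg i)] at h7
  have hs := superSign_mul_self (B.deg i) (B.deg j)
  simp only [rep_basis] at h1 h2 h5 h6 h7 h8
  rw [h1, h2, map_add, map_add, map_smul, map_smul, h3, h4, h5, h6, h7, h8, hJ]
  simp only [map_add, map_smul, LinearMap.add_apply, LinearMap.smul_apply]
  generalize superSign (B.deg i) (B.deg j) = p at *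
  generalize superSign (B.deg i) (B.deg k) = q at *
  generalize superSign (B.deg j) (B.deg k) = r at *
  match_scalars <;> first | ring1 | linear_combination (-r) * hs

/-- Induction on the length. If `j` cannot be put in front of `k :: w`, either `k < j`, settled by
`rel_cons_of_lt`, or `j = k` is odd, where `x_j² = ½ [x_j, x_j]` replaces the exchange of letters.
-/
theorem single_mem_relSubmodule (w : List I) (hw : B.IsOrdered w) :
    Finsupp.single w 1 ∈ B.relSubmodule := by
  generalize hn : w.length = n
  induction n using Nat.strong_induction_on generalizing w with
  | _ n ih =>
  have ih' : ∀ w : List I, w.length < n → B.IsOrdered w →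
      Finsupp.single w 1 ∈ B.relSubmodule := fun w h hw => ih _ h w hw rfl
  refine mem_relSubmodule fun i j hji => ?_
  cases w with
  | nil =>
    -- The subalgebra is an upper segment, so `i` belongs to it as well, and every term of the
    -- relation kills the empty monomial.
    by_cases hj : j ∈ B.pos
    · have hi : i ∈ B.pos := B.pos_upper hji hj
      have h : ∀ i ∈ B.pos, B.op i (Finsupp.single [] 1) = 0 := fun i hi => by
        rw [← rep_basis]
        exact rep_pos_nil (Submodule.subset_span ⟨i, hi, rfl⟩)
      rw [h i hi, h j hj, rep_pos_nil (B.bracket_pos i hi j hj)]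
      simp
    · exact rel_of_isOrdered hji (isOrdered_cons.2 ⟨hj, by simp, hw⟩)
  | cons k w =>
    have hlt : w.length < n := by simp at hn; omega
    rcases cons_cases (i := j) hw with h | h | ⟨rfl, hd⟩
    · exact rel_of_isOrdered hji h
    · exact rel_cons_of_lt ih' h hji hw hlt
    · have hv := ih' w hlt hw.tail
      have hi := B.basis_mem i
      have hj := B.basis_mem j
      have hjj := B.homog _ _ _ _ hj hj
      have hskew := B.skew _ _ _ _ hj (B.homog _ _ _ _ hi hj)
      have hJ := B.jacobi _ _ _ _ hi hj _ _ hj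
      have h6 := hv _ _ _ _ hi hjj
      have h7 := hv _ _ _ _ (B.homog _ _ _ _ hi hj) hj
      have h5 := hv _ _ _ _ hi hj
      rw [hskew, superSign_add_right, superSign_comm (B.deg j) (B.deg i), hd, superSign_one_one,
        smul_smul] at hJ
      rw [superSign_add_right, superSign_mul_self] at h6
      rw [superSign_add_left, hd, superSign_one_one] at h7
      rw [hd] at h5
      have hs := superSign_mul_self (B.deg i) 1
      have hsq : ∀ v : List I →₀ ℂ, B.op j (B.op j v) =
          superSign (B.deg j) (B.deg j) • B.op j (B.op j v) +
            B.rep (B.bracket (B.basis j) (B.basis j)) v →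
          B.op j (B.op j v) = (2⁻¹ : ℂ) • B.rep (B.bracket (B.basis j) (B.basis j)) v := by
        intro v h
        rw [hd, superSign_one_one] at h
        rw [eq_inv_smul_iff₀ two_ne_zero, two_smul]
        nth_rw 2 [h]
        module
      have hsv := hsq _ (by simpa only [rep_basis] using hv _ _ _ _ hj hj)
      rw [← act_of_isOrdered hw, ← op_single]
      set v : List I →₀ ℂ := Finsupp.single w 1
      simp only [rep_basis] at h5 h6 h7
      rcases hji.lt_or_eq with hlt' | rfl
      · have h4 := hsq _ (op_mem_relSubmodule ih' hlt' le_rfl hw hlt)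
        change B.op j (B.op j (B.op i v)) = (2⁻¹ : ℂ) • B.rep _ (B.op i v) at h4
        rw [hsv, map_smul, h6, hJ, h5]
        simp only [map_add, map_smul, LinearMap.add_apply, LinearMap.smul_apply]
        rw [h4, h7, hd]
        generalize superSign (B.deg i) 1 = p at *
        match_scalars <;>
          first
          | ring1
          | linear_combination (2⁻¹ : ℂ) * hs
          | linear_combination (-2⁻¹ : ℂ) * hs
      · rw [hd, superSign_add_right, superSign_mul_self] at hskew
        rw [hd, superSign_one_one] at hJ
        -- For an odd vector the Jacobi identity reads `3 [[x, x], x] = 0`, so `x` commutes with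
        -- `[x, x] = 2 x²`.
        have h0 : B.bracket (B.basis j) (B.bracket (B.basis j) (B.basis j)) = 0 := by
          have h3 : (3 : ℂ) • B.bracket (B.bracket (B.basis j) (B.basis j)) (B.basis j) = 0 := by
            rw [hskew, ← sub_eq_zero] at hJ
            rw [← neg_eq_zero, ← hJ]
            module
          rw [hskew, (smul_eq_zero.1 h3).resolve_left three_ne_zero, smul_zero]
        rw [h0, map_zero, LinearMap.zero_apply, add_zero, one_smul] at h6
        rw [hsv, map_smul, h6, hd, superSign_one_one]
        module

/-- The span of the ordered monomials is stable under `L`. -/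
theorem rep_mem_ordered (x : L) {v : List I →₀ ℂ}
    (hv : v ∈ Finsupp.supported ℂ ℂ {w : List I | B.IsOrdered w}) :
    B.rep x v ∈ Finsupp.supported ℂ ℂ {w : List I | B.IsOrdered w} :=
  rep_mem (fun i w hw => Finsupp.supported_mono (fun _ h => h.1) (act_mem_ordered i w hw)) x hv

variable (B) in
/-- The Poincaré–Birkhoff–Witt theorem in degree one, relative to a subalgebra: there is a module
with a vector whose annihilator in `L` is the subalgebra. -/
theorem exists_module : ∃ (M : Submodule ℂ (List I →₀ ℂ)) (ρ : L →ₗ[ℂ] Module.End ℂ M) (m : M),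
    (∀ a b x y, x ∈ B.grading a → y ∈ B.grading b → ∀ v, ρ x (ρ y v) =
      superSign a b • ρ y (ρ x v) + ρ (B.bracket x y) v) ∧
    (∀ x, ρ x m = 0 → x ∈ Submodule.span ℂ (B.basis '' B.pos)) ∧
    ∀ x ∈ Submodule.span ℂ (B.basis '' B.pos), ρ x m = 0 := by
  have hnil : B.IsOrdered [] := ⟨by simp, by simp⟩
  refine ⟨Finsupp.supported ℂ ℂ {w : List I | B.IsOrdered w},
    { toFun := fun x => (B.rep x).restrict fun v hv => rep_mem_ordered x hv
      map_add' := fun x y => by ext v : 2; simp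
      map_smul' := fun c x => by ext v : 2; simp },
    ⟨Finsupp.single [] 1, Finsupp.single_mem_supported _ _ hnil⟩, ?_, ?_, ?_⟩
  · rintro a b x y hx hy ⟨v, hv⟩
    exact Subtype.ext
      (mem_of_mem_supported (N := B.relSubmodule) single_mem_relSubmodule hv a b x y hx hy)
  · intro x hx
    have hx' : B.rep x (Finsupp.single [] 1) = 0 := congrArg Subtype.val hx
    rw [B.basis.mem_span_image]
    intro i hi
    by_contra hpos
    rw [rep_single] at hx'
    -- For `i` outside the subalgebra, the coefficient of the one-letter monomial `[i]` in the image
    -- of the empty monomial is the coordinate of `x` at `i`.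
    have h := DFunLike.congr_fun hx' [i]
    rw [Finsupp.sum_apply, Finsupp.sum, Finset.sum_eq_single i] at h
    · have : B.act i [] = Finsupp.single [i] 1 :=
        act_of_isOrdered (isOrdered_cons.2 ⟨hpos, by simp, hnil⟩)
      rw [this] at h
      simp at h
      exact (Finsupp.mem_support_iff.1 hi) h
    · intro j _ hj
      rw [act]
      split_ifs <;> simp [hj]
    · intro h
      simp at h
      simp [h]
  · intro x hx
    exact Subtype.ext (rep_pos_nil hx)

end OrderedSuperBasis

/-! ### Rearrangement of finite double sums -/

section DoubleSums

variable {M : Type*} [AddCommGroup M]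

theorem sum_range_smul_add [Module ℂ M] {K : ℕ} {F : ℕ → M}
    (hF : ∀ t, K ≤ t → F t = 0) (g : ℕ → ℕ → ℂ) :
    ∑ i ∈ Finset.range K, ∑ k ∈ Finset.range K, g i k • F (i + k) =
      ∑ t ∈ Finset.range K,
        (∑ x ∈ Finset.HasAntidiagonal.antidiagonal t, g x.1 x.2) • F t := by
  have h1 : ∀ t, (∑ x ∈ Finset.HasAntidiagonal.antidiagonal t, g x.1 x.2) • F t =
      ∑ k ∈ Finset.range (t + 1), g k (t - k) • F (k + (t - k)) := by
    intro t
    rw [Finset.Nat.sum_antidiagonal_eq_sum_range_succ (fun i j => g i j), Finset.sum_smul]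
    refine Finset.sum_congr rfl fun k hk => ?_
    rw [Nat.add_sub_cancel' (by simpa [Nat.lt_succ_iff] using hk)]
  simp only [h1]
  rw [Finset.sum_range_diag_flip K fun i k => g i k • F (i + k)]
  refine Finset.sum_congr rfl fun i hi => (Finset.sum_subset ?_ fun k _ hk => ?_).symm
  · exact Finset.range_mono (Nat.sub_le _ _)
  · rw [hF _ (by simp at hk; omega), smul_zero]

theorem sum_range_eq_shift {K s R : ℕ} {h : ℕ → M} (h1 : ∀ i, i < s → h i = 0)
    (h2 : ∀ i, s + K ≤ i → h i = 0) (hR : s + K ≤ R) :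
    ∑ i ∈ Finset.range R, h i = ∑ i ∈ Finset.range K, h (s + i) := by
  have e : ∑ i ∈ Finset.range K, h (s + i) = ∑ i ∈ Finset.Ico s (s + K), h i := by
    rw [Finset.sum_Ico_eq_sum_range, Nat.add_sub_cancel_left]
  rw [e]
  refine (Finset.sum_subset (fun i hi => ?_) fun i _ hi => ?_).symm
  · simp at hi ⊢; omega
  · by_cases h : i < s
    · exact h1 i h
    · exact h2 i (by simp at hi; omega)

end DoubleSums

/-! ### The Lie superalgebra `ℒ(U)` -/

namespace VertexLieSuperalgebra

variable {U : Type*} [AddCommGroup U] [Module ℂ U] (L : VertexLieSuperalgebra U)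

theorem mode_mem {a : ZMod 2} {u : U} (hu : u ∈ L.grading a) (n : ℤ) :
    L.mode n u ∈ L.localGrading a :=
  Submodule.mem_iSup_of_mem n ⟨u, hu, rfl⟩

theorem localGrading_le {a : ZMod 2} {N : Submodule ℂ L.LocalAlgebra}
    (h : ∀ n, ∀ u ∈ L.grading a, L.mode n u ∈ N) : L.localGrading a ≤ N := by
  refine iSup_le fun n => ?_
  rintro _ ⟨u, hu, rfl⟩
  exact h n u hu

theorem mode_D_pow (k : ℕ) (q : ℤ) (u : U) : L.mode q ((L.D ^ k) u) =
    ((-1) ^ k * k.factorial * intChoose q k) • L.mode (q - k) u := by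
  induction k generalizing q with
  | zero => simp [intChoose_zero_right]
  | succ k ih =>
    have e : q - ((k + 1 : ℕ) : ℤ) = q - 1 - k := by push_cast; ring
    have h := intChoose_sub_one q k
    rw [pow_succ', Module.End.mul_apply, mode_D, ih, smul_smul, e, Nat.factorial_succ]
    congr 1
    push_cast
    linear_combination (-1) ^ (k + 1) * (k.factorial : ℂ) * h

theorem localBracket_mode_eq_range {n p : ℤ} {u v : U} {K : ℕ}
    (h : ∀ i, K ≤ i → L.mul i u v = 0) : L.localBracket (L.mode n u) (L.mode p v) =
    ∑ i ∈ Finset.range K, intChoose n i • L.mode (n + p - i) (L.mul i u v) := by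
  rw [localBracket_mode]
  exact finsum_eq_range _ _ fun i hi => by rw [h i hi, map_zero, smul_zero]

/-- Half skew symmetry expresses `u_i v` through the `D^k (v_{i+k} u)`; in `ℒ(U)` the powers of `D`
become binomial factors by `mode_D_pow`. Collecting the terms with `i + k = t` leaves the sum of
`intChoose_alternating`. -/
theorem localBracket_mode_skew {a b : ZMod 2} {u v : U} (hu : u ∈ L.grading a)
    (hv : v ∈ L.grading b) (n p : ℤ) : L.localBracket (L.mode n u) (L.mode p v) =
      -superSign a b • L.localBracket (L.mode p v) (L.mode n u) := by
  obtain ⟨N, hN⟩ := L.truncation u v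
  obtain ⟨N', hN'⟩ := L.truncation v u
  set K := max N N'
  have hF : ∀ t, K ≤ t → L.mode (n + p - t) (L.mul t v u) = 0 := fun t ht => by
    rw [hN' t (by omega), map_zero]
  rw [L.localBracket_mode_eq_range (K := K) fun i hi => hN i (by omega),
    L.localBracket_mode_eq_range (K := K) fun i hi => hN' i (by omega)]
  have hterm : ∀ i : ℕ, intChoose n i • L.mode (n + p - i) (L.mul i u v) =
      -superSign a b • ∑ k ∈ Finset.range K,
        ((-1) ^ i * (intChoose n i * intChoose (n + p - i) k)) •
          L.mode (n + p - ((i + k : ℕ) : ℤ)) (L.mul (i + k) v u) := by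
    intro i
    rw [L.skew a b u v hu hv i, finsum_eq_range _ K fun k hk => by
      rw [hN' _ (by omega), map_zero, smul_zero], map_smul, smul_comm, map_sum, Finset.smul_sum]
    congr 1
    refine Finset.sum_congr rfl fun k _ => ?_
    have e : n + p - ((i + k : ℕ) : ℤ) = n + p - i - k := by push_cast; ring
    have hk : (k.factorial : ℂ) ≠ 0 := by exact_mod_cast k.factorial_ne_zero
    have hs : ((-1 : ℂ) ^ k) * (-1) ^ k = 1 := by rw [← mul_pow]; simp
    rw [map_smul, mode_D_pow, e, smul_smul, smul_smul, pow_add]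
    congr 1
    field_simp
    linear_combination intChoose n i * intChoose (n + p - i) k * hs
  rw [Finset.sum_congr rfl fun i _ => hterm i, ← Finset.smul_sum,
    sum_range_smul_add (F := fun t => L.mode (n + p - t) (L.mul t v u)) hF
      fun i k => (-1) ^ i * (intChoose n i * intChoose (n + p - i) k)]
  congr 1
  refine Finset.sum_congr rfl fun t _ => ?_
  rw [intChoose_alternating, add_comm p n]

theorem localBracket_skew (a b : ZMod 2) (x y : L.LocalAlgebra) (hx : x ∈ L.localGrading a)
    (hy : y ∈ L.localGrading b) :
    L.localBracket x y = -superSign a b • L.localBracket y x := by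
  have h : x ∈ (⨅ y : L.localGrading b, LinearMap.ker
      (L.localBracket.flip y.1 + superSign a b • L.localBracket y.1)) := by
    refine L.localGrading_le (fun n u hu => ?_) hx
    simp only [Submodule.mem_iInf, LinearMap.mem_ker]
    rintro ⟨y, hy⟩
    have hy' : y ∈ LinearMap.ker (L.localBracket (L.mode n u) +
        superSign a b • L.localBracket.flip (L.mode n u)) := by
      refine L.localGrading_le (fun p v hv => ?_) hy
      rw [LinearMap.mem_ker, LinearMap.add_apply, LinearMap.smul_apply, LinearMap.flip_apply,
        L.localBracket_mode_skew hu hv]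
      module
    exact hy'
  simp only [Submodule.mem_iInf, LinearMap.mem_ker] at h
  have := h ⟨y, hy⟩
  rw [neg_smul]
  exact eq_neg_of_add_eq_zero_left this

theorem localBracket_homog (a b : ZMod 2) (x y : L.LocalAlgebra) (hx : x ∈ L.localGrading a)
    (hy : y ∈ L.localGrading b) : L.localBracket x y ∈ L.localGrading (a + b) := by
  have h : L.localGrading a ≤ (L.localGrading (a + b)).comap (L.localBracket.flip y) := by
    refine L.localGrading_le fun n u hu => ?_
    have h' : L.localGrading b ≤ (L.localGrading (a + b)).comap (L.localBracket (L.mode n u)) := by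
      refine L.localGrading_le fun p v hv => ?_
      rw [Submodule.mem_comap, localBracket_mode]
      exact finsum_induction (· ∈ L.localGrading (a + b)) (zero_mem _) (fun _ _ => add_mem)
        fun i => Submodule.smul_mem _ _ (L.mode_mem (L.homog a b u v hu hv i) _)
    exact h' hy
  exact h hx

/-- The half Jacobi identity with `k = 0`; the Jacobi identity of `ℒ(U)` uses nothing else of it. -/
theorem mul_comm_formula {a b : ZMod 2} {u v : U} (hu : u ∈ L.grading a) (hv : v ∈ L.grading b)
    (m n : ℕ) (w : U) : L.mul m u (L.mul n v w) = superSign a b • L.mul n v (L.mul m u w) +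
      ∑ i ∈ Finset.range (m + 1), (m.choose i : ℂ) • L.mul (m + n - i) (L.mul i u v) w := by
  have h := L.jacobi a b u v hu hv 0 m n w
  simp only [zero_add, Finset.sum_range_one, pow_zero, Nat.choose_zero_right, Nat.cast_one,
    mul_one, one_smul, add_zero, Nat.sub_zero] at h
  rw [← h]
  abel

theorem exists_truncation (u v w : U) :
    ∃ K : ℕ, ∀ i j : ℕ, K ≤ i ∨ K ≤ j → L.mul i u (L.mul j v w) = 0 := by
  obtain ⟨N, hN⟩ := L.truncation v w
  choose f hf using fun j => L.truncation u (L.mul j v w)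
  refine ⟨N + ∑ j ∈ Finset.range N, f j, fun i j h => ?_⟩
  by_cases hj : N ≤ j
  · rw [hN j hj, map_zero]
  · refine hf j i ?_
    have := Finset.single_le_sum (f := f) (fun _ _ => Nat.zero_le _)
      (Finset.mem_range.2 (not_le.1 hj))
    omega

theorem exists_truncation' (u v w : U) :
    ∃ K : ℕ, ∀ i j : ℕ, K ≤ i ∨ K ≤ j → L.mul j (L.mul i u v) w = 0 := by
  obtain ⟨N, hN⟩ := L.truncation u v
  choose f hf using fun i => L.truncation (L.mul i u v) w
  refine ⟨N + ∑ j ∈ Finset.range N, f j, fun i j h => ?_⟩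
  by_cases hi : N ≤ i
  · rw [hN i hi, map_zero, LinearMap.zero_apply]
  · refine hf i j ?_
    have := Finset.single_le_sum (f := f) (fun _ _ => Nat.zero_le _)
      (Finset.mem_range.2 (not_le.1 hi))
    omega

theorem localBracket_mode_mode {u v w : U} {K : ℕ}
    (hK : ∀ i j : ℕ, K ≤ i ∨ K ≤ j → L.mul i u (L.mul j v w) = 0)
    (hK' : ∀ j : ℕ, K ≤ j → L.mul j v w = 0) (m n p : ℤ) :
    L.localBracket (L.mode m u) (L.localBracket (L.mode n v) (L.mode p w)) =
      ∑ j ∈ Finset.range K, ∑ i ∈ Finset.range K, (intChoose m i * intChoose n j) •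
        L.mode (m + n + p - i - j) (L.mul i u (L.mul j v w)) := by
  rw [L.localBracket_mode_eq_range hK', map_sum]
  refine Finset.sum_congr rfl fun j _ => ?_
  rw [map_smul, L.localBracket_mode_eq_range fun i hi => hK i j (Or.inl hi), Finset.smul_sum]
  refine Finset.sum_congr rfl fun i _ => ?_
  have e : m + (n + p - j) - i = m + n + p - i - (j : ℤ) := by ring
  rw [e, smul_smul, mul_comm]

/-- The commutator formula in `U` leaves the coefficients `(m choose i) (n choose j) (i choose s)`.
Since `(m choose i) (i choose s) = (m choose s) (m - s choose i - s)`, Vandermonde's identity sums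
those with fixed `i + j - s = t` to `(m choose s) (m + n - s choose t)`, as in the iterated bracket.
-/
theorem localBracket_mode_jacobi {a b : ZMod 2} {u v : U} (hu : u ∈ L.grading a)
    (hv : v ∈ L.grading b) (w : U) (m n p : ℤ) :
    L.localBracket (L.mode m u) (L.localBracket (L.mode n v) (L.mode p w)) =
      L.localBracket (L.localBracket (L.mode m u) (L.mode n v)) (L.mode p w) +
      superSign a b •
        L.localBracket (L.mode n v) (L.localBracket (L.mode m u) (L.mode p w)) := by
  obtain ⟨K1, h1⟩ := L.exists_truncation u v w
  obtain ⟨K2, h2⟩ := L.exists_truncation v u w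
  obtain ⟨K3, h3⟩ := L.exists_truncation' u v w
  obtain ⟨K4, h4⟩ := L.truncation v w
  obtain ⟨K5, h5⟩ := L.truncation u w
  obtain ⟨K6, h6⟩ := L.truncation u v
  set K := K1 + K2 + K3 + K4 + K5 + K6
  -- The sums over `i` and `j` run up to `K + K`, because `i = s + i'` with `s` and `i'` both below
  -- `K`.
  have hK : K ≤ K + K := by omega
  rw [L.localBracket_mode_mode (K := K + K) (fun i j h => h1 i j (by omega))
      (fun j hj => h4 j (by omega)),
    L.localBracket_mode_mode (K := K + K) (fun i j h => h2 i j (by omega))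
      (fun j hj => h5 j (by omega)), Finset.sum_comm, ← sub_eq_iff_eq_add, Finset.smul_sum,
    ← Finset.sum_sub_distrib]
  have hterm : ∀ i j : ℕ, (intChoose m i * intChoose n j) •
        L.mode (m + n + p - i - j) (L.mul i u (L.mul j v w)) - superSign a b •
      (intChoose n j * intChoose m i) •
        L.mode (n + m + p - j - i) (L.mul j v (L.mul i u w)) =
      ∑ s ∈ Finset.range K, (intChoose m i * intChoose n j * (i.choose s : ℂ)) •
        L.mode (m + n + p - i - j) (L.mul (i + j - s) (L.mul s u v) w) := by
    intro i j
    have e : n + m + p - j - (i : ℤ) = m + n + p - i - j := by ring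
    have es : ∑ s ∈ Finset.range (i + 1),
        (i.choose s : ℂ) • L.mul (i + j - s) (L.mul s u v) w =
        ∑ s ∈ Finset.range K, (i.choose s : ℂ) • L.mul (i + j - s) (L.mul s u v) w := by
      rw [← finsum_eq_range (fun s => (i.choose s : ℂ) • L.mul (i + j - s) (L.mul s u v) w),
        finsum_eq_range _ K]
      · intro s hs
        rw [h6 s (by omega), map_zero, LinearMap.zero_apply, smul_zero]
      · intro s hs
        rw [Nat.choose_eq_zero_of_lt (by omega), Nat.cast_zero, zero_smul]
    rw [L.mul_comm_formula hu hv, es, e, map_add, map_smul, map_sum]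
    simp only [map_smul, smul_add, Finset.smul_sum, smul_smul]
    rw [mul_comm (intChoose n j), mul_comm (superSign a b), add_sub_cancel_left]
  simp only [Finset.smul_sum]
  simp only [← Finset.sum_sub_distrib]
  rw [Finset.sum_congr rfl fun i _ => Finset.sum_congr rfl fun j _ => hterm i j]
  rw [L.localBracket_mode_eq_range (K := K) fun i hi => h6 i (by omega), map_sum,
    LinearMap.sum_apply]
  have hrhs : ∀ s ∈ Finset.range K,
      L.localBracket (intChoose m s • L.mode (m + n - s) (L.mul s u v)) (L.mode p w) =
        ∑ i ∈ Finset.range (K + K), ∑ j ∈ Finset.range (K + K),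
          (intChoose m i * intChoose n j * (i.choose s : ℂ)) •
            L.mode (m + n + p - i - j) (L.mul (i + j - s) (L.mul s u v) w) := by
    intro s hs
    have hs' : s < K := Finset.mem_range.1 hs
    have hF : ∀ t, K ≤ t → L.mode (m + n - s + p - t) (L.mul t (L.mul s u v) w) = 0 :=
      fun t ht => by rw [h3 s t (by omega), map_zero]
    rw [map_smul, LinearMap.smul_apply, L.localBracket_mode_eq_range (K := K)
      fun t ht => h3 s t (by omega)]
    rw [sum_range_eq_shift (K := K) (s := s) (R := K + K) ?_ ?_ (by omega)]
    · have hj : ∀ i : ℕ, ∑ j ∈ Finset.range (K + K),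
          (intChoose m (s + i : ℕ) * intChoose n j * ((s + i).choose s : ℂ)) •
            L.mode (m + n + p - (s + i : ℕ) - j) (L.mul (s + i + j - s) (L.mul s u v) w) =
          ∑ j ∈ Finset.range K, (intChoose m s * (intChoose (m - s) i * intChoose n j)) •
            L.mode (m + n - s + p - (i + j : ℕ)) (L.mul (i + j) (L.mul s u v) w) := by
        intro i
        have et : ∀ j : ℕ, (intChoose m (s + i : ℕ) * intChoose n j * ((s + i).choose s : ℂ)) •
            L.mode (m + n + p - (s + i : ℕ) - j) (L.mul (s + i + j - s) (L.mul s u v) w) =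
            (intChoose m s * (intChoose (m - s) i * intChoose n j)) •
            L.mode (m + n - s + p - (i + j : ℕ)) (L.mul (i + j) (L.mul s u v) w) := by
          intro j
          have hc := intChoose_mul_sub m s i
          rw [VertexSuperalgebra.intChoose_natCast] at hc
          have e1 : m + n + p - ((s + i : ℕ) : ℤ) - j = m + n - s + p - ((i + j : ℕ) : ℤ) := by
            push_cast; ring
          have e2 : s + i + j - s = i + j := by omega
          rw [e1, e2]
          congr 1
          linear_combination intChoose n j * hc
        rw [Finset.sum_congr rfl fun j _ => et j]
        refine (Finset.sum_subset (Finset.range_mono hK) fun j _ hj => ?_).symm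
        rw [hF _ (by simp at hj; omega), smul_zero]
      rw [Finset.sum_congr rfl fun i _ => hj i,
        sum_range_smul_add (F := fun t => L.mode (m + n - s + p - t) (L.mul t (L.mul s u v) w)) hF
          fun i j => intChoose m s * (intChoose (m - s) i * intChoose n j), Finset.smul_sum]
      refine Finset.sum_congr rfl fun t _ => ?_
      rw [← Finset.mul_sum, intChoose_vandermonde, smul_smul]
      congr 3
      ring
    · intro i hi
      refine Finset.sum_eq_zero fun j _ => ?_
      rw [Nat.choose_eq_zero_of_lt hi, Nat.cast_zero, mul_zero, zero_smul]
    · intro i hi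
      refine Finset.sum_eq_zero fun j _ => ?_
      rw [h3 s _ (by omega), map_zero, smul_zero]
  rw [Finset.sum_congr rfl hrhs]
  refine Eq.symm ?_
  rw [Finset.sum_comm]
  refine Finset.sum_congr rfl fun i _ => ?_
  rw [Finset.sum_comm]

theorem localBracket_jacobi (a b : ZMod 2) (x y : L.LocalAlgebra) (hx : x ∈ L.localGrading a)
    (hy : y ∈ L.localGrading b) (c : ZMod 2) (z : L.LocalAlgebra) (hz : z ∈ L.localGrading c) :
    L.localBracket x (L.localBracket y z) = L.localBracket (L.localBracket x y) z +
      superSign a b • L.localBracket y (L.localBracket x z) := by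
  let T : L.LocalAlgebra → L.LocalAlgebra → L.LocalAlgebra → Prop := fun x y z =>
    L.localBracket x (L.localBracket y z) = L.localBracket (L.localBracket x y) z +
      superSign a b • L.localBracket y (L.localBracket x z)
  have hT : ∀ (x y z : L.LocalAlgebra), T x y z ↔ L.localBracket x (L.localBracket y z) =
      L.localBracket (L.localBracket x y) z +
      superSign a b • L.localBracket y (L.localBracket x z) := fun _ _ _ => Iff.rfl
  have h1 : ∀ x y, (∀ n, ∀ w ∈ L.grading c, T x y (L.mode n w)) → ∀ z ∈ L.localGrading c,
      T x y z := by
    intro x y h z hz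
    refine L.localGrading_le (N :=
      { carrier := {z | T x y z}
        add_mem' := fun {z z'} h h' => ?_
        zero_mem' := ?_
        smul_mem' := fun r z h => ?_ }) h hz
    · simp only [Set.mem_ofPred_eq, hT] at h h' ⊢
      simp only [map_add, h, h']
      module
    · simp [hT]
    · simp only [Set.mem_ofPred_eq, hT] at h ⊢
      simp only [map_smul, h]
      module
  have h2 : ∀ x, (∀ n, ∀ v ∈ L.grading b, ∀ z ∈ L.localGrading c, T x (L.mode n v) z) →
      ∀ y ∈ L.localGrading b, ∀ z ∈ L.localGrading c, T x y z := by
    intro x h y hy z hz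
    refine L.localGrading_le (N :=
      { carrier := {y | T x y z}
        add_mem' := fun {z z'} h h' => ?_
        zero_mem' := ?_
        smul_mem' := fun r z h => ?_ }) (fun n v hv => h n v hv z hz) hy
    · simp only [Set.mem_ofPred_eq, hT] at h h' ⊢
      simp only [map_add, LinearMap.add_apply, h, h']
      module
    · simp [hT]
    · simp only [Set.mem_ofPred_eq, hT] at h ⊢
      simp only [map_smul, LinearMap.smul_apply, h]
      module
  have h3 : ∀ x ∈ L.localGrading a, ∀ y ∈ L.localGrading b, ∀ z ∈ L.localGrading c,
      T x y z := by
    intro x hx y hy z hz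
    refine L.localGrading_le (N :=
      { carrier := {x | T x y z}
        add_mem' := fun {z z'} h h' => ?_
        zero_mem' := ?_
        smul_mem' := fun r z h => ?_ }) (fun n u hu => h2 _ (fun p v hv => h1 _ _
          fun q w _ => L.localBracket_mode_jacobi hu hv w n p q) y hy z hz) hx
    · simp only [Set.mem_ofPred_eq, hT] at h h' ⊢
      simp only [map_add, LinearMap.add_apply, h, h']
      module
    · simp [hT]
    · simp only [Set.mem_ofPred_eq, hT] at h ⊢
      simp only [map_smul, LinearMap.smul_apply, h]
      module
  exact h3 x hx y hy z hz

end VertexLieSuperalgebra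

/-! ### The module `𝒱(U)`: fields, grading and derivation -/

/-- By Pascal's rule, multiplication by `z₁ - z₂` turns `(n choose s + 1) g(n + p)` into `(n choose
s) g(n + p + 1)`; after `s + 1` steps the term of degree `s` is gone. -/
theorem isLocal_of_superComm_eq {V : Type*} [AddCommGroup V] [Module ℂ V] {ε : ℂ}
    {a b : ℤ → Module.End ℂ V} (N : ℕ) (g : ℕ → ℤ → Module.End ℂ V)
    (h : ∀ n p w, a n (b p w) = ε • b p (a n w) +
      ∑ i ∈ Finset.range N, intChoose n i • g i (n + p) w) : IsLocal ε a b := by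
  refine ⟨N, ?_⟩
  have key : ∀ (s : ℕ) (g : ℤ → Module.End ℂ V),
      (shiftDiff (Module.End ℂ V) ^ (s + 1)) (fun n p => intChoose n s • g (n + p)) = 0 := by
    intro s
    induction s with
    | zero =>
      intro g
      rw [pow_one]
      ext n p : 2
      have e : n + 1 + p = n + (p + 1) := by ring
      simp [shiftDiff_apply, intChoose_zero_right, e]
    | succ s ih =>
      intro g
      have e : shiftDiff (Module.End ℂ V) (fun n p => intChoose n (s + 1) • g (n + p)) =
          fun n p => intChoose n s • (fun q => g (q + 1)) (n + p) := by
        ext n p : 2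
        have e1 : n + 1 + p = n + p + 1 := by ring
        have e2 : n + (p + 1) = n + p + 1 := by ring
        simp only [shiftDiff_apply, e1, e2, intChoose_succ_succ]
        module
      rw [pow_succ, Module.End.mul_apply, e]
      exact ih fun q => g (q + 1)
  have hc : superComm ε a b =
      ∑ i ∈ Finset.range N, fun (n p : ℤ) => intChoose n i • g i (n + p) := by
    ext n p w
    simp only [superComm, Finset.sum_apply, LinearMap.sum_apply, LinearMap.sub_apply,
      LinearMap.smul_apply, Module.End.mul_apply]
    exact sub_eq_iff_eq_add'.2 (h n p w)
  rw [hc, map_sum]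
  refine Finset.sum_eq_zero fun i hi => ?_
  exact pow_apply_eq_zero_of_le (Finset.mem_range.1 hi) (key i _)

namespace SuperEnveloping

variable {L : Type*} [AddCommGroup L] [Module ℂ L] {gr : ZMod 2 → Submodule ℂ L}
  {br : L →ₗ[ℂ] L →ₗ[ℂ] L}

theorem induction {p : SuperEnveloping gr br → Prop} (h0 : ∀ c, p (algebraMap ℂ _ c))
    (hι : ∀ x, p (ι gr br x)) (hmul : ∀ x y, p x → p y → p (x * y))
    (hadd : ∀ x y, p x → p y → p (x + y)) (y : SuperEnveloping gr br) : p y := by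
  obtain ⟨t, rfl⟩ := RingQuot.mkAlgHom_surjective ℂ (SuperEnvelopingRel gr br) y
  induction t using TensorAlgebra.induction with
  | algebraMap c => rw [AlgHom.commutes]; exact h0 c
  | ι x => exact hι x
  | mul x y hx hy => rw [map_mul]; exact hmul _ _ hx hy
  | add x y hx hy => rw [map_add]; exact hadd _ _ hx hy

end SuperEnveloping

namespace VertexLieSuperalgebra

variable {U : Type*} [AddCommGroup U] [Module ℂ U] (L : VertexLieSuperalgebra U)

theorem iSup_grading : ⨆ a, L.grading a = ⊤ := L.isInternal.submodule_iSup_eq_top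

/-- The action of `ℒ(U)` on `𝒱(U)`. -/
def envOp : L.LocalAlgebra →ₗ[ℂ] Module.End ℂ L.Enveloping :=
  (Algebra.lsmul ℂ ℂ L.Enveloping).toLinearMap ∘ₗ SuperEnveloping.ι L.localGrading L.localBracket

theorem envOp_apply (x : L.LocalAlgebra) (w : L.Enveloping) :
    L.envOp x w = SuperEnveloping.ι L.localGrading L.localBracket x • w := rfl

theorem envOp_mode (n : ℤ) (u : U) (w : L.Enveloping) :
    L.envOp (L.mode n u) w = L.envMode n u w := rfl

theorem envOp_comm {a b : ZMod 2} {x y : L.LocalAlgebra} (hx : x ∈ L.localGrading a)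
    (hy : y ∈ L.localGrading b) (w : L.Enveloping) : L.envOp x (L.envOp y w) =
      superSign a b • L.envOp y (L.envOp x w) + L.envOp (L.localBracket x y) w := by
  simp only [envOp_apply, ← mul_smul]
  rw [SuperEnveloping.ι_mul_ι _ _ a b x y hx hy, add_smul, smul_assoc]

theorem tmul_eq_smul (y : L.LocalEnveloping) (c : ℂ) :
    L.balancedRel.mkQ (y ⊗ₜ[ℂ] c) = (c • y) • L.envVac := by
  rw [envVac, ← map_smul, TensorProduct.smul_tmul', smul_eq_mul, mul_one,
    TensorProduct.smul_tmul, smul_eq_mul, mul_one]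

theorem posInclusion_ι (x : L.localPos) :
    L.posInclusion (SuperEnveloping.ι L.posGrading L.posBracket x) =
      SuperEnveloping.ι L.localGrading L.localBracket x :=
  SuperEnveloping.lift_ι _ _ _ _ _

theorem envOp_pos_vac {x : L.LocalAlgebra} (hx : x ∈ L.localPos) : L.envOp x L.envVac = 0 := by
  have h : ((1 : L.LocalEnveloping) *
      L.posInclusion (SuperEnveloping.ι L.posGrading L.posBracket ⟨x, hx⟩)) ⊗ₜ[ℂ] (1 : ℂ) -
        (1 : L.LocalEnveloping) ⊗ₜ[ℂ] (SuperEnveloping.augmentation L.posGrading L.posBracket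
          (SuperEnveloping.ι L.posGrading L.posBracket ⟨x, hx⟩) * (1 : ℂ)) ∈ L.balancedRel :=
    Submodule.subset_span ⟨_, _, _, rfl⟩
  rw [← Submodule.Quotient.mk_eq_zero, ← Submodule.mkQ_apply, map_sub, tmul_eq_smul, tmul_eq_smul,
    posInclusion_ι, SuperEnveloping.augmentation, SuperEnveloping.lift_ι] at h
  simpa [envOp_apply] using h

theorem envMode_nonneg_vac {n : ℤ} (hn : 0 ≤ n) (u : U) : L.envMode n u L.envVac = 0 :=
  L.envOp_pos_vac (Submodule.subset_span ⟨u, n, hn, rfl⟩)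

theorem env_generate {W : Submodule ℂ L.Enveloping} (h0 : L.envVac ∈ W)
    (h : ∀ a, ∀ u ∈ L.grading a, ∀ n, ∀ w ∈ W, L.envMode n u w ∈ W) : W = ⊤ := by
  have h1 : ∀ x, ∀ w ∈ W, L.envOp x w ∈ W := by
    intro x w hw
    obtain ⟨x, rfl⟩ := L.localRel.mkQ_surjective x
    induction x using Finsupp.induction_linear with
    | zero => simp
    | add x y hx hy => rw [map_add, map_add, LinearMap.add_apply]; exact add_mem hx hy
    | single n u =>
      refine homogeneous_induction L.iSup_grading (p := fun u => L.envOp (L.mode n u) w ∈ W)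
        (fun a u hu => h a u hu n w hw) (fun u v hu hv => ?_) u
      rw [map_add, map_add, LinearMap.add_apply]
      exact add_mem hu hv
  have h2 : ∀ y : L.LocalEnveloping, ∀ w ∈ W, y • w ∈ W := by
    intro y
    induction y using SuperEnveloping.induction with
    | h0 c => intro w hw; rw [algebraMap_smul]; exact W.smul_mem c hw
    | hι x => exact h1 x
    | hmul x y hx hy => intro w hw; rw [mul_smul]; exact hx _ (hy w hw)
    | hadd x y hx hy => intro w hw; rw [add_smul]; exact add_mem (hx w hw) (hy w hw)
  refine eq_top_iff.2 fun w _ => ?_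
  obtain ⟨t, rfl⟩ := L.balancedRel.mkQ_surjective w
  induction t using TensorProduct.induction_on with
  | zero => simp
  | tmul y c => rw [tmul_eq_smul]; exact h2 _ _ h0
  | add x y hx hy => rw [map_add]; exact add_mem (hx trivial) (hy trivial)

section Lift

variable {M : Type*} [AddCommGroup M] [Module ℂ M]

/-- The universal property of `𝒱(U)` as an `ℒ(U)`-module. -/
theorem exists_env_lift (ρ : L.LocalAlgebra →ₗ[ℂ] Module.End ℂ M)
    (hρ : ∀ a b x y, x ∈ L.localGrading a → y ∈ L.localGrading b → ∀ v, ρ x (ρ y v) =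
      superSign a b • ρ y (ρ x v) + ρ (L.localBracket x y) v) (m : M)
    (hm : ∀ x ∈ L.localPos, ρ x m = 0) :
    ∃ ψ : L.Enveloping →ₗ[ℂ] M, ψ L.envVac = m ∧ ∀ x w, ψ (L.envOp x w) = ρ x (ψ w) := by
  let A := SuperEnveloping.lift L.localGrading L.localBracket ρ fun a b x y hx hy => by
    ext v
    exact hρ a b x y hx hy v
  have hA : ∀ x, A (SuperEnveloping.ι _ _ x) = ρ x := fun x => SuperEnveloping.lift_ι _ _ _ _ _
  -- As `m` is killed by `ℒ₊(U)`, the algebra `𝒰(ℒ₊(U))` acts on it by the augmentation. This is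
  -- what the balancing relations require.
  have hpos : ∀ y, A (L.posInclusion y) m =
      SuperEnveloping.augmentation L.posGrading L.posBracket y • m := by
    intro y
    induction y using SuperEnveloping.induction with
    | h0 c => simp [Algebra.algebraMap_eq_smul_one]
    | hι x =>
      rw [posInclusion_ι, hA, hm _ x.2, SuperEnveloping.augmentation, SuperEnveloping.lift_ι]
      simp
    | hmul x y hx hy =>
      rw [map_mul, map_mul, map_mul, Module.End.mul_apply, hy, map_smul, hx, smul_smul, mul_comm]
    | hadd x y hx hy =>
      rw [map_add, map_add, map_add, LinearMap.add_apply, hx, hy, add_smul]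
  let ψ₀ : L.LocalEnveloping ⊗[ℂ] ℂ →ₗ[ℂ] M := TensorProduct.lift
    (LinearMap.mk₂ ℂ (fun y c => c • A y m)
      (fun y z c => by rw [map_add, LinearMap.add_apply, smul_add])
      (fun r y c => by rw [map_smul, LinearMap.smul_apply, smul_comm])
      (fun y c d => add_smul c d _) (fun r y c => mul_smul r c _))
  have hψ₀ : ∀ y c, ψ₀ (y ⊗ₜ c) = c • A y m := fun y c => TensorProduct.lift.tmul _ _
  have hsmul : ∀ (y : L.LocalEnveloping) t, ψ₀ (y • t) = A y (ψ₀ t) := by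
    intro y t
    induction t using TensorProduct.induction_on with
    | zero => simp
    | tmul z c =>
      rw [TensorProduct.smul_tmul', hψ₀, hψ₀, smul_eq_mul, map_mul, Module.End.mul_apply, map_smul]
    | add s t hs ht => rw [smul_add, map_add, map_add, map_add, hs, ht]
  have hker : L.balancedRel.restrictScalars ℂ ≤ LinearMap.ker ψ₀ := by
    intro t ht
    rw [Submodule.restrictScalars_mem] at ht
    rw [LinearMap.mem_ker]
    induction ht using Submodule.span_induction with
    | mem t ht =>
      obtain ⟨x, a, c, rfl⟩ := ht
      rw [map_sub, hψ₀, hψ₀, map_mul, Module.End.mul_apply, hpos, map_smul, smul_smul, mul_comm,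
        sub_self]
    | zero => exact map_zero _
    | add s t _ _ hs ht => rw [map_add, hs, ht, add_zero]
    | smul y t _ ht => rw [hsmul, ht, map_zero]
  -- The relations form a submodule over `𝒰(ℒ(U))`, whereas `ψ₀` is only `ℂ`-linear; so the quotient
  -- map is built on additive groups.
  let ψ : L.Enveloping →ₗ[ℂ] M :=
    { toFun := QuotientAddGroup.lift L.balancedRel.toAddSubgroup ψ₀.toAddMonoidHom
        fun t ht => hker ht
      map_add' := map_add _
      map_smul' := by
        intro c w
        obtain ⟨t, rfl⟩ := L.balancedRel.mkQ_surjective w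
        exact map_smul ψ₀ c t }
  have hψ : ∀ t, ψ (L.balancedRel.mkQ t) = ψ₀ t := fun t => rfl
  refine ⟨ψ, ?_, fun x w => ?_⟩
  · rw [envVac, hψ, hψ₀, map_one, one_smul]
    rfl
  · obtain ⟨t, rfl⟩ := L.balancedRel.mkQ_surjective w
    rw [envOp_apply, ← map_smul, hψ, hψ, hsmul, hA]

theorem exists_local_lift (f : ℤ → U →ₗ[ℂ] M)
    (hD : ∀ n u, f n (L.D u) = -(n : ℂ) • f (n - 1) u) :
    ∃ ρ : L.LocalAlgebra →ₗ[ℂ] M, ∀ n u, ρ (L.mode n u) = f n u := by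
  refine ⟨L.localRel.liftQ (Finsupp.lsum ℂ f) (Submodule.span_le.2 ?_), fun n u => ?_⟩
  · rintro _ ⟨u, n, rfl⟩
    rw [SetLike.mem_coe, LinearMap.mem_ker, map_add, map_smul, Finsupp.lsum_single,
      Finsupp.lsum_single, hD, neg_smul, neg_add_cancel]
  · exact (Submodule.liftQ_apply _ _ _).trans (Finsupp.lsum_single _ _ _ _)

/-- An `ℒ(U)`-module structure on `M` and a vector killed by `ℒ₊(U)` define a homomorphism
`𝒱(U) → M`. -/
theorem exists_mode_lift (f : ℤ → U →ₗ[ℂ] Module.End ℂ M)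
    (hD : ∀ n u, f n (L.D u) = -(n : ℂ) • f (n - 1) u)
    (hf : ∀ a b u v, u ∈ L.grading a → v ∈ L.grading b → ∀ n p w, f n u (f p v w) =
      superSign a b • f p v (f n u w) +
        ∑ᶠ i : ℕ, intChoose n i • f (n + p - i) (L.mul i u v) w)
    (m : M) (hm : ∀ n u, 0 ≤ n → f n u m = 0) :
    ∃ (ρ : L.LocalAlgebra →ₗ[ℂ] Module.End ℂ M) (ψ : L.Enveloping →ₗ[ℂ] M),
      (∀ n u, ρ (L.mode n u) = f n u) ∧ ψ L.envVac = m ∧ ∀ x w, ψ (L.envOp x w) = ρ x (ψ w) := by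
  obtain ⟨ρ, hρ⟩ := L.exists_local_lift f hD
  suffices h : (∀ a b x y, x ∈ L.localGrading a → y ∈ L.localGrading b → ∀ v, ρ x (ρ y v) =
      superSign a b • ρ y (ρ x v) + ρ (L.localBracket x y) v) ∧ ∀ x ∈ L.localPos, ρ x m = 0 by
    obtain ⟨ψ, h1, h2⟩ := L.exists_env_lift ρ h.1 m h.2
    exact ⟨ρ, ψ, hρ, h1, h2⟩
  refine ⟨fun a b x y hx hy v => ?_, fun x hx => ?_⟩
  · let T : L.LocalAlgebra →ₗ[ℂ] L.LocalAlgebra →ₗ[ℂ] M := LinearMap.mk₂ ℂ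
      (fun x y => ρ x (ρ y v) - superSign a b • ρ y (ρ x v) - ρ (L.localBracket x y) v)
      (fun x x' y => by simp only [map_add, LinearMap.add_apply]; module)
      (fun c x y => by simp only [map_smul, LinearMap.smul_apply]; module)
      (fun x y y' => by simp only [map_add, LinearMap.add_apply]; module)
      (fun c x y => by simp only [map_smul, LinearMap.smul_apply]; module)
    have hT : T x y = 0 := by
      have hx' : L.localGrading a ≤ LinearMap.ker (T.flip y) := by
        refine L.localGrading_le fun n u hu => ?_
        have hy' : L.localGrading b ≤ LinearMap.ker (T (L.mode n u)) := by
          refine L.localGrading_le fun p v' hv => ?_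
          rw [LinearMap.mem_ker, LinearMap.mk₂_apply, hρ, hρ, hf a b u v' hu hv, localBracket_mode]
          obtain ⟨N, hN⟩ := L.truncation u v'
          rw [finsum_eq_range _ N fun i hi => by
              rw [hN i hi, map_zero, LinearMap.zero_apply, smul_zero],
            finsum_eq_range _ N fun i hi => by rw [hN i hi, map_zero, smul_zero], map_sum,
            LinearMap.sum_apply]
          simp only [map_smul, LinearMap.smul_apply, hρ]
          abel
        exact hy' hy
      exact hx' hx
    rw [LinearMap.mk₂_apply, sub_sub, sub_eq_zero] at hT
    exact hT
  · have : L.localPos ≤ LinearMap.ker (ρ.flip m) := by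
      refine Submodule.span_le.2 ?_
      rintro _ ⟨u, n, hn, rfl⟩
      rw [SetLike.mem_coe, LinearMap.mem_ker, LinearMap.flip_apply, hρ, hm n u hn]
    exact this hx

end Lift

theorem envMode_add (n : ℤ) (u v : U) (w : L.Enveloping) :
    L.envMode n (u + v) w = L.envMode n u w + L.envMode n v w := by
  simp only [← envOp_mode, map_add, LinearMap.add_apply]

theorem envMode_comm {a b : ZMod 2} {u v : U} (hu : u ∈ L.grading a) (hv : v ∈ L.grading b)
    (n p : ℤ) (w : L.Enveloping) : L.envMode n u (L.envMode p v w) =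
      superSign a b • L.envMode p v (L.envMode n u w) +
        binSum n fun i : ℕ => L.envMode (n + p - i) (L.mul i u v) w := by
  have h := L.envOp_comm (L.mode_mem hu n) (L.mode_mem hv p) w
  obtain ⟨N, hN⟩ := L.truncation u v
  rw [L.localBracket_mode_eq_range hN, map_sum, LinearMap.sum_apply] at h
  rw [binSum_eq_range (N := N) fun i hi => by
    rw [hN i hi, ← envOp_mode, map_zero, map_zero, LinearMap.zero_apply]]
  simpa only [map_smul, LinearMap.smul_apply, envOp_mode] using h

theorem envMode_truncation (u : U) (w : L.Enveloping) :
    ∃ N : ℤ, ∀ n, N ≤ n → L.envMode n u w = 0 := by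
  let W : Submodule ℂ L.Enveloping :=
    { carrier := {w | ∀ u, ∃ N : ℤ, ∀ n, N ≤ n → L.envOp (L.mode n u) w = 0}
      add_mem' := fun {w w'} h h' u => by
        obtain ⟨N, hN⟩ := h u
        obtain ⟨N', hN'⟩ := h' u
        exact ⟨max N N', fun n hn => by rw [map_add, hN n (by omega), hN' n (by omega), add_zero]⟩
      zero_mem' := fun u => ⟨0, fun n _ => map_zero _⟩
      smul_mem' := fun c w h u => by
        obtain ⟨N, hN⟩ := h u
        exact ⟨N, fun n hn => by rw [map_smul, hN n hn, smul_zero]⟩ }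
  have hW : W = ⊤ := by
    refine L.env_generate (fun u => ⟨0, fun n hn => L.envMode_nonneg_vac hn u⟩)
      fun b v hv p w hw u => ?_
    refine homogeneous_induction L.iSup_grading (p := fun u => ∃ N : ℤ, ∀ n, N ≤ n →
      L.envOp (L.mode n u) (L.envMode p v w) = 0) (fun a u hu => ?_) (fun u u' h h' => ?_) u
    · obtain ⟨K, hK⟩ := L.truncation u v
      obtain ⟨N, hN⟩ := hw u
      choose f hf using fun i => hw (L.mul i u v)
      -- In the commutator formula for `u_n v_p w` both `n ≥ N` and `n + p - i ≥ f i` for all `i <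
      -- K` are needed; the absolute values make one bound serve for all of these.
      refine ⟨N + |N| + K - p + |p| + |p| + ∑ i ∈ Finset.range K, |f i|, fun n hn => ?_⟩
      have hsum : 0 ≤ ∑ i ∈ Finset.range K, |f i| := Finset.sum_nonneg fun i _ => abs_nonneg _
      have h1 := neg_abs_le N
      have h2 := le_abs_self p
      rw [envOp_mode, L.envMode_comm hu hv, ← envOp_mode L n, hN n (by
          have := abs_nonneg N; have := abs_nonneg p; omega), ← envOp_mode, map_zero,
        smul_zero, zero_add, binSum]
      refine (finsum_eq_range _ K fun i hi => ?_).trans (Finset.sum_eq_zero fun i hi => ?_)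
      · rw [hK i hi, ← envOp_mode, map_zero, map_zero, LinearMap.zero_apply, smul_zero]
      · have h3 := Finset.single_le_sum (f := fun i => |f i|) (fun i _ => abs_nonneg _) hi
        have h4 := le_abs_self (f i)
        have h5 := neg_abs_le p
        have h6 : i < K := Finset.mem_range.1 hi
        rw [← envOp_mode, hf i _ (by
          have : f i ≤ ∑ i ∈ Finset.range K, |f i| := h4.trans h3
          omega), smul_zero]
    · obtain ⟨N, hN⟩ := h
      obtain ⟨N', hN'⟩ := h'
      exact ⟨max N N', fun n hn => by
        rw [map_add, map_add, LinearMap.add_apply, hN n (by omega), hN' n (by omega), add_zero]⟩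
  have hw : w ∈ W := by rw [hW]; trivial
  exact hw u

/-- The field `∑ uₙ z^{-n-1}` on `𝒱(U)`. -/
def envField (u : U) : vertexFields L.Enveloping :=
  ⟨fun n => L.envOp (L.mode n u), fun w => L.envMode_truncation u w⟩

theorem isLocal_envField {a b : ZMod 2} {u v : U} (hu : u ∈ L.grading a) (hv : v ∈ L.grading b) :
    IsLocal (superSign a b) (L.envField u).1 (L.envField v).1 := by
  obtain ⟨N, hN⟩ := L.truncation u v
  refine isLocal_of_superComm_eq N (fun i q => L.envOp (L.mode (q - i) (L.mul i u v)))
    fun n p w => ?_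
  have h := L.envMode_comm hu hv n p w
  rw [binSum_eq_range (N := N) fun i hi => by
    rw [hN i hi, ← envOp_mode, map_zero, map_zero, LinearMap.zero_apply]] at h
  exact h

theorem envVac_even : L.envVac ∈ L.envGrading 0 :=
  ⟨1, Submodule.subset_span ⟨[], by simp, by simp, by simp⟩, by
    rw [LinearMap.restrictScalars_apply, LinearMap.toSpanSingleton_apply, one_smul]⟩

theorem envOp_mem {a b : ZMod 2} {x : L.LocalAlgebra} {w : L.Enveloping}
    (hx : x ∈ L.localGrading a) (hw : w ∈ L.envGrading b) : L.envOp x w ∈ L.envGrading (a + b) := by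
  obtain ⟨y, hy, rfl⟩ := hw
  refine ⟨SuperEnveloping.ι _ _ x * y, ?_, by
    simp only [LinearMap.restrictScalars_apply, LinearMap.toSpanSingleton_apply, mul_smul,
      envOp_apply]⟩
  rw [SetLike.mem_coe]
  induction hy using Submodule.span_induction with
  | mem y hy =>
    obtain ⟨l, h1, h2, rfl⟩ := hy
    exact Submodule.subset_span
      ⟨(a, x) :: l, List.forall_mem_cons.2 ⟨hx, h1⟩, by simp [h2], by simp⟩
  | zero => rw [mul_zero]; exact zero_mem _
  | add y z _ _ hy hz => rw [mul_add]; exact add_mem hy hz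
  | smul c y _ hy => rw [mul_smul_comm]; exact Submodule.smul_mem _ c hy

theorem envGrading_induction {p : ZMod 2 → L.Enveloping → Prop} (h0 : p 0 L.envVac)
    (hop : ∀ a b x w, x ∈ L.localGrading a → p b w → p (a + b) (L.envOp x w))
    (hzero : ∀ a, p a 0) (hadd : ∀ a v w, p a v → p a w → p a (v + w))
    (hsmul : ∀ a (c : ℂ) v, p a v → p a (c • v)) {a : ZMod 2} {w : L.Enveloping}
    (hw : w ∈ L.envGrading a) : p a w := by
  obtain ⟨y, hy, rfl⟩ := hw
  change p a (y • L.envVac)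
  induction hy using Submodule.span_induction with
  | mem y hy =>
    obtain ⟨l, h1, rfl, rfl⟩ := hy
    induction l with
    | nil => simpa using h0
    | cons q l ih =>
      simp only [List.map_cons, List.sum_cons, List.prod_cons, mul_smul]
      exact hop _ _ _ _ (h1 q (by simp)) (ih fun r hr => h1 r (by simp [hr]))
  | zero => rw [zero_smul]; exact hzero a
  | add y z _ _ hy hz => rw [add_smul]; exact hadd _ _ _ hy hz
  | smul c y _ hy => rw [smul_assoc]; exact hsmul _ _ _ hy

theorem iSup_envGrading : ⨆ a, L.envGrading a = ⊤ := by
  refine L.env_generate (Submodule.mem_iSup_of_mem 0 L.envVac_even) fun a u hu n w hw => ?_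
  rw [← envOp_mode]
  induction hw using Submodule.iSup_induction' with
  | mem b w hw => exact Submodule.mem_iSup_of_mem _ (L.envOp_mem (L.mode_mem hu n) hw)
  | zero => rw [map_zero]; exact zero_mem _
  | add v w _ _ hv hw => rw [map_add]; exact add_mem hv hw

theorem neg_one_pow_val_add (a b : ZMod 2) :
    (-1 : ℂ) ^ (a + b).val = (-1) ^ a.val * (-1) ^ b.val := by
  rw [← pow_add]
  refine neg_one_pow_congr ?_
  revert a b
  decide

theorem exists_parity : ∃ σ : U →ₗ[ℂ] U, ∀ a, ∀ u ∈ L.grading a, σ u = (-1 : ℂ) ^ a.val • u := by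
  obtain ⟨σ, hσ⟩ := exists_linearMap_of_isInternal L.isInternal
    fun a => ((-1 : ℂ) ^ a.val) • (L.grading a).subtype
  exact ⟨σ, fun a u hu => by rw [hσ a u hu]; rfl⟩

theorem parity_D {σ : U →ₗ[ℂ] U} (hσ : ∀ a, ∀ u ∈ L.grading a, σ u = (-1 : ℂ) ^ a.val • u) (u : U) :
    σ (L.D u) = L.D (σ u) := by
  refine homogeneous_induction L.iSup_grading (p := fun u => σ (L.D u) = L.D (σ u))
    (fun a u hu => ?_) (fun u v hu hv => ?_) u
  · rw [hσ a u hu, hσ a _ (L.D_even a u hu), map_smul]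
  · simp only [map_add, hu, hv]

/-- Twisting the action by the parity operator of `U` gives another `ℒ(U)`-module structure whose
vacuum is killed by `ℒ₊(U)`. The universal property yields an operator acting by `±1` on the graded
pieces, so `isInternal_of_involution` applies. -/
theorem envGrading_isInternal : DirectSum.IsInternal L.envGrading := by
  obtain ⟨σ, hσ⟩ := L.exists_parity
  obtain ⟨ρ, ψ, h1, h2, h3⟩ := L.exists_mode_lift
    (fun n => L.envOp ∘ₗ L.mode n ∘ₗ σ)
    (fun n u => by
      simp only [LinearMap.comp_apply, L.parity_D hσ, mode_D, map_smul])
    (fun a b u v hu hv n p w => by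
      have h := L.envMode_comm hu hv n p w
      simp only [LinearMap.comp_apply, hσ a u hu, hσ b v hv, hσ _ _ (L.homog a b u v hu hv _),
        map_smul, LinearMap.smul_apply, envOp_mode, h, neg_one_pow_val_add]
      rw [smul_add, smul_add, binSum, smul_finsum, smul_finsum]
      congr 1
      · module
      · exact finsum_congr fun i => by module)
    L.envVac (fun n u hn => L.envMode_nonneg_vac hn _)
  refine isInternal_of_involution ψ (fun a w hw => ?_) L.iSup_envGrading
  refine L.envGrading_induction (p := fun a w => ψ w = (-1 : ℂ) ^ a.val • w) (by simp [h2])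
    (fun a b x w hx hw => ?_) (by simp) (fun a v w hv hw => by rw [map_add, hv, hw, smul_add])
    (fun a c v hv => by rw [map_smul, hv, smul_comm]) hw
  have hx' : L.localGrading a ≤ LinearMap.ker (ρ - (-1 : ℂ) ^ a.val • L.envOp) := by
    refine L.localGrading_le fun n u hu => ?_
    rw [LinearMap.mem_ker, LinearMap.sub_apply, h1, LinearMap.comp_apply, LinearMap.comp_apply,
      hσ a u hu, map_smul, map_smul, LinearMap.smul_apply, sub_self]
  have hx'' := hx' hx
  rw [LinearMap.mem_ker, LinearMap.sub_apply, sub_eq_zero] at hx''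
  rw [h3, hw, hx'', LinearMap.smul_apply, LinearMap.smul_apply, map_smul, smul_smul,
    neg_one_pow_val_add]

section Deriv

variable {M : Type*} [AddCommGroup M] [Module ℂ M]

/-- The operators `(w, w') ↦ (uₙ w, uₙ w' + (D u)ₙ w)`. -/
def derivMode (f : ℤ → U →ₗ[ℂ] Module.End ℂ M) (n : ℤ) : U →ₗ[ℂ] Module.End ℂ (M × M) where
  toFun u := (f n u ∘ₗ LinearMap.fst ℂ M M).prod
    (f n u ∘ₗ LinearMap.snd ℂ M M + f n (L.D u) ∘ₗ LinearMap.fst ℂ M M)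
  map_add' u v := by
    refine LinearMap.ext fun w => Prod.ext ?_ ?_
    · simp
    · simp; abel
  map_smul' c u := by
    refine LinearMap.ext fun w => Prod.ext ?_ ?_
    · simp
    · simp

theorem derivMode_apply (f : ℤ → U →ₗ[ℂ] Module.End ℂ M) (n : ℤ) (u : U) (w : M × M) :
    L.derivMode f n u w = (f n u w.1, f n u w.2 + f n (L.D u) w.1) := rfl

theorem derivMode_D {f : ℤ → U →ₗ[ℂ] Module.End ℂ M}
    (hD : ∀ n u, f n (L.D u) = -(n : ℂ) • f (n - 1) u) (n : ℤ) (u : U) :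
    L.derivMode f n (L.D u) = -(n : ℂ) • L.derivMode f (n - 1) u := by
  refine LinearMap.ext fun w => ?_
  rw [LinearMap.smul_apply, derivMode_apply, derivMode_apply, hD, hD, Prod.smul_mk, smul_add]
  rfl

/-- The operators are those of `u + ε D u` over the dual numbers. The first component is the given
relation; the second is its linearization, which holds because `D` is a derivation of the products
of `U`. -/
theorem derivMode_comm {f : ℤ → U →ₗ[ℂ] Module.End ℂ M}
    (hf : ∀ a b u v, u ∈ L.grading a → v ∈ L.grading b → ∀ n p w, f n u (f p v w) =
      superSign a b • f p v (f n u w) +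
        ∑ᶠ i : ℕ, intChoose n i • f (n + p - i) (L.mul i u v) w)
    (a b : ZMod 2) (u v : U) (hu : u ∈ L.grading a) (hv : v ∈ L.grading b) (n p : ℤ) (w : M × M) :
    L.derivMode f n u (L.derivMode f p v w) =
      superSign a b • L.derivMode f p v (L.derivMode f n u w) +
        ∑ᶠ i : ℕ, intChoose n i • L.derivMode f (n + p - i) (L.mul i u v) w := by
  obtain ⟨N, hN⟩ := L.truncation u v
  obtain ⟨N1, hN1⟩ := L.truncation (L.D u) v
  obtain ⟨N2, hN2⟩ := L.truncation u (L.D v)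
  have hz : ∀ {K : ℕ} {u v : U}, (∀ i, K ≤ i → L.mul i u v = 0) → ∀ w (i : ℕ), K ≤ i →
      intChoose n i • f (n + p - i) (L.mul i u v) w = 0 := fun h w i hi => by
    rw [h i hi, map_zero, LinearMap.zero_apply, smul_zero]
  have e1 := hf a b u v hu hv n p w.1
  have e2 := hf a b u v hu hv n p w.2
  have e3 := hf a b _ v (L.D_even a u hu) hv n p w.1
  have e4 := hf a b u _ hu (L.D_even b v hv) n p w.1
  rw [finsum_eq_range _ (N + N1 + N2) (hz (fun i hi => hN i (by omega)) _)] at e1 e2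
  rw [finsum_eq_range _ (N + N1 + N2) (hz (fun i hi => hN1 i (by omega)) _)] at e3
  rw [finsum_eq_range _ (N + N1 + N2) (hz (fun i hi => hN2 i (by omega)) _)] at e4
  rw [finsum_eq_range _ (N + N1 + N2) fun i hi => by
    rw [hN i (by omega), map_zero, LinearMap.zero_apply, smul_zero]]
  have hDm : ∀ i, L.D (L.mul i u v) = L.mul i u (L.D v) + L.mul i (L.D u) v := fun i => by
    rw [← L.D_comm]; abel
  refine Prod.ext ?_ ?_
  · rw [Prod.fst_add, Prod.fst_sum]
    exact e1
  · rw [Prod.snd_add, Prod.snd_sum]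
    simp only [derivMode_apply, Prod.smul_mk, hDm, map_add, LinearMap.add_apply, smul_add,
      Finset.sum_add_distrib, e2, e3, e4]
    abel

end Deriv

/-- The universal property, applied to the dual-number action of `derivMode` and the vector `(1,
0)`, gives a map into pairs. Its first component is the identity, since it fixes the vacuum and
commutes with the modes; its second component is the derivation. -/
theorem exists_env_deriv : ∃ D : L.Enveloping →ₗ[ℂ] L.Enveloping, D L.envVac = 0 ∧
    ∀ n u w, D (L.envMode n u w) = L.envMode n (L.D u) w + L.envMode n u (D w) := by
  let f : ℤ → U →ₗ[ℂ] Module.End ℂ L.Enveloping := fun n => L.envOp ∘ₗ L.mode n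
  have hf : ∀ n u w, f n u w = L.envMode n u w := fun _ _ _ => rfl
  obtain ⟨ρ, ψ, h1, h2, h3⟩ := L.exists_mode_lift (L.derivMode f)
    (L.derivMode_D fun n u => by
      simp only [f, LinearMap.comp_apply, mode_D, map_smul])
    (L.derivMode_comm fun a b u v hu hv n p w => L.envMode_comm hu hv n p w)
    (L.envVac, 0) (fun n u hn => by
      rw [derivMode_apply, map_zero, zero_add, hf, hf, L.envMode_nonneg_vac hn,
        L.envMode_nonneg_vac hn]
      rfl)
  have hψ : ∀ n u w, ψ (L.envMode n u w) = L.derivMode f n u (ψ w) := fun n u w => by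
    rw [← envOp_mode, h3, h1]
  have hfst : ∀ w, (ψ w).1 = w := by
    intro w
    have hker : LinearMap.ker (LinearMap.fst ℂ _ _ ∘ₗ ψ - LinearMap.id) = ⊤ := by
      refine L.env_generate ?_ fun a u hu n w hw => ?_
      · rw [LinearMap.mem_ker, LinearMap.sub_apply, sub_eq_zero, LinearMap.comp_apply, h2]
        rfl
      · rw [LinearMap.mem_ker, LinearMap.sub_apply, sub_eq_zero] at hw ⊢
        rw [LinearMap.comp_apply, hψ, derivMode_apply]
        exact congrArg (L.envMode n u) hw
    have hw : w ∈ LinearMap.ker (LinearMap.fst ℂ _ _ ∘ₗ ψ - LinearMap.id) := by rw [hker]; trivial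
    rw [LinearMap.mem_ker, LinearMap.sub_apply, sub_eq_zero] at hw
    exact hw
  refine ⟨LinearMap.snd ℂ _ _ ∘ₗ ψ, ?_, fun n u w => ?_⟩
  · rw [LinearMap.comp_apply, h2]
    rfl
  · rw [LinearMap.comp_apply, hψ, derivMode_apply, LinearMap.snd_apply, hfst, hf, hf, add_comm]
    rfl

/-- The derivation of `𝒱(U)`. -/
def envD : L.Enveloping →ₗ[ℂ] L.Enveloping := L.exists_env_deriv.choose

theorem envD_vac : L.envD L.envVac = 0 := L.exists_env_deriv.choose_spec.1

theorem envD_mode (n : ℤ) (u : U) (w : L.Enveloping) :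
    L.envD (L.envMode n u w) = L.envMode n (L.D u) w + L.envMode n u (L.envD w) :=
  L.exists_env_deriv.choose_spec.2 n u w

/-- The fields `∑ uₙ z^{-n-1}`, for homogeneous `u`, generate `𝒱(U)`. -/
def envGenerators : GeneratingFields L.Enveloping (Σ a, L.grading a) where
  grading := L.envGrading
  isInternal := L.envGrading_isInternal
  vac := L.envVac
  vac_even := L.envVac_even
  D := L.envD
  D_vac := L.envD_vac
  parity x := x.1
  field x := L.envField x.2
  covariant x n v := by
    change L.envD (L.envMode n x.2.1 v) - L.envMode n x.2.1 (L.envD v) =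
      -(n : ℂ) • L.envMode (n - 1) x.2.1 v
    rw [envD_mode, add_sub_cancel_right, ← envOp_mode, mode_D, map_smul, LinearMap.smul_apply,
      envOp_mode]
  creative x n hn := L.envMode_nonneg_vac hn _
  homog x n b v hv := L.envOp_mem (L.mode_mem x.2.2 n) hv
  isLocal x y := L.isLocal_envField x.2.2 y.2.2
  generate W h0 h := L.env_generate h0 fun a u hu n w hw => h ⟨a, u, hu⟩ n w hw

theorem isEnvelopingStructure : L.IsEnvelopingStructure L.envGenerators.vertexSuperalgebra where
  grading_eq _ := rfl
  vac_eq := rfl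
  D_vac := L.envD_vac
  D_mode := L.envD_mode
  mul_eq n u w := by
    refine homogeneous_induction L.iSup_grading (p := fun u =>
      L.envGenerators.vertexSuperalgebra.mul n (L.envMode (-1) u L.envVac) w = L.envMode n u w)
      (fun a u hu => ?_) (fun u v hu hv => ?_) u
    · exact L.envGenerators.vertexSuperalgebra_mul ⟨a, u, hu⟩ n w
    · rw [envMode_add, map_add, LinearMap.add_apply, hu, hv, envMode_add]

end VertexLieSuperalgebra

/-! ### Injectivity of the map `κ` -/

/-- The lexicographic order of the pairs `(i ∈ pos, i)`, for any well-order of `I`, puts `pos` last.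
-/
theorem exists_wellOrder_isUpperSet {I : Type*} (pos : Set I) :
    ∃ (_ : LinearOrder I) (_ : WellFoundedLT I), IsUpperSet pos := by
  classical
  obtain ⟨o, ho⟩ := exists_wellFoundedLT I
  let f : I → Bool ×ₗ I := fun i => toLex (decide (i ∈ pos), i)
  have hf : Function.Injective f := fun i j h => congrArg (fun x => (ofLex x).2) h
  have hwf : WellFounded fun x y : Bool ×ₗ I => x < y := wellFounded_lt
  have key : ∀ i j, f i ≤ f j → i ∈ pos → j ∈ pos := by
    intro i j h hi
    rw [Prod.Lex.le_iff] at h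
    rcases h with h | ⟨h, -⟩
    · have h' : decide (i ∈ pos) < decide (j ∈ pos) := h
      rw [decide_eq_true hi] at h'
      exact absurd h' (by simp)
    · have h' : decide (i ∈ pos) = decide (j ∈ pos) := h
      rw [decide_eq_true hi] at h'
      exact of_decide_eq_true h'.symm
  exact ⟨LinearOrder.lift' f hf, ⟨InvImage.wf f hwf⟩, fun i j hij hi => key i j hij hi⟩

/-- A homogeneous basis, with a well-order, of which an upper segment spans a given graded
subspace. -/
theorem exists_homogeneous_basis.{u} {L : Type u} [AddCommGroup L] [Module ℂ L]
    {gr : ZMod 2 → Submodule ℂ L} (h : DirectSum.IsInternal gr) {P : Submodule ℂ L}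
    (hP : P ≤ ⨆ a, P ⊓ gr a) :
    ∃ (I : Type u) (_ : LinearOrder I) (_ : WellFoundedLT I) (b : Module.Basis I ℂ L)
      (deg : I → ZMod 2) (pos : Set I), (∀ i, b i ∈ gr (deg i)) ∧ IsUpperSet pos ∧
        Submodule.span ℂ (b '' pos) = P := by
  -- In each degree a basis of the part of `P` is joined with one of a complement. The left summands
  -- then span `P`, because `P` is the sum of its homogeneous parts.
  let Q : ∀ a, Submodule ℂ (gr a) := fun a => P.comap (gr a).subtype
  choose C hC using fun a => (Q a).exists_isCompl
  let bQ := fun a => Module.Basis.ofVectorSpace ℂ (Q a)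
  let b := h.collectedBasis fun a =>
    ((bQ a).prod (Module.Basis.ofVectorSpace ℂ (C a))).map ((Q a).prodEquivOfIsCompl (C a) (hC a))
  have hb : ∀ a j, b ⟨a, Sum.inl j⟩ = ((bQ a j : gr a) : L) := by
    intro a j
    simp [b, DirectSum.IsInternal.collectedBasis_coe]
  let pos := {i : Σ a, (Module.Basis.ofVectorSpaceIndex ℂ (Q a) ⊕
    Module.Basis.ofVectorSpaceIndex ℂ (C a)) | i.2.isLeft = true}
  obtain ⟨o, hw, hpos⟩ := exists_wellOrder_isUpperSet pos
  refine ⟨_, o, hw, b, Sigma.fst, pos, fun i => ?_, hpos, le_antisymm ?_ (hP.trans ?_)⟩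
  · exact h.collectedBasis_mem _ i
  · refine Submodule.span_le.2 ?_
    rintro _ ⟨⟨a, j | j⟩, hi, rfl⟩
    · rw [hb]
      exact (bQ a j).2
    · simp [pos] at hi
  · refine iSup_le fun a v hv => ?_
    have hle : (⊤ : Submodule ℂ (Q a)) ≤
        (Submodule.span ℂ (b '' pos)).comap ((gr a).subtype ∘ₗ (Q a).subtype) := by
      rw [← (bQ a).span_eq]
      refine Submodule.span_le.2 ?_
      rintro _ ⟨j, rfl⟩
      exact Submodule.subset_span ⟨⟨a, Sum.inl j⟩, rfl, hb a j⟩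
    exact hle (x := ⟨⟨v, hv.2⟩, hv.1⟩) trivial

namespace VertexLieSuperalgebra

variable {U : Type*} [AddCommGroup U] [Module ℂ U] (L : VertexLieSuperalgebra U)

theorem local_induction {W : Submodule ℂ L.LocalAlgebra}
    (h : ∀ a, ∀ u ∈ L.grading a, ∀ n, L.mode n u ∈ W) : W = ⊤ := by
  refine eq_top_iff.2 fun x _ => ?_
  obtain ⟨x, rfl⟩ := L.localRel.mkQ_surjective x
  induction x using Finsupp.induction_linear with
  | zero => simp
  | add x y hx hy => rw [map_add]; exact add_mem (hx trivial) (hy trivial)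
  | single n u =>
    exact homogeneous_induction L.iSup_grading (p := fun u => L.mode n u ∈ W)
      (fun a u hu => h a u hu n) (fun u v hu hv => by rw [map_add]; exact add_mem hu hv) u

/-- The parity operator of `U` commutes with `D`, so it descends to `ℒ(U)`, where it separates the
degrees. -/
theorem localGrading_isInternal : DirectSum.IsInternal L.localGrading := by
  obtain ⟨σ, hσ⟩ := L.exists_parity
  obtain ⟨ρ, hρ⟩ := L.exists_local_lift (fun n => L.mode n ∘ₗ σ) fun n u => by
    rw [LinearMap.comp_apply, L.parity_D hσ, mode_D, LinearMap.comp_apply]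
  refine isInternal_of_involution ρ (fun a x hx => ?_)
    (L.local_induction fun a u hu n => Submodule.mem_iSup_of_mem a (L.mode_mem hu n))
  have hle : L.localGrading a ≤ LinearMap.ker (ρ - (-1 : ℂ) ^ a.val • LinearMap.id) := by
    refine L.localGrading_le fun n u hu => ?_
    rw [LinearMap.mem_ker, LinearMap.sub_apply, hρ, LinearMap.comp_apply, hσ a u hu, map_smul,
      LinearMap.smul_apply, LinearMap.id_apply, sub_self]
  exact sub_eq_zero.1 (LinearMap.mem_ker.1 (hle hx))

theorem localPos_le_iSup : L.localPos ≤ ⨆ a, L.localPos ⊓ L.localGrading a := by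
  refine Submodule.span_le.2 ?_
  rintro _ ⟨u, n, hn, rfl⟩
  refine homogeneous_induction L.iSup_grading
    (p := fun u => L.mode n u ∈ ⨆ a, L.localPos ⊓ L.localGrading a) (fun a u hu => ?_)
    (fun u v hu hv => by rw [map_add]; exact add_mem hu hv) u
  exact Submodule.mem_iSup_of_mem a ⟨Submodule.subset_span ⟨u, n, hn, rfl⟩, L.mode_mem hu n⟩

/-- The projection of `ℒ(U)` to the `u₋₁`, along `ℒ₊(U)`. -/
theorem exists_residue : ∃ r : L.LocalAlgebra →ₗ[ℂ] U,
    (∀ x ∈ L.localPos, r x = 0) ∧ ∀ u, r (L.mode (-1) u) = u := by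
  -- The values are forced: in `ℒ(U)` one has `u_{-1-k} = (D^k u)₋₁ / k!`.
  obtain ⟨r, hr⟩ := L.exists_local_lift
    (fun n => if n < 0 then ((-1 - n).toNat.factorial : ℂ)⁻¹ • L.D ^ (-1 - n).toNat else 0)
    fun n u => by
      rcases lt_trichotomy n 0 with hn | rfl | hn
      · obtain ⟨k, rfl⟩ : ∃ k : ℕ, n = -1 - k := ⟨(-1 - n).toNat, by omega⟩
        have e1 : (-1 - (-1 - (k : ℤ))).toNat = k := by omega
        have e2 : (-1 - (-1 - (k : ℤ) - 1)).toNat = k + 1 := by omega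
        rw [if_pos hn, if_pos (by omega), e1, e2, LinearMap.smul_apply, LinearMap.smul_apply,
          smul_smul, pow_succ, Module.End.mul_apply, Nat.factorial_succ]
        congr 1
        have h1 : ((k.factorial : ℕ) : ℂ) ≠ 0 := by exact_mod_cast k.factorial_ne_zero
        have h2 : (k : ℂ) + 1 ≠ 0 := by exact_mod_cast k.succ_ne_zero
        push_cast
        field_simp
        ring
      · simp
      · rw [if_neg (by omega), if_neg (by omega), LinearMap.zero_apply, LinearMap.zero_apply,
          smul_zero]
  refine ⟨r, ?_, fun u => ?_⟩
  · have hle : L.localPos ≤ LinearMap.ker r := by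
      refine Submodule.span_le.2 ?_
      rintro _ ⟨u, n, hn, rfl⟩
      rw [SetLike.mem_coe, LinearMap.mem_ker, hr, if_neg (by omega), LinearMap.zero_apply]
    exact hle
  · rw [hr]
    simp

/-- By the Poincaré–Birkhoff–Witt theorem, only `ℒ₊(U)` kills the vacuum vector. -/
theorem mem_localPos_of_envOp_vac {x : L.LocalAlgebra} (h : L.envOp x L.envVac = 0) :
    x ∈ L.localPos := by
  obtain ⟨I, _, _, b, deg, pos, hdeg, hpos, hspan⟩ :=
    exists_homogeneous_basis L.localGrading_isInternal L.localPos_le_iSup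
  let B : OrderedSuperBasis L.LocalAlgebra I :=
    { grading := L.localGrading
      isInternal := L.localGrading_isInternal
      bracket := L.localBracket
      skew := L.localBracket_skew
      jacobi := L.localBracket_jacobi
      homog := L.localBracket_homog
      basis := b
      deg := deg
      basis_mem := hdeg
      pos := pos
      pos_upper := hpos
      bracket_pos := fun i hi j hj => by
        rw [hspan]
        refine L.localBracket_mem_localPos ?_ ?_ <;> rw [← hspan]
        · exact Submodule.subset_span ⟨i, hi, rfl⟩
        · exact Submodule.subset_span ⟨j, hj, rfl⟩ }
  obtain ⟨M, ρ, m, h1, h2, h3⟩ := B.exists_module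
  -- The vacuum is mapped to the empty monomial, so what kills the former kills the latter.
  obtain ⟨ψ, hψ, hψ'⟩ := L.exists_env_lift ρ h1 m fun x hx => h3 x (hspan.symm ▸ hx)
  rw [← hspan]
  refine h2 x ?_
  rw [← hψ, ← hψ', h, map_zero]

theorem envMode_vac_injective {u : U} (h : L.envMode (-1) u L.envVac = 0) : u = 0 := by
  obtain ⟨r, h1, h2⟩ := L.exists_residue
  rw [← h2 u]
  exact h1 _ (L.mem_localPos_of_envOp_vac h)

end VertexLieSuperalgebra

/-! ### Commutator and associator formulas -/

namespace VertexSuperalgebra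

variable {V : Type*} [AddCommGroup V] [Module ℂ V]

theorem ext_of_mul {S T : VertexSuperalgebra V} (hg : S.grading = T.grading) (hv : S.vac = T.vac)
    (hD : S.D = T.D) (hm : S.mul = T.mul) : S = T := by
  cases S
  cases T
  cases hg
  cases hv
  cases hD
  cases hm
  rfl

variable (S : VertexSuperalgebra V) {a b : ZMod 2} {u v : V}

/-- The Jacobi identity with `k = 0`. It makes every vertex superalgebra receiving `U` an
`ℒ(U)`-module. -/
theorem commutator_formula (hu : u ∈ S.grading a) (hv : v ∈ S.grading b) (m n : ℤ) (w : V) :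
    S.mul m u (S.mul n v w) = superSign a b • S.mul n v (S.mul m u w) +
      ∑ᶠ i : ℕ, intChoose m i • S.mul (m + n - i) (S.mul i u v) w := by
  have h := S.jacobi a b u v hu hv 0 m n w
  rw [finsum_eq_single _ 0 fun i hi => by
    obtain ⟨j, rfl⟩ := Nat.exists_eq_succ_of_ne_zero hi
    rw [intChoose_zero_succ, mul_zero, zero_smul]] at h
  simp only [pow_zero, intChoose_zero_right, mul_one, one_smul, add_zero, Nat.cast_zero, sub_zero,
    zpow_zero, zero_add] at h
  exact sub_eq_iff_eq_add'.1 h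

/-- The Jacobi identity with `m = 0`. It shows that products by `u_k v` are determined by those by
`u` and `v`. -/
theorem associator_formula (hu : u ∈ S.grading a) (hv : v ∈ S.grading b) (k n : ℤ) (w : V) :
    S.mul n (S.mul k u v) w = ∑ᶠ i : ℕ, ((-1) ^ i * intChoose k i) •
      (S.mul (k - i) u (S.mul (n + i) v w) -
        (superSign a b * (-1) ^ k) • S.mul (n + k - i) v (S.mul i u w)) := by
  have h := S.jacobi a b u v hu hv k 0 n w
  rw [finsum_eq_single (fun i : ℕ => intChoose 0 i • S.mul (0 + n - i) (S.mul (k + i) u v) w) 0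
    fun i hi => by
      obtain ⟨j, rfl⟩ := Nat.exists_eq_succ_of_ne_zero hi
      rw [intChoose_zero_succ, zero_smul]] at h
  simp only [intChoose_zero_right, one_smul, add_zero, Nat.cast_zero, sub_zero, zero_add] at h
  exact h.symm

theorem associator_finite (ε : ℂ) (k n : ℤ) (u v w : V) :
    (Function.support fun i : ℕ => ((-1) ^ i * intChoose k i) •
      (S.mul (k - i) u (S.mul (n + i) v w) - ε • S.mul (n + k - i) v (S.mul i u w))).Finite := by
  obtain ⟨N, hN⟩ := S.truncation v w
  obtain ⟨N', hN'⟩ := S.truncation u w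
  refine (Finset.range ((N - n).toNat + N'.toNat)).finite_toSet.subset fun i hi => ?_
  by_contra hc
  have hi' : (N - n).toNat + N'.toNat ≤ i := by simpa using hc
  refine hi ?_
  simp only
  rw [hN _ (by omega), hN' _ (by omega), map_zero, map_zero, smul_zero, sub_zero, smul_zero]

/-- If a linear map is compatible with the products by `u` and `v`, it is so with those by
`uₖ v`. -/
theorem map_mul_mul {W : Type*} [AddCommGroup W] [Module ℂ W] (T : VertexSuperalgebra W)
    {ψ : V →ₗ[ℂ] W} (hu : u ∈ S.grading a) (hv : v ∈ S.grading b) (hu' : ψ u ∈ T.grading a)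
    (hv' : ψ v ∈ T.grading b) (h : ∀ n w, ψ (S.mul n u w) = T.mul n (ψ u) (ψ w))
    (h' : ∀ n w, ψ (S.mul n v w) = T.mul n (ψ v) (ψ w)) (k n : ℤ) (w : V) :
    ψ (S.mul n (S.mul k u v) w) = T.mul n (ψ (S.mul k u v)) (ψ w) := by
  rw [h, T.associator_formula hu' hv', S.associator_formula hu hv,
    map_finsum ψ (S.associator_finite _ k n u v w)]
  exact finsum_congr fun i => by rw [map_smul, map_sub, map_smul, h, h', h', h]

end VertexSuperalgebra

/-! ### Uniqueness of the structure and the universal property -/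

namespace VertexLieSuperalgebra

variable {U : Type*} [AddCommGroup U] [Module ℂ U] (L : VertexLieSuperalgebra U)

theorem env_hom_ext {M : Type*} [AddCommGroup M] [Module ℂ M] {f g : L.Enveloping →ₗ[ℂ] M}
    (h0 : f L.envVac = g L.envVac)
    (h : ∀ n u w, f w = g w → f (L.envMode n u w) = g (L.envMode n u w)) : f = g := by
  have hker : LinearMap.ker (f - g) = ⊤ :=
    L.env_generate (sub_eq_zero.2 h0) fun a u _ n w hw => sub_eq_zero.2 (h n u w (sub_eq_zero.1 hw))
  exact sub_eq_zero.1 (LinearMap.ker_eq_top.1 hker)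

/-- The map `κ : U → 𝒱(U)`, `u ↦ u₋₁ 1`. -/
def envUnit : U →ₗ[ℂ] L.Enveloping := L.envOp.flip L.envVac ∘ₗ L.mode (-1)

theorem envUnit_apply (u : U) : L.envUnit u = L.envMode (-1) u L.envVac := rfl

theorem envUnit_mem {a : ZMod 2} {u : U} (hu : u ∈ L.grading a) : L.envUnit u ∈ L.envGrading a := by
  have h := L.envOp_mem (L.mode_mem hu (-1)) L.envVac_even
  rwa [add_zero] at h

/-- In `u_n v₋₁ 1 = ∑ (n choose i) (u_i v)_{n-1-i} 1` only `i = n` survives: for `i < n` the mode is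
nonnegative and kills the vacuum, for `i > n` the binomial coefficient is zero. -/
theorem envUnit_mul (n : ℕ) (u v : U) : L.envUnit (L.mul n u v) = L.envMode n u (L.envUnit v) := by
  refine homogeneous_induction L.iSup_grading
    (p := fun u => L.envUnit (L.mul n u v) = L.envMode n u (L.envUnit v)) (fun a u hu => ?_)
    (fun u u' h h' => by rw [map_add, LinearMap.add_apply, map_add, h, h', envMode_add]) u
  refine homogeneous_induction L.iSup_grading
    (p := fun v => L.envUnit (L.mul n u v) = L.envMode n u (L.envUnit v)) (fun b v hv => ?_)
    (fun v v' h h' => by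
      rw [map_add, map_add, h, h', map_add, ← envOp_mode, ← envOp_mode, ← envOp_mode, map_add]) v
  rw [envUnit_apply L v, L.envMode_comm hu hv, L.envMode_nonneg_vac (Int.natCast_nonneg n),
    ← envOp_mode, map_zero, smul_zero, zero_add, binSum, finsum_eq_single _ n fun i hi => ?_]
  · rw [VertexSuperalgebra.intChoose_natCast, Nat.choose_self, Nat.cast_one, one_smul]
    have e : (n : ℤ) + -1 - n = -1 := by ring
    rw [e, envUnit_apply]
  · rcases lt_or_gt_of_ne hi with h | h
    · rw [L.envMode_nonneg_vac (by omega), smul_zero]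
    · rw [VertexSuperalgebra.intChoose_natCast, Nat.choose_eq_zero_of_lt h, Nat.cast_zero,
        zero_smul]

variable {L} {S : VertexSuperalgebra L.Enveloping}

namespace IsEnvelopingStructure

variable (hS : L.IsEnvelopingStructure S)
include hS

/-- The vectors by which products are respected include the vacuum and all `κ(u)`, and are closed
under products by the associator formula; since the `κ(u)` generate, these are all vectors. Both the
uniqueness of the structure and the extension of homomorphisms reduce to this. -/
theorem map_of_envMode {V : Type*} [AddCommGroup V] [Module ℂ V] (T : VertexSuperalgebra V)
    {φ : U → V} (hφ : ∀ a, ∀ u ∈ L.grading a, φ u ∈ T.grading a) {ψ : L.Enveloping →ₗ[ℂ] V}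
    (hvac : ψ L.envVac = T.vac) (hψ : ∀ n u w, ψ (L.envMode n u w) = T.mul n (φ u) (ψ w)) :
    (∀ a, ∀ v ∈ S.grading a, ψ v ∈ T.grading a) ∧
      ∀ n v w, ψ (S.mul n v w) = T.mul n (ψ v) (ψ w) := by
  -- Homogeneity of `v` and of `ψ v` is part of the condition, because the sign in the associator
  -- formula depends on it.
  let Z : ZMod 2 → Submodule ℂ L.Enveloping := fun a =>
    { carrier := {v | v ∈ S.grading a ∧ ψ v ∈ T.grading a ∧
        ∀ n w, ψ (S.mul n v w) = T.mul n (ψ v) (ψ w)}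
      add_mem' := fun {v v'} h h' => ⟨add_mem h.1 h'.1, by
        rw [map_add]; exact add_mem h.2.1 h'.2.1, fun n w => by
        rw [map_add, map_add, map_add, LinearMap.add_apply, LinearMap.add_apply, map_add, h.2.2,
          h'.2.2]⟩
      zero_mem' := ⟨zero_mem _, by rw [map_zero]; exact zero_mem _, fun n w => by
        rw [map_zero, map_zero, map_zero, LinearMap.zero_apply, LinearMap.zero_apply, map_zero]⟩
      smul_mem' := fun c v h => ⟨Submodule.smul_mem _ c h.1, by
        rw [map_smul]; exact Submodule.smul_mem _ c h.2.1, fun n w => by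
        rw [map_smul, map_smul, map_smul, LinearMap.smul_apply, LinearMap.smul_apply, map_smul,
          h.2.2]⟩ }
  have hunit : ∀ u, ψ (L.envUnit u) = φ u := fun u => by
    rw [envUnit_apply, hψ, hvac, T.mul_vac]
  have hZunit : ∀ a, ∀ u ∈ L.grading a, L.envUnit u ∈ Z a := fun a u hu =>
    ⟨by rw [hS.grading_eq]; exact L.envUnit_mem hu, by rw [hunit]; exact hφ a u hu, fun n w => by
      rw [hunit, envUnit_apply, hS.mul_eq, hψ]⟩
  have hvacZ : L.envVac ∈ Z 0 := by
    refine ⟨by rw [← hS.vac_eq]; exact S.vac_even, by rw [hvac]; exact T.vac_even, fun n w => ?_⟩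
    rw [hvac, T.vac_mul, ← hS.vac_eq, S.vac_mul]
    split_ifs
    · rfl
    · rw [map_zero]
  have htop : ⨆ a, Z a = ⊤ := by
    refine L.env_generate (Submodule.mem_iSup_of_mem 0 hvacZ) fun a u hu n w hw => ?_
    rw [← hS.mul_eq, ← envUnit_apply]
    have hx := hZunit a u hu
    induction hw using Submodule.iSup_induction' with
    | mem b w hw =>
      refine Submodule.mem_iSup_of_mem (a + b) ⟨S.homog a b _ _ hx.1 hw.1 n, ?_, fun k v => ?_⟩
      · rw [hx.2.2]
        exact T.homog a b _ _ hx.2.1 hw.2.1 n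
      · exact S.map_mul_mul T hx.1 hw.1 hx.2.1 hw.2.1 hx.2.2 hw.2.2 n k v
    | zero => rw [map_zero]; exact zero_mem _
    | add v w _ _ hv hw => rw [map_add]; exact add_mem hv hw
  have hZ : ∀ a, Z a = S.grading a := eq_of_le_of_isInternal S.isInternal (fun a v hv => hv.1) htop
  refine ⟨fun a v hv => ?_, fun n v w => ?_⟩
  · rw [← hZ] at hv
    exact hv.2.1
  · exact homogeneous_induction htop (p := fun v => ψ (S.mul n v w) = T.mul n (ψ v) (ψ w))
      (fun a v hv => hv.2.2 n w) (fun v v' h h' => by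
        rw [map_add, LinearMap.add_apply, map_add, h, h', map_add, map_add,
          LinearMap.add_apply]) v

/-- The identity map satisfies the hypotheses of `map_of_envMode` with target `S'`, so the two
structures have the same products; the derivations agree on the vacuum and under all modes. -/
theorem unique {S' : VertexSuperalgebra L.Enveloping} (hS' : L.IsEnvelopingStructure S') :
    S' = S := by
  refine VertexSuperalgebra.ext_of_mul (funext fun a => by rw [hS.grading_eq, hS'.grading_eq])
    (by rw [hS.vac_eq, hS'.vac_eq]) (L.env_hom_ext (by rw [hS.D_vac, hS'.D_vac]) fun n u w h => ?_)
    ?_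
  · rw [hS.D_mode, hS'.D_mode, h]
  · have h := (hS.map_of_envMode S' (φ := L.envUnit) (ψ := LinearMap.id)
      (fun a u hu => by rw [hS'.grading_eq]; exact L.envUnit_mem hu) hS'.vac_eq.symm
      fun n u w => (hS'.mul_eq n u w).symm).2
    exact funext fun n => LinearMap.ext fun v => LinearMap.ext fun w => (h n v w).symm

/-- The map `κ`, as a homomorphism of vertex Lie superalgebras. -/
def unit : L.Hom S.toVertexLieSuperalgebra where
  toLinearMap := L.envUnit
  map_grading a u hu := by
    change L.envUnit u ∈ S.grading a
    rw [hS.grading_eq]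
    exact L.envUnit_mem hu
  map_mul n u v := by
    change _ = S.mul n (L.envUnit u) (L.envUnit v)
    rw [envUnit_mul, envUnit_apply L u, hS.mul_eq]
  map_D u := by
    change _ = S.D (L.envUnit u)
    rw [envUnit_apply, envUnit_apply, hS.D_mode, hS.D_vac, ← envOp_mode L (-1) u, map_zero,
      add_zero]

variable {V : Type*} [AddCommGroup V] [Module ℂ V] (T : VertexSuperalgebra V)
  (φ : L.Hom T.toVertexLieSuperalgebra)

/-- The modes of the vectors `φ(u)` satisfy the relations of `ℒ(U)` by the commutator formula, and
the nonnegative ones kill the vacuum of `V`. The resulting module homomorphism respects all products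
by `map_of_envMode`. -/
theorem exists_hom : ∃ ψ : S.Hom T, ∀ u, ψ.toLinearMap (L.envUnit u) = φ.toLinearMap u := by
  obtain ⟨ρ, ψ, h1, h2, h3⟩ := L.exists_mode_lift (fun n => T.mul n ∘ₗ φ.toLinearMap)
    (fun n u => by
      rw [LinearMap.comp_apply, φ.map_D]
      exact LinearMap.ext fun w => T.mul_D n _ w)
    (fun a b u v hu hv n p w => by
      have h := T.commutator_formula (φ.map_grading a u hu) (φ.map_grading b v hv) n p w
      simp only [LinearMap.comp_apply, φ.map_mul]
      exact h)
    T.vac (fun n u hn => T.mul_vac_nonneg n hn _)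
  have hψ : ∀ n u w, ψ (L.envMode n u w) = T.mul n (φ.toLinearMap u) (ψ w) := fun n u w => by
    rw [← envOp_mode, h3, h1, LinearMap.comp_apply]
  obtain ⟨hg, hm⟩ := hS.map_of_envMode T φ.map_grading h2 hψ
  refine ⟨⟨ψ, hg, hm, by rw [hS.vac_eq, h2]⟩, fun u => ?_⟩
  rw [envUnit_apply]
  exact (hψ _ _ _).trans (by rw [h2, T.mul_vac])

theorem hom_unique {ψ ψ' : S.Hom T}
    (h : ∀ u, ψ.toLinearMap (L.envUnit u) = ψ'.toLinearMap (L.envUnit u)) : ψ = ψ' := by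
  have e : ψ.toLinearMap = ψ'.toLinearMap := by
    refine L.env_hom_ext (by rw [← hS.vac_eq, ψ.map_vac, ψ'.map_vac]) fun n u w hw => ?_
    rw [← hS.mul_eq, ψ.map_mul, ψ'.map_mul, ← envUnit_apply, h, hw]
  cases ψ
  cases ψ'
  cases e
  rfl

end IsEnvelopingStructure

end VertexLieSuperalgebra

end

theorem theorem5p5 {U : Type*} [AddCommGroup U] [Module ℂ U]
    (L : VertexLieSuperalgebra U) :
    ∃ S : VertexSuperalgebra L.Enveloping,
      L.IsEnvelopingStructure S ∧
      (∀ S' : VertexSuperalgebra L.Enveloping, L.IsEnvelopingStructure S' → S' = S) ∧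
      ∃ κ : VertexLieSuperalgebra.Hom L S.toVertexLieSuperalgebra,
        (∀ u, κ.toLinearMap u = L.envMode (-1) u L.envVac) ∧
        Function.Injective κ.toLinearMap ∧
        ∀ (V : Type*) [AddCommGroup V] [Module ℂ V] (T : VertexSuperalgebra V)
          (φ : VertexLieSuperalgebra.Hom L T.toVertexLieSuperalgebra),
          ∃! ψ : VertexSuperalgebra.Hom S T,
            ∀ u, ψ.toLinearMap (κ.toLinearMap u) = φ.toLinearMap u := by
  have hS := L.isEnvelopingStructure
  refine ⟨_, hS, fun S' hS' => hS.unique hS', hS.unit, fun u => rfl,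
    (injective_iff_map_eq_zero _).2 fun u hu => L.envMode_vac_injective hu,
    fun V _ _ T φ => ?_⟩
  obtain ⟨ψ, hψ⟩ := hS.exists_hom T φ
  exact ⟨ψ, hψ, fun ψ' hψ' => hS.hom_unique T fun u => (hψ' u).trans (hψ u).symm⟩
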